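/- A \emph{Manin triple} $(\mathfrak d,\langle\cdot,\cdot\rangle,\mathfrak g,\mathfrak h)$ is a finite-dimensional real Lie algebra $\mathfrak d$ with an invariant symmetric bilinear pairing and a vector space splitting $\mathfrak d=\mathfrak g\oplus\mathfrak h$ into Lagrangian Lie subalgebras ($\mathfrak g=\mathfrak g^\perp$, $\mathfrak h=\mathfrak h^\perp$); thus $\mathfrak h\cong\mathfrak g^*$. It is \emph{$G$-invariant} if $G$ is a Lie group with Lie algebra $\mathfrak g$, together with a smooth linear action $\mathrm{Ad}:G\curvearrowright\mathfrak d$ which extends the adjoint action of $G$ on $\mathfrak g$, integrates the bracket action $\mathrm{ad}:\mathfrak g\curvearrowright\mathfrak d$, and preserves the bracket and the pairing of $\mathfrak d$. Let $\theta^L$ be the left-invariant Maurer--Cartan form of $G$, and for $v\in\mathfrak d$ let $\varrho(v)$ be the vector field on $G$ with $\mathrm{Ad}_g(\iota_{\varrho(v)}\theta^L_g)=\mathrm{pr}_{\mathfrak g}\mathrm{Ad}_g(v)$, where $\mathrm{pr}_{\mathfrak g}$ is the projection along $\mathfrak h$. The associated Poisson--Lie structure $\pi_G$ on $G$ is the bivector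 field determined by $\pi_G^\sharp\langle\theta^L,w\rangle=\varrho(w)$ for all $w\in\mathfrak h$. \textbf{Proposition.} Let $(G,\pi_G)$ be the Poisson--Lie group of a $G$-invariant Manin triple $(\mathfrak d,\langle\cdot,\cdot\rangle,\mathfrak g,\mathfrak h)$, let $K\subset G$ be a connected closed subgroup with Lie algebra $\mathfrak k\subset\mathfrak g$, let $\mathfrak k^\circ=\{w\in\mathfrak h : \langle v,w\rangle=0 \text{ for all } v\in\mathfrak k\}$, and let $p:G\to M:=G/K$ be the quotient map of the action $K\curvearrowright G$, $(k,g)\mapsto gk^{-1}$. a) $\pi_G$ is $K$-invariant if and only if $[\mathfrak k,\mathfrak h]\subset\mathfrak h$; in that case $\pi_G$ vanishes at all points of $K$. b) The following are equivalent: $K$ is a Poisson submanifold of $(G,\pi_G)$ (i.e. $\pi_G$ is tangent to $K$); $\mathfrak k^\circ$ is an ideal of $\mathfrak h$; $[\mathfrak k,\mathfrak k^\circ]\subset\mathfrak h$. c) There is a Poisson structure $\pi_M$ on $M$ for which $p:(G,\pi_G)\to(M,\pi_M)$ is a Poisson submersion if and only if $\mathfrak k^\circ$ is a Lie subalgebra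 of $\mathfrak h$. d) Suppose that $K$ is a Poisson submanifold. Then all fibres of $p$ are Poisson--Dirac submanifolds of $(G,\pi_G)$ if and only if $\mathrm{Ad}_G(\mathfrak h)\cap(\mathfrak k\oplus\mathfrak k^\circ)\subset\mathfrak k^\circ$, where $\mathrm{Ad}_G(\mathfrak h)=\bigcup_{g\in G}\mathrm{Ad}_g(\mathfrak h)$. In that case, the induced Poisson structures on the fibres are all zero if and only if $\mathrm{Ad}_G(\mathfrak h)\cap(\mathfrak k\oplus\mathfrak h)\subset\mathfrak h$. Here a submanifold $i:X\to G$ is \emph{Poisson--Dirac}, with induced Poisson structure $\pi_X$, if $\{u+i^*\xi : i_*u=\pi_G^\sharp(\xi)\}$ is the graph of a (smooth) Poisson structure $\pi_X$ on $X$. -/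

import Mathlib

open scoped Manifold ContDiff

noncomputable section

section Poisson

variable {E : Type*} [NormedAddCommGroup E] [NormedSpace ℝ E] {H : Type*} [TopologicalSpace H]
  (I : ModelWithCorners ℝ E H) {M : Type*} [TopologicalSpace M] [ChartedSpace H M]
  {E' : Type*} [NormedAddCommGroup E'] [NormedSpace ℝ E'] {H' : Type*} [TopologicalSpace H']
  (J : ModelWithCorners ℝ E' H') {N : Type*} [TopologicalSpace N] [ChartedSpace H' N]

/-- The tangent map `T_x M → T_{f x} N` of `f`, as a linear map. -/
def tangentLin (f : M → N) (x : M) : TangentSpace I x →ₗ[ℝ] TangentSpace J (f x) :=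
  (mfderiv I J f x).toLinearMap

/-- The differential `df_x ∈ T_x^* M` of a real function `f`. -/
def differential (f : M → ℝ) (x : M) : Module.Dual ℝ (TangentSpace I x) :=
  (mfderiv I 𝓘(ℝ, ℝ) f x).toLinearMap

variable (M) in
/-- A (not necessarily smooth) bivector field `π` on `M`: at every point `x` an element of
`∧² T_x M`, given as the skew-symmetric map `π^♯ : T_x^* M → T_x M`. -/
@[ext]
structure BivectorField where
  /-- The map `π^♯ : T_x^* M → T_x M`. -/
  sharp : ∀ x : M, Module.Dual ℝ (TangentSpace I x) →ₗ[ℝ] TangentSpace I x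
  skew : ∀ (x : M) (ξ η : Module.Dual ℝ (TangentSpace I x)), ξ (sharp x η) = -η (sharp x ξ)

namespace BivectorField

variable {I J}

/-- The bracket `{f, g} = π(df, dg) = dg (π^♯ df)` of functions. -/
def bracket (π : BivectorField I M) (f g : M → ℝ) : M → ℝ :=
  fun x => differential I g x (π.sharp x (differential I f x))

/-- `π` is a smooth bivector field; on a Hausdorff manifold, where all covectors are values of
differentials of global smooth functions, this can be tested on `π(df, dg)`. -/
def IsSmooth (π : BivectorField I M) : Prop :=
  ∀ f g : M → ℝ, ContMDiff I 𝓘(ℝ, ℝ) ∞ f → ContMDiff I 𝓘(ℝ, ℝ) ∞ g →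
    ContMDiff I 𝓘(ℝ, ℝ) ∞ (π.bracket f g)

/-- `π` is a Poisson structure: it is smooth and its bracket satisfies the Jacobi identity. -/
def IsPoisson (π : BivectorField I M) : Prop :=
  π.IsSmooth ∧
  ∀ f g h : M → ℝ, ContMDiff I 𝓘(ℝ, ℝ) ∞ f → ContMDiff I 𝓘(ℝ, ℝ) ∞ g →
    ContMDiff I 𝓘(ℝ, ℝ) ∞ h → ∀ x,
      π.bracket f (π.bracket g h) x + π.bracket g (π.bracket h f) x +
        π.bracket h (π.bracket f g) x = 0

/-- `f : (M, π) → (N, σ)` maps `π` to `σ`, that is `f_* π_x = σ_{f x}` for all `x`. -/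
def Pushes (f : M → N) (π : BivectorField I M) (σ : BivectorField J N) : Prop :=
  ∀ (x : M) (ξ : Module.Dual ℝ (TangentSpace J (f x))),
    tangentLin I J f x (π.sharp x (ξ ∘ₗ tangentLin I J f x)) = σ.sharp (f x) ξ

/-- The embedded submanifold `i : M → N` is a Poisson submanifold of `(N, σ)`: the bivector `σ` is
tangent to it, that is `σ^♯` takes values in the tangent spaces of the submanifold. -/
def IsPoissonSubmanifold (i : M → N) (σ : BivectorField J N) : Prop :=
  ∀ (x : M) (ξ : Module.Dual ℝ (TangentSpace J (i x))),
    σ.sharp (i x) ξ ∈ LinearMap.range (tangentLin I J i x)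

/-- `π` is the bivector field induced by `σ` on the submanifold `i : M → N`, that is
`Gr(π) = i^! Gr(σ) = {u + i^* ξ | i_* u + ξ ∈ Gr(σ)}` at every point. -/
def IsInduced (i : M → N) (σ : BivectorField J N) (π : BivectorField I M) : Prop :=
  ∀ (x : M) (u : TangentSpace I x) (η : Module.Dual ℝ (TangentSpace I x)),
    π.sharp x η = u ↔
      ∃ ξ : Module.Dual ℝ (TangentSpace J (i x)),
        σ.sharp (i x) ξ = tangentLin I J i x u ∧ η = ξ ∘ₗ tangentLin I J i x

variable (I) in
/-- The embedded submanifold `i : M → N` of `(N, σ)` is Poisson-Dirac: `i^! Gr(σ)` is the graph of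
a Poisson structure. -/
def IsPoissonDirac (i : M → N) (σ : BivectorField J N) : Prop :=
  ∃ π : BivectorField I M, π.IsPoisson ∧ IsInduced i σ π

end BivectorField

end Poisson

section LieGroup

variable {E : Type*} [NormedAddCommGroup E] [NormedSpace ℝ E] {H : Type*} [TopologicalSpace H]
  (I : ModelWithCorners ℝ E H) {G : Type*} [TopologicalSpace G] [ChartedSpace H G] [Group G]

/-- The adjoint action of `g` on the Lie algebra of `G`: the derivative at `1` of conjugation. -/
def adjointMap (g : G) : GroupLieAlgebra I G →ₗ[ℝ] GroupLieAlgebra I G :=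
  tangentLin I I (fun x : G => g * x * g⁻¹) 1

/-- The left-invariant Maurer-Cartan form `θ^L_g : T_g G → 𝔤`. -/
def maurerCartan (g : G) : TangentSpace I g →ₗ[ℝ] GroupLieAlgebra I G :=
  tangentLin I I (fun x : G => g⁻¹ * x) g

/-- `π` is invariant under the action `(k, g) ↦ g k⁻¹` of the subgroup `K`: every map `g ↦ g k⁻¹`
with `k ∈ K` maps `π` to itself. -/
def IsRightInvariant (K : Subgroup G) (π : BivectorField I G) : Prop :=
  ∀ k ∈ K, π.Pushes (fun g : G => g * k⁻¹) π

/-- The Lie algebra `𝔨 ⊆ 𝔤` of a subgroup `K` that carries the structure of an embedded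
submanifold: the tangent space of `K` at `1`. -/
def subgroupLieAlgebra {E' : Type*} [NormedAddCommGroup E'] [NormedSpace ℝ E'] {H' : Type*}
    [TopologicalSpace H'] (J : ModelWithCorners ℝ E' H') (K : Subgroup G) [ChartedSpace H' K] :
    Submodule ℝ (GroupLieAlgebra I G) :=
  LinearMap.range (tangentLin J I (Subtype.val : K → G) 1)

theorem maurerCartan_translate [LieGroup I ∞ G] (g : G) (v : GroupLieAlgebra I G) :
    maurerCartan I g (tangentLin I I (fun x : G => g * x) 1 v) = v := by
  have hd : ∀ (a x : G), MDifferentiableAt I I (fun y : G => a * y) x := fun a x =>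
    (contMDiff_mul_left (I := I) (n := ∞)).mdifferentiableAt (by simp)
  have h := mfderiv_comp (I := I) (I' := I) (I'' := I) (1 : G)
    (g := fun x : G => g⁻¹ * x) (hd g⁻¹ (g * 1)) (hd g 1)
  have h1 : (fun x : G => g⁻¹ * x) ∘ (fun x : G => g * x) = id := by ext x; simp
  rw [h1, mfderiv_id] at h
  have h2 := DFunLike.congr_fun h v
  have h3 : (g * 1 : G) = g := mul_one g
  rw [h3] at h2
  exact h2.symm

theorem maurerCartan_surjective [LieGroup I ∞ G] (g : G) : Function.Surjective (maurerCartan I g) :=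
  fun v => ⟨_, maurerCartan_translate I g v⟩

end LieGroup

section Fibres

/-- The parametrization `k ↦ g k` by `K` of the fibre of `G → G ⧸ K` through `g`. -/
def fibreEmbedding {G : Type*} [Group G] (K : Subgroup G) (g : G) : K → G := fun k => g * k

theorem range_fibreEmbedding {G : Type*} [Group G] (K : Subgroup G) (g : G) :
    Set.range (fibreEmbedding K g) =
      (QuotientGroup.mk : G → G ⧸ K) ⁻¹' {(QuotientGroup.mk g : G ⧸ K)} := by
  ext x
  simp only [fibreEmbedding, Set.mem_range, Subtype.exists, Set.mem_preimage,
    Set.mem_singleton_iff, eq_comm (a := (QuotientGroup.mk x : G ⧸ K)), QuotientGroup.eq]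
  constructor
  · rintro ⟨k, hk, rfl⟩
    simpa using hk
  · intro h
    exact ⟨_, h, by simp⟩

end Fibres

section Manin

instance {E : Type*} [NormedAddCommGroup E] [NormedSpace ℝ E] {H : Type*} [TopologicalSpace H]
    (I : ModelWithCorners ℝ E H) (G : Type*) [TopologicalSpace G] [ChartedSpace H G] [Group G]
    [LieGroup I ∞ G] : LieGroup I (minSmoothness ℝ 3) G :=
  LieGroup.of_le (n := ∞)
    (by simp only [minSmoothness_of_isRCLikeNormedField]; exact ENat.LEInfty.out)

variable {E : Type*} [NormedAddCommGroup E] [NormedSpace ℝ E] [CompleteSpace E]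
  {H : Type*} [TopologicalSpace H]
  (I : ModelWithCorners ℝ E H) (G : Type*) [TopologicalSpace G] [ChartedSpace H G] [Group G]
  [LieGroup I ∞ G] (𝔡 : Type*) [LieRing 𝔡] [LieAlgebra ℝ 𝔡]

/-- A `G`-invariant Manin triple `(𝔡, ⟨·,·⟩, 𝔤, 𝔥)`, where `𝔤` is the Lie algebra of the Lie
group `G`, regarded as a subalgebra of `𝔡` through the injection `incl`. -/
structure InvariantManinTriple where
  /-- The inclusion of `𝔤` as a Lie subalgebra of `𝔡`. -/
  incl : GroupLieAlgebra I G →ₗ⁅ℝ⁆ 𝔡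
  incl_injective : Function.Injective incl
  /-- The complementary Lie subalgebra. -/
  𝔥 : LieSubalgebra ℝ 𝔡
  isCompl : IsCompl incl.range.toSubmodule 𝔥.toSubmodule
  /-- The pairing `⟨·,·⟩` on `𝔡`. -/
  pairing : LinearMap.BilinForm ℝ 𝔡
  pairing_symm : ∀ v w : 𝔡, pairing v w = pairing w v
  pairing_invariant : ∀ u v w : 𝔡, pairing ⁅u, v⁆ w + pairing v ⁅u, w⁆ = 0
  /-- `𝔤` is Lagrangian: it equals its own orthogonal. -/
  lagrangian_𝔤 : incl.range.toSubmodule.orthogonalBilin pairing = incl.range.toSubmodule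
  /-- `𝔥` is Lagrangian: it equals its own orthogonal. -/
  lagrangian_𝔥 : 𝔥.toSubmodule.orthogonalBilin pairing = 𝔥.toSubmodule
  /-- The action of `G` on `𝔡`. -/
  Ad : G →* (𝔡 →ₗ[ℝ] 𝔡)
  /-- The action is smooth: its matrix coefficients are. -/
  Ad_smooth : ∀ (w : 𝔡) (φ : Module.Dual ℝ 𝔡), ContMDiff I 𝓘(ℝ, ℝ) ∞ (fun g => φ (Ad g w))
  /-- The action extends the adjoint action on `𝔤`. -/
  Ad_incl : ∀ (g : G) (v : GroupLieAlgebra I G), Ad g (incl v) = incl (adjointMap I g v)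
  /-- The action integrates the bracket action of `𝔤` on `𝔡`. -/
  Ad_deriv : ∀ (w : 𝔡) (φ : Module.Dual ℝ 𝔡) (v : GroupLieAlgebra I G),
    differential I (fun g => φ (Ad g w)) 1 v = φ ⁅incl v, w⁆
  Ad_lie : ∀ (g : G) (v w : 𝔡), Ad g ⁅v, w⁆ = ⁅Ad g v, Ad g w⁆
  Ad_pairing : ∀ (g : G) (v w : 𝔡), pairing (Ad g v) (Ad g w) = pairing v w

namespace InvariantManinTriple

variable {I G 𝔡} (T : InvariantManinTriple I G 𝔡)

/-- The projection `pr_𝔤 : 𝔡 → 𝔤` along `𝔥`. -/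
def pr : 𝔡 →ₗ[ℝ] GroupLieAlgebra I G :=
  (LinearEquiv.ofInjective T.incl.toLinearMap T.incl_injective).symm.toLinearMap ∘ₗ
    Submodule.projectionOnto (LinearMap.range T.incl.toLinearMap) T.𝔥.toSubmodule T.isCompl

/-- The infinitesimal dressing action `ϱ(v)_g ∈ T_g G`, determined by
`Ad_g (θ^L_g (ϱ(v)_g)) = pr_𝔤 (Ad_g v)`. -/
def dressing (g : G) : 𝔡 →ₗ[ℝ] TangentSpace I g :=
  tangentLin I I (fun x : G => g * x) 1 ∘ₗ adjointMap I g⁻¹ ∘ₗ T.pr ∘ₗ T.Ad g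

/-- The covector `⟨θ^L_g, w⟩ ∈ T_g^* G`, for `w ∈ 𝔡`. -/
def covector (g : G) : 𝔡 →ₗ[ℝ] Module.Dual ℝ (TangentSpace I g) :=
  LinearMap.flip (T.pairing ∘ₗ T.incl.toLinearMap ∘ₗ maurerCartan I g)

theorem covector_apply (g : G) (w : 𝔡) (u : TangentSpace I g) :
    T.covector g w u = T.pairing (T.incl (maurerCartan I g u)) w := rfl

theorem exists_eq_incl_pr_add (x : 𝔡) : ∃ y ∈ T.𝔥, x = T.incl (T.pr x) + y := by
  refine ⟨x - T.incl (T.pr x), ?_, by abel⟩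
  have h := Submodule.sub_projection_mem T.isCompl x
  have e : T.incl (T.pr x) = Submodule.projection _ _ T.isCompl x :=
    congrArg Subtype.val ((LinearEquiv.ofInjective T.incl.toLinearMap
      T.incl_injective).apply_symm_apply
        (Submodule.projectionOnto (LinearMap.range T.incl.toLinearMap) T.𝔥.toSubmodule T.isCompl x))
  rw [e]
  exact h

theorem pairing_𝔥 {v w : 𝔡} (hv : v ∈ T.𝔥) (hw : w ∈ T.𝔥) : T.pairing v w = 0 := by
  have h : w ∈ T.𝔥.toSubmodule.orthogonalBilin T.pairing := by
    rw [T.lagrangian_𝔥]; exact hw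
  exact h v hv

theorem pairing_incl (v w : GroupLieAlgebra I G) : T.pairing (T.incl v) (T.incl w) = 0 := by
  have h : T.incl w ∈ T.incl.range.toSubmodule.orthogonalBilin T.pairing := by
    rw [T.lagrangian_𝔤]; exact ⟨w, rfl⟩
  exact h _ ⟨v, rfl⟩

theorem incl_maurerCartan_dressing (g : G) (w : 𝔡) :
    T.incl (maurerCartan I g (T.dressing g w)) = T.Ad g⁻¹ (T.incl (T.pr (T.Ad g w))) := by
  rw [T.Ad_incl]
  exact congrArg T.incl (maurerCartan_translate I g _)

theorem covector_bijective [FiniteDimensional ℝ E] [FiniteDimensional ℝ 𝔡] (g : G) :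
    Function.Bijective (T.covector g ∘ₗ T.𝔥.toSubmodule.subtype) := by
  have : FiniteDimensional ℝ (TangentSpace I g) := inferInstanceAs (FiniteDimensional ℝ E)
  have : FiniteDimensional ℝ (GroupLieAlgebra I G) := inferInstanceAs (FiniteDimensional ℝ E)
  have inj : Function.Injective (T.covector g ∘ₗ T.𝔥.toSubmodule.subtype) := by
    rw [injective_iff_map_eq_zero]
    rintro ⟨w, hw⟩ h0
    have hg : w ∈ T.incl.range.toSubmodule := by
      rw [← T.lagrangian_𝔤]
      rintro _ ⟨v, rfl⟩
      obtain ⟨u, rfl⟩ := maurerCartan_surjective I g v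
      exact DFunLike.congr_fun h0 u
    exact Subtype.ext (Submodule.disjoint_def.1 T.isCompl.disjoint w hg hw)
  let F : GroupLieAlgebra I G →ₗ[ℝ] Module.Dual ℝ T.𝔥.toSubmodule :=
    LinearMap.lcomp ℝ ℝ T.𝔥.toSubmodule.subtype ∘ₗ T.pairing ∘ₗ T.incl.toLinearMap
  have injF : Function.Injective F := by
    rw [injective_iff_map_eq_zero]
    intro v h0
    have hh : T.incl v ∈ T.𝔥.toSubmodule := by
      rw [← T.lagrangian_𝔥]
      intro w hw
      rw [T.pairing_symm]
      exact DFunLike.congr_fun h0 ⟨w, hw⟩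
    have := Submodule.disjoint_def.1 T.isCompl.disjoint (T.incl v) ⟨v, rfl⟩ hh
    exact (map_eq_zero_iff T.incl T.incl_injective).1 this
  have le₁ := LinearMap.finrank_le_finrank_of_injective inj
  have le₂ := LinearMap.finrank_le_finrank_of_injective injF
  rw [Subspace.dual_finrank_eq] at le₁ le₂
  refine ⟨inj, (LinearMap.injective_iff_surjective_of_finrank_eq_finrank ?_).1 inj⟩
  rw [Subspace.dual_finrank_eq]
  exact le_antisymm le₁ le₂

variable [FiniteDimensional ℝ E] [FiniteDimensional ℝ 𝔡]

/-- The isomorphism `𝔥 ≃ T_g^* G`, `w ↦ ⟨θ^L_g, w⟩`. -/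
def covectorEquiv (g : G) : T.𝔥.toSubmodule ≃ₗ[ℝ] Module.Dual ℝ (TangentSpace I g) :=
  LinearEquiv.ofBijective _ (T.covector_bijective g)

/-- The Poisson-Lie structure `π_G` of the triple: the bivector field with
`Gr(π_G) = {ϱ(w) + ⟨θ^L, w⟩ | w ∈ 𝔥}`, that is `π_G^♯ ⟨θ^L, w⟩ = ϱ(w)` for `w ∈ 𝔥`. -/
def bivector : BivectorField I G where
  sharp g := T.dressing g ∘ₗ T.𝔥.toSubmodule.subtype ∘ₗ (T.covectorEquiv g).symm.toLinearMap
  skew g ξ η := by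
    obtain ⟨⟨v, hv⟩, rfl⟩ := (T.covectorEquiv g).surjective ξ
    obtain ⟨⟨w, hw⟩, rfl⟩ := (T.covectorEquiv g).surjective η
    have key : ∀ a b : 𝔡, T.covector g a (T.dressing g b) =
        T.pairing (T.incl (T.pr (T.Ad g b))) (T.Ad g a) := by
      intro a b
      rw [covector_apply, incl_maurerCartan_dressing, ← T.Ad_pairing g]
      congr 2
      rw [← Module.End.mul_apply, ← map_mul]
      simp
    have h0 : T.pairing (T.Ad g v) (T.Ad g w) = 0 := by
      rw [T.Ad_pairing, T.pairing_𝔥 hv hw]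
    obtain ⟨y, hy, ey⟩ := T.exists_eq_incl_pr_add (T.Ad g v)
    obtain ⟨z, hz, ez⟩ := T.exists_eq_incl_pr_add (T.Ad g w)
    simp only [LinearMap.comp_apply, LinearEquiv.coe_coe, LinearEquiv.symm_apply_apply]
    change T.covector g v (T.dressing g w) = -T.covector g w (T.dressing g v)
    rw [key, key]
    generalize T.pr (T.Ad g v) = p at *
    generalize T.pr (T.Ad g w) = q at *
    rw [ey, ez] at h0 ⊢
    simp only [map_add, LinearMap.add_apply, T.pairing_incl, T.pairing_𝔥 hy hz] at h0 ⊢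
    rw [T.pairing_symm y] at h0
    linarith

theorem bivector_sharp_covector (g : G) {w : 𝔡} (hw : w ∈ T.𝔥) :
    T.bivector.sharp g (T.covector g w) = T.dressing g w := by
  have h : (T.covectorEquiv g).symm (T.covector g w) = ⟨w, hw⟩ :=
    (T.covectorEquiv g).symm_apply_apply ⟨w, hw⟩
  change T.dressing g ((T.covectorEquiv g).symm (T.covector g w) : 𝔡) = T.dressing g w
  rw [h]

/-- The annihilator `𝔨° = {w ∈ 𝔥 | ⟨𝔨, w⟩ = 0}` of `𝔨 ⊆ 𝔤` in `𝔥 = 𝔤^*`. -/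
def ann (𝔨 : Submodule ℝ (GroupLieAlgebra I G)) : Submodule ℝ 𝔡 :=
  T.𝔥.toSubmodule ⊓ (𝔨.map T.incl.toLinearMap).orthogonalBilin T.pairing

end InvariantManinTriple
end Manin

end

noncomputable section

open VectorField

/-! ### Lie brackets of vector fields as commutators of derivations. -/

section Calculus

variable {E : Type*} [NormedAddCommGroup E] [NormedSpace ℝ E] {M : Type*} [TopologicalSpace M]
  [ChartedSpace E M]

/-! Left translation identifies `T_g G ⊕ T_g^* G` with `𝔤 ⊕ 𝔥 = 𝔡`. In this picture `π_G^♯ ⟨θ^L, w⟩`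
is the left translate of `v` exactly when `Ad_g (w - v) ∈ 𝔥` (`sharp_covector_eq_iff`), so all four
parts become linear algebra in `𝔡`.

For a), b) and c), right translation by `k⁻¹` changes `π_G^♯` by `pr (Ad_{k⁻¹} w)`
(`sharp_mul_inv`). Invariance thus means `Ad_K 𝔥 ⊆ 𝔥`, and descent to `G/K` means `Ad_K 𝔨° ⊆ 𝔨 ⊕ 𝔥`.
Tangency to `K` says that `π_G^♯` kills the conormal covectors, that is `Ad_K 𝔨° ⊆ 𝔥`.
Differentiating at `1` (`lie_mem`) gives bracket conditions. Conversely, as `K` is connected, a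
subspace stable under `ad 𝔨` is stable under `Ad_K` (`map_mem`, by uniqueness for linear
differential equations); it is applied to `𝔥`, `𝔨°` and `𝔨 ⊕ 𝔨°`. Invariance of the pairing and `(𝔨
⊕ 𝔥)^⊥ = 𝔨°` turn the results into the stated conditions on `𝔨°`.

For d), with `K` a Poisson submanifold, `𝔨 ⊕ 𝔥` is a coisotropic subalgebra in which `𝔨°` is an
ideal. Put `L = (Ad_{g⁻¹} 𝔥 ∩ (𝔨 ⊕ 𝔥)) + 𝔨°`, an isotropic subalgebra. The condition on `Ad_G 𝔥`
makes `L` a complement of `𝔨` in `𝔨 ⊕ 𝔥`, and projecting to `𝔨` along `L` defines the induced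
bivector on the fibre `gK`. Single-valuedness of the induced bivector gives back the condition.

One criterion yields the Jacobi identity both for `π_G` and for the fibres
(`isPoisson_of_projection`): the bivector is `Ad_{g⁻¹} P Ad_g`, where `P` splits a subalgebra of `𝔡`
into two isotropic subalgebras. Since `Ad` integrates `ad`, the identity reduces to an algebraic
one, `cyclic_projection_identity`. -/

theorem differential_eq_fderiv_comp_extChartAt_symm {f : M → ℝ} {x : M}
    (hf : MDifferentiableAt 𝓘(ℝ, E) 𝓘(ℝ, ℝ) f x) (v : TangentSpace 𝓘(ℝ, E) x) :
    differential 𝓘(ℝ, E) f x v =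
      fderiv ℝ (f ∘ (extChartAt 𝓘(ℝ, E) x).symm) (extChartAt 𝓘(ℝ, E) x x) v := by
  change mfderiv 𝓘(ℝ, E) 𝓘(ℝ, ℝ) f x v = _
  simp only [mfderiv, hf, writtenInExtChartAt]
  simp only [ModelWithCorners.range_eq_univ, fderivWithin_univ]
  rfl

theorem inverse_mfderiv_extChartAt_self [IsManifold 𝓘(ℝ, E) 1 M] (x : M) (v : E) :
    (mfderiv 𝓘(ℝ, E) 𝓘(ℝ, E) (extChartAt 𝓘(ℝ, E) x) x).inverse v = v := by
  have h := congrArg ContinuousLinearMap.inverse (mfderiv_extChartAt_self (I := 𝓘(ℝ, E)) (x := x))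
  exact (DFunLike.congr_fun h v).trans
    (DFunLike.congr_fun (ContinuousLinearMap.inverse_id (R := ℝ) (M := E)) v)

/-- Differentiating along the Lie bracket of two vector fields is the commutator of the
derivatives. -/
theorem mfderiv_mlieBracket [CompleteSpace E] [IsManifold 𝓘(ℝ, E) ∞ M] {f : M → ℝ}
    (hf : ContMDiff 𝓘(ℝ, E) 𝓘(ℝ, ℝ) ∞ f) {V W : ∀ x : M, TangentSpace 𝓘(ℝ, E) x} {x : M}
    (hV : MDifferentiableAt 𝓘(ℝ, E) (𝓘(ℝ, E).tangent)
      (fun y => (V y : TangentBundle 𝓘(ℝ, E) M)) x)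
    (hW : MDifferentiableAt 𝓘(ℝ, E) (𝓘(ℝ, E).tangent)
      (fun y => (W y : TangentBundle 𝓘(ℝ, E) M)) x)
    (hfV : MDifferentiableAt 𝓘(ℝ, E) 𝓘(ℝ, ℝ) (fun y => differential 𝓘(ℝ, E) f y (V y)) x)
    (hfW : MDifferentiableAt 𝓘(ℝ, E) 𝓘(ℝ, ℝ) (fun y => differential 𝓘(ℝ, E) f y (W y)) x) :
    differential 𝓘(ℝ, E) f x (mlieBracket 𝓘(ℝ, E) V W x) =
      differential 𝓘(ℝ, E) (fun y => differential 𝓘(ℝ, E) f y (W y)) x (V x) -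
        differential 𝓘(ℝ, E) (fun y => differential 𝓘(ℝ, E) f y (V y)) x (W x) := by
  have : IsManifold 𝓘(ℝ, E) 2 M := IsManifold.of_le (n := ∞) (by exact ENat.LEInfty.out)
  have : IsManifold 𝓘(ℝ, E) 1 M := IsManifold.of_le (n := 2) (by norm_num)
  have hfm : MDifferentiable 𝓘(ℝ, E) 𝓘(ℝ, ℝ) f := hf.mdifferentiable (by simp)
  set φ := extChartAt 𝓘(ℝ, E) x with hφ
  have hbr : mlieBracket 𝓘(ℝ, E) V W x = lieBracket ℝ
      (mpullbackWithin 𝓘(ℝ, E) 𝓘(ℝ, E) φ.symm V (Set.range 𝓘(ℝ, E)))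
      (mpullbackWithin 𝓘(ℝ, E) 𝓘(ℝ, E) φ.symm W (Set.range 𝓘(ℝ, E))) (φ x) := by
    rw [mlieBracket, mlieBracketWithin_apply]
    refine (inverse_mfderiv_extChartAt_self x _).trans ?_
    have h : ∀ (A B : E → E) (s : Set E), s = Set.univ →
        lieBracketWithin ℝ A B s (φ x) = lieBracket ℝ A B (φ x) := by
      rintro A B _ rfl
      rw [lieBracketWithin_univ]
    exact h _ _ _ (by simp)
  have hpull : ∀ {V : ∀ x : M, TangentSpace 𝓘(ℝ, E) x}, MDifferentiableAt 𝓘(ℝ, E)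
      (𝓘(ℝ, E).tangent) (fun y => (V y : TangentBundle 𝓘(ℝ, E) M)) x →
      DifferentiableAt ℝ (mpullbackWithin 𝓘(ℝ, E) 𝓘(ℝ, E) φ.symm V (Set.range 𝓘(ℝ, E)))
        (φ x) := by
    intro V hV
    have := MDifferentiableWithinAt.differentiableWithinAt_mpullbackWithin_vectorField
      (mdifferentiableWithinAt_univ.2 hV)
    have hu : φ.symm ⁻¹' Set.univ ∩ Set.range 𝓘(ℝ, E) = Set.univ := by simp
    rw [← hφ, hu] at this
    exact differentiableWithinAt_univ.1 this
  have hval : ∀ V : ∀ x : M, TangentSpace 𝓘(ℝ, E) x,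
      mpullbackWithin 𝓘(ℝ, E) 𝓘(ℝ, E) φ.symm V (Set.range 𝓘(ℝ, E)) (φ x) = V x := by
    intro V
    have h1 := mfderivWithin_extChartAt_symm_inverse_apply (I := 𝓘(ℝ, E)) (x := x)
      (V (φ.symm (φ x)))
    have h2 : φ.symm (φ x) = x := extChartAt_to_inv x
    rw [mpullbackWithin]
    refine h1.trans ?_
    rw [h2]
  -- In the chart the derivative of `f` along `V` is that of `f ∘ φ.symm` along the pulled-back
  -- field. This holds near the base point, as a further derivative is taken.
  have hloc : ∀ V : ∀ x : M, TangentSpace 𝓘(ℝ, E) x,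
      ((fun y => differential 𝓘(ℝ, E) f y (V y)) ∘ φ.symm) =ᶠ[nhds (φ x)]
      fun z => fderiv ℝ (f ∘ φ.symm) z
        (mpullbackWithin 𝓘(ℝ, E) 𝓘(ℝ, E) φ.symm V (Set.range 𝓘(ℝ, E)) z) := by
    intro V
    filter_upwards [extChartAt_target_mem_nhds (I := 𝓘(ℝ, E)) x] with z hz
    have hd : MDifferentiableWithinAt 𝓘(ℝ, E) 𝓘(ℝ, E) φ.symm (Set.range 𝓘(ℝ, E)) z :=
      mdifferentiableWithinAt_extChartAt_symm hz
    have hinv := isInvertible_mfderivWithin_extChartAt_symm hz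
    have hc : fderiv ℝ (f ∘ φ.symm) z = (mfderiv 𝓘(ℝ, E) 𝓘(ℝ, ℝ) f (φ.symm z)).comp
        (mfderivWithin 𝓘(ℝ, E) 𝓘(ℝ, E) φ.symm (Set.range 𝓘(ℝ, E)) z) := by
      rw [← mfderiv_eq_fderiv]
      have hr : Set.range 𝓘(ℝ, E) = Set.univ := by simp
      rw [hr, mdifferentiableWithinAt_univ] at hd
      rw [hr, mfderivWithin_univ]
      exact mfderiv_comp z (hfm _) hd
    rw [hc]
    simp only [Function.comp_apply, mpullbackWithin]
    obtain ⟨e, he⟩ := hinv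
    rw [← he, ContinuousLinearMap.inverse_equiv]
    change mfderiv 𝓘(ℝ, E) 𝓘(ℝ, ℝ) f (φ.symm z) (V (φ.symm z)) =
      mfderiv 𝓘(ℝ, E) 𝓘(ℝ, ℝ) f (φ.symm z) (e (e.symm (V (φ.symm z))))
    rw [e.apply_symm_apply]
  have hfd : ContDiffAt ℝ 2 (f ∘ φ.symm) (φ x) := by
    have h1 : ContMDiffOn 𝓘(ℝ, E) 𝓘(ℝ, E) ∞ φ.symm φ.target := contMDiffOn_extChartAt_symm x
    have h2 := (hf.contMDiffOn (s := Set.univ)).comp h1 (fun _ _ => Set.mem_univ _)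
    have h3 := (h2.contMDiffAt (extChartAt_target_mem_nhds (I := 𝓘(ℝ, E)) x)).contDiffAt
    exact h3.of_le (by exact ENat.LEInfty.out)
  -- The flat case: the second derivatives of the `C²` function `f ∘ φ.symm` are symmetric and
  -- cancel.
  have key := VectorField.fderiv_apply_lieBracket hfd (by simp) (hpull hW) (hpull hV)
  rw [hval, hval, ← (hloc V).fderiv_eq, ← (hloc W).fderiv_eq] at key
  rw [differential_eq_fderiv_comp_extChartAt_symm (hfm x),
    differential_eq_fderiv_comp_extChartAt_symm hfV,
    differential_eq_fderiv_comp_extChartAt_symm hfW, hbr]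
  exact key

end Calculus

/-! ### Local sections of submersions and curves in their fibres. -/

section Submersion

universe u

variable {E : Type u} [NormedAddCommGroup E] [NormedSpace ℝ E] {M : Type*} [TopologicalSpace M]
  [ChartedSpace E M] {E' : Type*} [NormedAddCommGroup E'] [NormedSpace ℝ E'] {N : Type*}
  [TopologicalSpace N] [ChartedSpace E' N]

/-- The local normal form of a submersion. -/
theorem Manifold.IsSubmersion.exists_charts {p : M → N}
    (hp : Manifold.IsSubmersion 𝓘(ℝ, E) 𝓘(ℝ, E') ∞ p) (x : M) :
    ∃ (F : Type u) (_ : NormedAddCommGroup F) (_ : NormedSpace ℝ F) (e : E ≃L[ℝ] E' × F)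
      (φ : OpenPartialHomeomorph M E) (ψ : OpenPartialHomeomorph N E'),
      φ ∈ IsManifold.maximalAtlas 𝓘(ℝ, E) ∞ M ∧ ψ ∈ IsManifold.maximalAtlas 𝓘(ℝ, E') ∞ N ∧
      x ∈ φ.source ∧ Set.MapsTo p φ.source ψ.source ∧
      ∀ z ∈ φ.target, ψ (p (φ.symm z)) = (e z).1 := by
  obtain ⟨F, _, _, h⟩ := hp
  refine ⟨F, _, _, (h x).equiv, (h x).domChart, (h x).codChart, (h x).domChart_mem_maximalAtlas,
    (h x).codChart_mem_maximalAtlas, (h x).mem_domChart_source,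
    (h x).mapsto_domChart_source_codChart_source, fun z hz => ?_⟩
  have hz' : z ∈ ((h x).domChart.extend 𝓘(ℝ, E)).target := by
    simpa [OpenPartialHomeomorph.extend] using hz
  simpa using (h x).writtenInCharts hz'

/-- In submersion charts `p` is the projection to the first factor; the section freezes the second
coordinate at its value at `x`. -/
theorem Manifold.IsSubmersion.exists_local_section {p : M → N}
    (hp : Manifold.IsSubmersion 𝓘(ℝ, E) 𝓘(ℝ, E') ∞ p) (x : M) :
    ∃ σ : N → M, σ (p x) = x ∧ ContMDiffAt 𝓘(ℝ, E') 𝓘(ℝ, E) ∞ σ (p x) ∧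
      ∀ᶠ y in nhds (p x), p (σ y) = y := by
  obtain ⟨F, _, _, e, φ, ψ, hφ, hψ, hx, hmaps, hpφ⟩ := hp.exists_charts x
  have hpx : p x ∈ ψ.source := hmaps hx
  have hex : ψ (p x) = (e (φ x)).1 := by
    rw [← hpφ _ (φ.map_source hx), φ.left_inv hx]
  set τ : N → E := fun y => e.symm (ψ y, (e (φ x)).2) with hτ
  have hτx : τ (p x) = φ x := by simp [hτ, hex]
  have hψs : ContMDiffAt 𝓘(ℝ, E') 𝓘(ℝ, E') ∞ ψ (p x) :=
    (contMDiffOn_of_mem_maximalAtlas hψ).contMDiffAt (ψ.open_source.mem_nhds hpx)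
  have hτs : ContMDiffAt 𝓘(ℝ, E') 𝓘(ℝ, E) ∞ τ (p x) := by
    have h1 : ContMDiff 𝓘(ℝ, E') 𝓘(ℝ, E) ∞ (fun u : E' => e.symm (u, (e (φ x)).2)) := by
      rw [contMDiff_iff_contDiff]
      fun_prop
    exact h1.contMDiffAt.comp (p x) hψs
  have hφs : ContMDiffAt 𝓘(ℝ, E) 𝓘(ℝ, E) ∞ φ.symm (τ (p x)) :=
    (contMDiffOn_symm_of_mem_maximalAtlas hφ).contMDiffAt
      (φ.open_target.mem_nhds (by rw [hτx]; exact φ.map_source hx))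
  refine ⟨φ.symm ∘ τ, by simp [hτx, φ.left_inv hx], hφs.comp (p x) hτs, ?_⟩
  have hτt : ∀ᶠ y in nhds (p x), τ y ∈ φ.target :=
    hτs.continuousAt.eventually_mem
      (φ.open_target.mem_nhds (by rw [hτx]; exact φ.map_source hx))
  filter_upwards [hτt, ψ.open_source.mem_nhds hpx] with y hy hyψ
  refine ψ.injOn (hmaps (φ.map_target hy)) hyψ ?_
  rw [hpφ _ hy]
  simp [hτ]

/-- Near `p x`, `F` equals `(F ∘ p) ∘ σ` for a local section `σ`. -/
theorem Manifold.IsSubmersion.contMDiff_of_comp {p : M → N}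
    (hp : Manifold.IsSubmersion 𝓘(ℝ, E) 𝓘(ℝ, E') ∞ p) (hs : Function.Surjective p) {F : N → ℝ}
    (hF : ContMDiff 𝓘(ℝ, E) 𝓘(ℝ, ℝ) ∞ (F ∘ p)) : ContMDiff 𝓘(ℝ, E') 𝓘(ℝ, ℝ) ∞ F := by
  intro y
  obtain ⟨x, rfl⟩ := hs y
  obtain ⟨σ, -, hσ, hpσ⟩ := hp.exists_local_section x
  refine (hF.contMDiffAt.comp (p x) hσ).congr_of_eventuallyEq ?_
  filter_upwards [hpσ] with y hy
  simp [hy]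

/-- A vector in the kernel of the tangent map of a submersion is the velocity of a curve in the
fibre. -/
theorem Manifold.IsSubmersion.exists_curve [IsManifold 𝓘(ℝ, E) ∞ M] [IsManifold 𝓘(ℝ, E') ∞ N]
    {p : M → N}
    (hp : Manifold.IsSubmersion 𝓘(ℝ, E) 𝓘(ℝ, E') ∞ p) (x : M) (v : TangentSpace 𝓘(ℝ, E) x)
    (hv : tangentLin 𝓘(ℝ, E) 𝓘(ℝ, E') p x v = 0) :
    ∃ γ : ℝ → M, γ 0 = x ∧ ContMDiffAt 𝓘(ℝ, ℝ) 𝓘(ℝ, E) ∞ γ 0 ∧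
      (∀ᶠ t in nhds 0, p (γ t) = p x) ∧
      (mfderiv 𝓘(ℝ, ℝ) 𝓘(ℝ, E) γ 0 (1 : ℝ) : E) = v := by
  obtain ⟨F, _, _, e, φ, ψ, hφ, hψ, hx, hmaps, hpφ⟩ := hp.exists_charts x
  have hpx : p x ∈ ψ.source := hmaps hx
  have hφs : ContMDiffAt 𝓘(ℝ, E) 𝓘(ℝ, E) ∞ φ x :=
    (contMDiffOn_of_mem_maximalAtlas hφ).contMDiffAt (φ.open_source.mem_nhds hx)
  have hψs : ContMDiffAt 𝓘(ℝ, E') 𝓘(ℝ, E') ∞ ψ (p x) :=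
    (contMDiffOn_of_mem_maximalAtlas hψ).contMDiffAt (ψ.open_source.mem_nhds hpx)
  have hφi : ContMDiffAt 𝓘(ℝ, E) 𝓘(ℝ, E) ∞ φ.symm (φ x) :=
    (contMDiffOn_symm_of_mem_maximalAtlas hφ).contMDiffAt
      (φ.open_target.mem_nhds (φ.map_source hx))
  obtain ⟨σ, hσx, hσ, hpσ⟩ := hp.exists_local_section x
  have hps : ContMDiffAt 𝓘(ℝ, E) 𝓘(ℝ, E') ∞ p x := hp.contMDiff.contMDiffAt
  set u : E := mfderiv 𝓘(ℝ, E) 𝓘(ℝ, E) φ x v with hu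
  -- the first component of `u` vanishes
  have hu0 : (e u).1 = 0 := by
    have heq : (ψ ∘ p) =ᶠ[nhds x] (fun z : E => (e z).1) ∘ φ := by
      filter_upwards [φ.open_source.mem_nhds hx] with y hy
      simp only [Function.comp_apply]
      rw [← hpφ _ (φ.map_source hy), φ.left_inv hy]
    have h1 := heq.mfderiv_eq (I := 𝓘(ℝ, E)) (I' := 𝓘(ℝ, E'))
    rw [mfderiv_comp x (hψs.mdifferentiableAt (by simp)) (hps.mdifferentiableAt (by simp))] at h1
    have hL : HasFDerivAt (fun z : E => (e z).1)
        ((ContinuousLinearMap.fst ℝ E' F).comp (e : E →L[ℝ] E' × F)) (φ x) :=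
      ((ContinuousLinearMap.fst ℝ E' F).comp (e : E →L[ℝ] E' × F)).hasFDerivAt
    have h2 := (hL.hasMFDerivAt.comp x (hφs.mdifferentiableAt (by simp)).hasMFDerivAt).mfderiv
    have h3 := DFunLike.congr_fun (h1.trans h2) v
    have h4 : mfderiv 𝓘(ℝ, E) 𝓘(ℝ, E') p x v = 0 := hv
    have h5 : (mfderiv 𝓘(ℝ, E') 𝓘(ℝ, E') ψ (p x)) (mfderiv 𝓘(ℝ, E) 𝓘(ℝ, E') p x v) =
        (e u).1 := h3
    rw [h4] at h5
    exact h5.symm.trans (map_zero _)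
  have hc : ContMDiff 𝓘(ℝ, ℝ) 𝓘(ℝ, E) ∞ (fun t : ℝ => φ x + t • u) := by
    rw [contMDiff_iff_contDiff]
    fun_prop
  have hc0 : φ x + (0 : ℝ) • u = φ x := by simp
  -- A straight line in the chart with direction `u`; it stays in the fibre because the first
  -- component of `e u` is zero.
  refine ⟨fun t => φ.symm (φ x + t • u), by simp [φ.left_inv hx], ?_, ?_, ?_⟩
  · exact ContMDiffAt.comp (0 : ℝ) (by rw [hc0]; exact hφi) hc.contMDiffAt
  · have ht : ∀ᶠ t in nhds (0 : ℝ), φ x + t • u ∈ φ.target :=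
      hc.continuous.continuousAt.eventually_mem
        (φ.open_target.mem_nhds (by rw [hc0]; exact φ.map_source hx))
    filter_upwards [ht] with t ht
    refine ψ.injOn (hmaps (φ.map_target ht)) hpx ?_
    rw [hpφ _ ht]
    have := hpφ _ (φ.map_source hx)
    rw [φ.left_inv hx] at this
    rw [this]
    simp [hu0]
  · have hcd : HasFDerivAt (fun t : ℝ => φ x + t • u)
        ((ContinuousLinearMap.id ℝ ℝ).smulRight u) 0 :=
      ((ContinuousLinearMap.id ℝ ℝ).smulRight u).hasFDerivAt.const_add (φ x)
    have h1 : HasMFDerivAt 𝓘(ℝ, E) 𝓘(ℝ, E) φ.symm (φ x + (0 : ℝ) • u)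
        (mfderiv 𝓘(ℝ, E) 𝓘(ℝ, E) φ.symm (φ x)) := by
      rw [hc0]
      exact (hφi.mdifferentiableAt (by simp)).hasMFDerivAt
    have h2 := (h1.comp (0 : ℝ) hcd.hasMFDerivAt).mfderiv
    have h3 : (mfderiv 𝓘(ℝ, ℝ) 𝓘(ℝ, E) (fun t : ℝ => φ.symm (φ x + t • u)) 0 (1 : ℝ) : E) =
        mfderiv 𝓘(ℝ, E) 𝓘(ℝ, E) φ.symm (φ x) ((1 : ℝ) • u) := DFunLike.congr_fun h2 (1 : ℝ)
    rw [h3, one_smul, hu]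
    have h4 : (φ.symm ∘ φ) =ᶠ[nhds x] id := by
      filter_upwards [φ.open_source.mem_nhds hx] with y hy
      exact φ.left_inv hy
    have h5 := h4.mfderiv_eq (I := 𝓘(ℝ, E)) (I' := 𝓘(ℝ, E))
    rw [mfderiv_comp x (hφi.mdifferentiableAt (by simp)) (hφs.mdifferentiableAt (by simp)),
      mfderiv_id] at h5
    exact DFunLike.congr_fun h5 v

end Submersion

/-! ### Left-invariant derivatives of functions on a Lie group. -/

section LeftTrivialization

variable {E : Type*} [NormedAddCommGroup E] [NormedSpace ℝ E] {G : Type*} [TopologicalSpace G]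
  [ChartedSpace E G] [Group G]

/-- The isomorphism `𝔤 → T_g G` given by left translation. -/
def leftTranslate (g : G) : GroupLieAlgebra 𝓘(ℝ, E) G →ₗ[ℝ] TangentSpace 𝓘(ℝ, E) g :=
  tangentLin 𝓘(ℝ, E) 𝓘(ℝ, E) (fun x : G => g * x) 1

/-- The derivative of a function along the left-invariant vector field of `v`. -/
def leftDeriv (v : GroupLieAlgebra 𝓘(ℝ, E) G) (f : G → ℝ) (g : G) : ℝ :=
  differential 𝓘(ℝ, E) f g (leftTranslate g v)

theorem leftTranslate_one (v : GroupLieAlgebra 𝓘(ℝ, E) G) : leftTranslate (1 : G) v = v := by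
  have h : (fun x : G => 1 * x) = id := by
    funext x
    simp
  have h1 : tangentLin 𝓘(ℝ, E) 𝓘(ℝ, E) (id : G → G) 1 v = v := by
    unfold tangentLin
    rw [mfderiv_id]
    rfl
  unfold leftTranslate
  rw [h]
  exact h1

theorem leftDeriv_add {f h : G → ℝ} {g : G} (hf : MDifferentiableAt 𝓘(ℝ, E) 𝓘(ℝ, ℝ) f g)
    (hh : MDifferentiableAt 𝓘(ℝ, E) 𝓘(ℝ, ℝ) h g) (v : GroupLieAlgebra 𝓘(ℝ, E) G) :
    leftDeriv v (fun x => f x + h x) g = leftDeriv v f g + leftDeriv v h g :=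
  DFunLike.congr_fun (hf.hasMFDerivAt.add hh.hasMFDerivAt).mfderiv (leftTranslate g v)

theorem leftDeriv_mul {f h : G → ℝ} {g : G} (hf : MDifferentiableAt 𝓘(ℝ, E) 𝓘(ℝ, ℝ) f g)
    (hh : MDifferentiableAt 𝓘(ℝ, E) 𝓘(ℝ, ℝ) h g) (v : GroupLieAlgebra 𝓘(ℝ, E) G) :
    leftDeriv v (fun x => f x * h x) g = leftDeriv v f g * h g + f g * leftDeriv v h g := by
  have h1 := DFunLike.congr_fun (hf.hasMFDerivAt.mul hh.hasMFDerivAt).mfderiv (leftTranslate g v)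
  refine Eq.trans h1 ?_
  change f g * leftDeriv v h g + h g * leftDeriv v f g = _
  ring

theorem leftDeriv_const (c : ℝ) (g : G) (v : GroupLieAlgebra 𝓘(ℝ, E) G) :
    leftDeriv v (fun _ => c) g = 0 :=
  DFunLike.congr_fun (hasMFDerivAt_const c g).mfderiv (leftTranslate g v)

theorem leftDeriv_sum {ι : Type*} (s : Finset ι) {f : ι → G → ℝ} {g : G}
    (hf : ∀ i, MDifferentiableAt 𝓘(ℝ, E) 𝓘(ℝ, ℝ) (f i) g) (v : GroupLieAlgebra 𝓘(ℝ, E) G) :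
    leftDeriv v (fun x => ∑ i ∈ s, f i x) g = ∑ i ∈ s, leftDeriv v (f i) g := by
  classical
  suffices h : MDifferentiableAt 𝓘(ℝ, E) 𝓘(ℝ, ℝ) (fun x => ∑ i ∈ s, f i x) g ∧
      leftDeriv v (fun x => ∑ i ∈ s, f i x) g = ∑ i ∈ s, leftDeriv v (f i) g from h.2
  induction s using Finset.induction_on with
  | empty => exact ⟨by simpa using mdifferentiableAt_const, by simpa using leftDeriv_const 0 g v⟩
  | insert a s ha ih =>
    simp only [Finset.sum_insert ha]
    exact ⟨(hf a).add ih.1, by rw [leftDeriv_add (hf a) ih.1, ih.2]⟩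

variable [LieGroup 𝓘(ℝ, E) ∞ G]

theorem mdifferentiableAt_leftMul (a x : G) :
    MDifferentiableAt 𝓘(ℝ, E) 𝓘(ℝ, E) (fun y : G => a * y) x :=
  (contMDiff_mul_left (I := 𝓘(ℝ, E)) (n := ∞)).mdifferentiableAt (by simp)

theorem maurerCartan_leftTranslate (g : G) (v : GroupLieAlgebra 𝓘(ℝ, E) G) :
    maurerCartan 𝓘(ℝ, E) g (leftTranslate g v) = v :=
  maurerCartan_translate 𝓘(ℝ, E) g v

section Comp

variable {E' : Type*} [NormedAddCommGroup E'] [NormedSpace ℝ E'] {N : Type*} [TopologicalSpace N]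
  [ChartedSpace E' N]

theorem tangentLin_leftTranslate {φ : G → N} {g : G}
    (hφ : MDifferentiableAt 𝓘(ℝ, E) 𝓘(ℝ, E') φ g) (v : GroupLieAlgebra 𝓘(ℝ, E) G) :
    (tangentLin 𝓘(ℝ, E) 𝓘(ℝ, E') φ g (leftTranslate g v) : E') =
      tangentLin 𝓘(ℝ, E) 𝓘(ℝ, E') (fun x => φ (g * x)) 1 v := by
  have h1 : HasMFDerivAt 𝓘(ℝ, E) 𝓘(ℝ, E') φ (g * 1) (mfderiv 𝓘(ℝ, E) 𝓘(ℝ, E') φ g) := by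
    rw [mul_one]
    exact hφ.hasMFDerivAt
  have h2 := (h1.comp (1 : G) (mdifferentiableAt_leftMul g 1).hasMFDerivAt).mfderiv
  exact (DFunLike.congr_fun h2 v).symm

end Comp

theorem leftTranslate_maurerCartan (g : G) (u : TangentSpace 𝓘(ℝ, E) g) :
    leftTranslate g (maurerCartan 𝓘(ℝ, E) g u) = u := by
  have h1 : HasMFDerivAt 𝓘(ℝ, E) 𝓘(ℝ, E) (fun x : G => g * x) (g⁻¹ * g)
      (mfderiv 𝓘(ℝ, E) 𝓘(ℝ, E) (fun x : G => g * x) 1) := by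
    rw [inv_mul_cancel]
    exact (mdifferentiableAt_leftMul g 1).hasMFDerivAt
  have h2 := (h1.comp g (mdifferentiableAt_leftMul g⁻¹ g).hasMFDerivAt).mfderiv
  have h3 : (fun x : G => g * x) ∘ (fun x : G => g⁻¹ * x) = id := by
    funext x
    simp
  rw [h3, mfderiv_id] at h2
  exact (DFunLike.congr_fun h2 u).symm

theorem leftTranslate_surjective (g : G) :
    Function.Surjective (leftTranslate (E := E) g) :=
  fun u => ⟨_, leftTranslate_maurerCartan g u⟩

theorem leftTranslate_injective (g : G) : Function.Injective (leftTranslate (E := E) g) :=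
  Function.LeftInverse.injective (maurerCartan_leftTranslate g)

/-- From `g x k⁻¹ = (g k⁻¹) (k x k⁻¹)`: in left trivialization, right translation acts by the
adjoint action. -/
theorem tangentLin_mul_right (k g : G) (v : GroupLieAlgebra 𝓘(ℝ, E) G) :
    tangentLin 𝓘(ℝ, E) 𝓘(ℝ, E) (fun x => x * k⁻¹) g (leftTranslate g v) =
      leftTranslate (g * k⁻¹) (adjointMap 𝓘(ℝ, E) k v) := by
  have hr : ∀ x : G, MDifferentiableAt 𝓘(ℝ, E) 𝓘(ℝ, E) (fun x : G => x * k⁻¹) x := fun x =>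
    (contMDiff_mul_right (I := 𝓘(ℝ, E)) (n := ∞)).mdifferentiableAt (by simp)
  refine (tangentLin_leftTranslate (hr g) v).trans ?_
  have h : (fun x : G => g * x * k⁻¹) = (fun x => g * k⁻¹ * x) ∘ fun x => k * x * k⁻¹ := by
    funext x
    simp [mul_assoc]
  have hc : MDifferentiableAt 𝓘(ℝ, E) 𝓘(ℝ, E) (fun x : G => k * x * k⁻¹) 1 :=
    (hr _).comp (1 : G) (mdifferentiableAt_leftMul k 1)
  have h1 : HasMFDerivAt 𝓘(ℝ, E) 𝓘(ℝ, E) (fun x : G => g * k⁻¹ * x) (k * 1 * k⁻¹)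
      (mfderiv 𝓘(ℝ, E) 𝓘(ℝ, E) (fun x : G => g * k⁻¹ * x) 1) := by
    rw [mul_one, mul_inv_cancel]
    exact (mdifferentiableAt_leftMul _ 1).hasMFDerivAt
  have h2 := (h1.comp (1 : G) hc.hasMFDerivAt).mfderiv
  rw [h]
  exact DFunLike.congr_fun h2 v

theorem leftDeriv_eq {f : G → ℝ} {g : G} (hf : MDifferentiableAt 𝓘(ℝ, E) 𝓘(ℝ, ℝ) f g)
    (v : GroupLieAlgebra 𝓘(ℝ, E) G) :
    leftDeriv v f g = differential 𝓘(ℝ, E) (fun x => f (g * x)) 1 v :=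
  tangentLin_leftTranslate hf v

/-- The derivative at `g` is that of `(g, x) ↦ f (g x)` at `(g, 1)` in the direction `(0, v)`: a
tangent map composed with a smooth map into the tangent bundle. -/
theorem contMDiff_leftDeriv {f : G → ℝ} (hf : ContMDiff 𝓘(ℝ, E) 𝓘(ℝ, ℝ) ∞ f)
    (v : GroupLieAlgebra 𝓘(ℝ, E) G) : ContMDiff 𝓘(ℝ, E) 𝓘(ℝ, ℝ) ∞ (leftDeriv v f) := by
  let m : G × G → ℝ := fun p => f (p.1 * p.2)
  have hm : ContMDiff (𝓘(ℝ, E).prod 𝓘(ℝ, E)) 𝓘(ℝ, ℝ) ∞ m := hf.comp (contMDiff_mul 𝓘(ℝ, E) ∞)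
  let F₁ : G → TangentBundle 𝓘(ℝ, E) G × TangentBundle 𝓘(ℝ, E) G :=
    fun g => (Bundle.TotalSpace.mk' E g 0, Bundle.TotalSpace.mk' E 1 v)
  have s1 : ContMDiff 𝓘(ℝ, E) 𝓘(ℝ, E).tangent ∞
      (fun g : G => (Bundle.TotalSpace.mk' E g 0 : TangentBundle 𝓘(ℝ, E) G)) :=
    Bundle.contMDiff_zeroSection _ _
  have s2 : ContMDiff 𝓘(ℝ, E) 𝓘(ℝ, E).tangent ∞
      (fun _ : G => (Bundle.TotalSpace.mk' E 1 v : TangentBundle 𝓘(ℝ, E) G)) :=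
    contMDiff_const
  have S1 : ContMDiff 𝓘(ℝ, E) (𝓘(ℝ, E).tangent.prod 𝓘(ℝ, E).tangent) ∞ F₁ := s1.prodMk s2
  have S2 : ContMDiff (𝓘(ℝ, E).tangent.prod 𝓘(ℝ, E).tangent) (𝓘(ℝ, E).prod 𝓘(ℝ, E)).tangent ∞
      (equivTangentBundleProd 𝓘(ℝ, E) G 𝓘(ℝ, E) G).symm := contMDiff_equivTangentBundleProd_symm
  have S3 : ContMDiff (𝓘(ℝ, E).prod 𝓘(ℝ, E)).tangent 𝓘(ℝ, ℝ).tangent ∞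
      (tangentMap (𝓘(ℝ, E).prod 𝓘(ℝ, E)) 𝓘(ℝ, ℝ) m) :=
    hm.contMDiff_tangentMap (by simp)
  have S4 := (contMDiff_snd_tangentBundle_modelSpace (n := ∞) ℝ 𝓘(ℝ, ℝ)).comp
    ((S3.comp S2).comp S1)
  refine S4.congr fun g => ?_
  rw [leftDeriv_eq (hf.mdifferentiableAt (by simp))]
  have hd : MDifferentiableAt (𝓘(ℝ, E).prod 𝓘(ℝ, E)) 𝓘(ℝ, ℝ) m (g, 1) :=
    hm.mdifferentiableAt (by simp)
  have hi : HasMFDerivAt 𝓘(ℝ, E) (𝓘(ℝ, E).prod 𝓘(ℝ, E)) (fun x : G => (g, x)) 1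
      (mfderiv 𝓘(ℝ, E) (𝓘(ℝ, E).prod 𝓘(ℝ, E)) (fun x : G => (g, x)) 1) :=
    (mdifferentiableAt_const.prodMk mdifferentiableAt_id).hasMFDerivAt
  have h1 := (HasMFDerivAt.comp (1 : G) (g := m) hd.hasMFDerivAt hi).mfderiv
  rw [mfderiv_prod_right] at h1
  exact DFunLike.congr_fun h1 v

theorem leftDeriv_lie [CompleteSpace E] {f : G → ℝ} (hf : ContMDiff 𝓘(ℝ, E) 𝓘(ℝ, ℝ) ∞ f)
    (v w : GroupLieAlgebra 𝓘(ℝ, E) G) (g : G) :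
    leftDeriv ⁅v, w⁆ f g =
      leftDeriv v (leftDeriv w f) g - leftDeriv w (leftDeriv v f) g := by
  have : IsManifold 𝓘(ℝ, E) ∞ G := inferInstance
  have h := mfderiv_mlieBracket hf (V := mulInvariantVectorField v)
    (W := mulInvariantVectorField w) (x := g)
    (mdifferentiableAt_mulInvariantVectorField v) (mdifferentiableAt_mulInvariantVectorField w)
    ((contMDiff_leftDeriv hf v).mdifferentiableAt (by simp))
    ((contMDiff_leftDeriv hf w).mdifferentiableAt (by simp))
  rw [← mulInvariantVector_mlieBracket] at h
  exact h

end LeftTrivialization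

/-! ### The Jacobi identity in left trivialization. -/

section Jacobi

variable {E : Type*} [NormedAddCommGroup E] [NormedSpace ℝ E] {G : Type*} [TopologicalSpace G]
  [ChartedSpace E G] [Group G]

/-- The left trivialization `𝔤^* → 𝔤` of a bivector field at `g`. -/
def BivectorField.leftSharp (π : BivectorField 𝓘(ℝ, E) G) (g : G) :
    Module.Dual ℝ (GroupLieAlgebra 𝓘(ℝ, E) G) →ₗ[ℝ] GroupLieAlgebra 𝓘(ℝ, E) G :=
  maurerCartan 𝓘(ℝ, E) g ∘ₗ π.sharp g ∘ₗ (maurerCartan 𝓘(ℝ, E) g).dualMap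

/-- The left trivialization of the differential of a function. -/
def leftDifferential (f : G → ℝ) (g : G) : Module.Dual ℝ (GroupLieAlgebra 𝓘(ℝ, E) G) :=
  differential 𝓘(ℝ, E) f g ∘ₗ leftTranslate g

theorem leftDifferential_apply (f : G → ℝ) (g : G) (v : GroupLieAlgebra 𝓘(ℝ, E) G) :
    leftDifferential f g v = leftDeriv v f g := rfl

theorem BivectorField.leftSharp_skew (π : BivectorField 𝓘(ℝ, E) G) (g : G)
    (ξ η : Module.Dual ℝ (GroupLieAlgebra 𝓘(ℝ, E) G)) :
    ξ (π.leftSharp g η) = -η (π.leftSharp g ξ) :=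
  π.skew g ((maurerCartan 𝓘(ℝ, E) g).dualMap ξ) ((maurerCartan 𝓘(ℝ, E) g).dualMap η)

theorem leftDeriv_mul_const {f : G → ℝ} {g : G} (hf : MDifferentiableAt 𝓘(ℝ, E) 𝓘(ℝ, ℝ) f g)
    (c : ℝ) (v : GroupLieAlgebra 𝓘(ℝ, E) G) :
    leftDeriv v (fun x => f x * c) g = leftDeriv v f g * c := by
  rw [leftDeriv_mul hf mdifferentiableAt_const, leftDeriv_const, mul_zero, add_zero]

theorem leftDifferential_eq_sum (f : G → ℝ) (g : G) {ι : Type*} [Fintype ι]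
    (b : Module.Basis ι ℝ (GroupLieAlgebra 𝓘(ℝ, E) G)) :
    leftDifferential f g = ∑ i, leftDeriv (b i) f g • b.coord i := by
  refine b.ext fun j => ?_
  classical
  simp [leftDifferential_apply, Finsupp.single_apply]

theorem leftDeriv_eq_sum (f : G → ℝ) (g : G) {ι : Type*} [Fintype ι]
    (b : Module.Basis ι ℝ (GroupLieAlgebra 𝓘(ℝ, E) G)) (v : GroupLieAlgebra 𝓘(ℝ, E) G) :
    leftDeriv v f g = ∑ i, leftDeriv (b i) f g * b.coord i v := by
  rw [← leftDifferential_apply, leftDifferential_eq_sum f g b]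
  simp

variable [LieGroup 𝓘(ℝ, E) ∞ G]

theorem dualMap_maurerCartan_leftDifferential (f : G → ℝ) (g : G) :
    (maurerCartan 𝓘(ℝ, E) g).dualMap (leftDifferential f g) = differential 𝓘(ℝ, E) f g := by
  ext u
  exact congrArg (differential 𝓘(ℝ, E) f g) (leftTranslate_maurerCartan g u)

theorem leftTranslate_leftSharp (π : BivectorField 𝓘(ℝ, E) G) (g : G)
    (ξ : Module.Dual ℝ (GroupLieAlgebra 𝓘(ℝ, E) G)) :
    leftTranslate g (π.leftSharp g ξ) = π.sharp g ((maurerCartan 𝓘(ℝ, E) g).dualMap ξ) :=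
  leftTranslate_maurerCartan g _

theorem BivectorField.bracket_eq_leftDeriv (π : BivectorField 𝓘(ℝ, E) G) (f h : G → ℝ) (g : G) :
    π.bracket f h g = leftDeriv (π.leftSharp g (leftDifferential f g)) h g := by
  rw [leftDeriv, leftTranslate_leftSharp, dualMap_maurerCartan_leftDifferential]
  rfl

theorem BivectorField.bracket_eq_sum (π : BivectorField 𝓘(ℝ, E) G) (f h : G → ℝ) (g : G)
    {ι : Type*} [Fintype ι] (b : Module.Basis ι ℝ (GroupLieAlgebra 𝓘(ℝ, E) G)) :
    π.bracket f h g = ∑ i, ∑ j, b.coord j (π.leftSharp g (b.coord i)) *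
      (leftDeriv (b i) f g * leftDeriv (b j) h g) := by
  rw [π.bracket_eq_leftDeriv, leftDeriv_eq_sum h g b, leftDifferential_eq_sum f g b]
  simp only [map_sum, map_smul, smul_eq_mul, Finset.mul_sum]
  rw [Finset.sum_comm]
  refine Finset.sum_congr rfl fun i _ => Finset.sum_congr rfl fun j _ => ?_
  ring

variable [FiniteDimensional ℝ E]

instance : FiniteDimensional ℝ (GroupLieAlgebra 𝓘(ℝ, E) G) :=
  inferInstanceAs (FiniteDimensional ℝ E)

variable {π : BivectorField 𝓘(ℝ, E) G}

theorem BivectorField.isSmooth_of_leftSharp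
    (hs : ∀ ξ η : Module.Dual ℝ (GroupLieAlgebra 𝓘(ℝ, E) G),
      ContMDiff 𝓘(ℝ, E) 𝓘(ℝ, ℝ) ∞ fun g => η (π.leftSharp g ξ)) : π.IsSmooth := by
  intro f h hf hh
  let b := Module.finBasis ℝ (GroupLieAlgebra 𝓘(ℝ, E) G)
  have e : π.bracket f h = fun g => ∑ i, ∑ j, b.coord j (π.leftSharp g (b.coord i)) *
      (leftDeriv (b i) f g * leftDeriv (b j) h g) := by
    funext g
    exact π.bracket_eq_sum f h g b
  rw [e]
  exact ContMDiff.sum fun i _ => ContMDiff.sum fun j _ =>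
    (hs _ _).mul ((contMDiff_leftDeriv hf _).mul (contMDiff_leftDeriv hh _))

/-- The product rule in a basis of `𝔤`: one term with the covectors frozen at `g`, and two with
second derivatives of `f` and `h`. The minus sign comes from skewness, which moves the
differentiated covector out of the argument of `π^♯`. -/
theorem BivectorField.leftDeriv_bracket
    (hs : ∀ ξ η : Module.Dual ℝ (GroupLieAlgebra 𝓘(ℝ, E) G),
      ContMDiff 𝓘(ℝ, E) 𝓘(ℝ, ℝ) ∞ fun g => η (π.leftSharp g ξ)) {f h : G → ℝ}
    (hf : ContMDiff 𝓘(ℝ, E) 𝓘(ℝ, ℝ) ∞ f) (hh : ContMDiff 𝓘(ℝ, E) 𝓘(ℝ, ℝ) ∞ h) (g : G)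
    (v : GroupLieAlgebra 𝓘(ℝ, E) G) :
    leftDeriv v (π.bracket f h) g =
      leftDeriv v (fun x => leftDifferential h g (π.leftSharp x (leftDifferential f g))) g
      - leftDeriv v (leftDeriv (π.leftSharp g (leftDifferential h g)) f) g
      + leftDeriv v (leftDeriv (π.leftSharp g (leftDifferential f g)) h) g := by
  let b := Module.finBasis ℝ (GroupLieAlgebra 𝓘(ℝ, E) G)
  have hd : ∀ {F : G → ℝ}, ContMDiff 𝓘(ℝ, E) 𝓘(ℝ, ℝ) ∞ F →
      MDifferentiableAt 𝓘(ℝ, E) 𝓘(ℝ, ℝ) F g := fun hF => hF.mdifferentiableAt (by simp)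
  have hdd : ∀ {F : G → ℝ}, ContMDiff 𝓘(ℝ, E) 𝓘(ℝ, ℝ) ∞ F → ∀ w,
      MDifferentiableAt 𝓘(ℝ, E) 𝓘(ℝ, ℝ) (leftDeriv w F) g :=
    fun hF w => hd (contMDiff_leftDeriv hF w)
  have hsec : ∀ {F : G → ℝ}, ContMDiff 𝓘(ℝ, E) 𝓘(ℝ, ℝ) ∞ F → ∀ w,
      leftDeriv v (leftDeriv w F) g = ∑ i, leftDeriv v (leftDeriv (b i) F) g * b.coord i w := by
    intro F hF w
    have e : leftDeriv w F = fun x => ∑ i, leftDeriv (b i) F x * b.coord i w := by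
      funext x
      exact leftDeriv_eq_sum F x b w
    rw [e, leftDeriv_sum]
    · exact Finset.sum_congr rfl fun i _ => leftDeriv_mul_const (hdd hF (b i)) _ v
    · exact fun i => (hdd hF (b i)).mul mdifferentiableAt_const
  have e1 : π.bracket f h = fun g => ∑ i, ∑ j, b.coord j (π.leftSharp g (b.coord i)) *
      (leftDeriv (b i) f g * leftDeriv (b j) h g) := by
    funext g
    exact π.bracket_eq_sum f h g b
  have e2 : (fun x => leftDifferential h g (π.leftSharp x (leftDifferential f g))) =
      fun x => ∑ i, ∑ j, b.coord j (π.leftSharp x (b.coord i)) *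
        (leftDeriv (b i) f g * leftDeriv (b j) h g) := by
    funext x
    rw [leftDifferential_apply, leftDeriv_eq_sum h g b, leftDifferential_eq_sum f g b]
    simp only [map_sum, map_smul, smul_eq_mul, Finset.mul_sum]
    rw [Finset.sum_comm]
    refine Finset.sum_congr rfl fun i _ => Finset.sum_congr rfl fun j _ => ?_
    ring
  have sm : ∀ i j, ContMDiff 𝓘(ℝ, E) 𝓘(ℝ, ℝ) ∞
      fun x => b.coord j (π.leftSharp x (b.coord i)) * (leftDeriv (b i) f x * leftDeriv (b j) h x) :=
    fun i j => (hs _ _).mul ((contMDiff_leftDeriv hf _).mul (contMDiff_leftDeriv hh _))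
  have e3 : leftDeriv v (π.bracket f h) g = ∑ i, ∑ j,
      (leftDeriv v (fun x => b.coord j (π.leftSharp x (b.coord i))) g *
        (leftDeriv (b i) f g * leftDeriv (b j) h g) + b.coord j (π.leftSharp g (b.coord i)) *
        (leftDeriv v (leftDeriv (b i) f) g * leftDeriv (b j) h g +
          leftDeriv (b i) f g * leftDeriv v (leftDeriv (b j) h) g)) := by
    rw [e1, leftDeriv_sum _ fun i => hd (ContMDiff.sum fun j _ => sm i j)]
    refine Finset.sum_congr rfl fun i _ => ?_
    rw [leftDeriv_sum _ fun j => hd (sm i j)]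
    refine Finset.sum_congr rfl fun j _ => ?_
    rw [← leftDeriv_mul (hdd hf _) (hdd hh _)]
    exact leftDeriv_mul (hd (hs _ _)) ((hdd hf _).mul (hdd hh _)) v
  have e4 : leftDeriv v (fun x => leftDifferential h g (π.leftSharp x (leftDifferential f g))) g =
      ∑ i, ∑ j, leftDeriv v (fun x => b.coord j (π.leftSharp x (b.coord i))) g *
        (leftDeriv (b i) f g * leftDeriv (b j) h g) := by
    have sc : ∀ (i j) (c : ℝ), ContMDiff 𝓘(ℝ, E) 𝓘(ℝ, ℝ) ∞
        fun x => b.coord j (π.leftSharp x (b.coord i)) * c :=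
      fun i j c => (hs _ _).mul contMDiff_const
    rw [e2, leftDeriv_sum]
    · refine Finset.sum_congr rfl fun i _ => ?_
      rw [leftDeriv_sum]
      · exact Finset.sum_congr rfl fun j _ => leftDeriv_mul_const (hd (hs _ _)) _ v
      · exact fun j => hd (sc i j _)
    · exact fun i => hd (ContMDiff.sum fun j _ => sc i j _)
  have e5 : leftDeriv v (leftDeriv (π.leftSharp g (leftDifferential h g)) f) g =
      -∑ i, ∑ j, b.coord j (π.leftSharp g (b.coord i)) *
        (leftDeriv v (leftDeriv (b i) f) g * leftDeriv (b j) h g) := by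
    rw [hsec hf, ← Finset.sum_neg_distrib]
    refine Finset.sum_congr rfl fun i _ => ?_
    rw [π.leftSharp_skew, leftDifferential_apply, leftDeriv_eq_sum h g b, mul_neg, Finset.mul_sum]
    congr 1
    refine Finset.sum_congr rfl fun j _ => ?_
    ring
  have e6 : leftDeriv v (leftDeriv (π.leftSharp g (leftDifferential f g)) h) g =
      ∑ i, ∑ j, b.coord j (π.leftSharp g (b.coord i)) *
        (leftDeriv (b i) f g * leftDeriv v (leftDeriv (b j) h) g) := by
    rw [hsec hh, leftDifferential_eq_sum f g b]
    simp only [map_sum, map_smul, smul_eq_mul, Finset.mul_sum]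
    rw [Finset.sum_comm]
    refine Finset.sum_congr rfl fun i _ => Finset.sum_congr rfl fun j _ => ?_
    ring
  rw [e3, e4, e5, e6]
  simp only [mul_add, Finset.sum_add_distrib]
  ring

/-- The Jacobi identity of a bivector field on a Lie group in terms of its left trivialization. -/
theorem BivectorField.isPoisson_of_leftSharp [CompleteSpace E]
    (hs : ∀ ξ η : Module.Dual ℝ (GroupLieAlgebra 𝓘(ℝ, E) G),
      ContMDiff 𝓘(ℝ, E) 𝓘(ℝ, ℝ) ∞ fun g => η (π.leftSharp g ξ))
    (hj : ∀ (g : G) (ξ₁ ξ₂ ξ₃ : Module.Dual ℝ (GroupLieAlgebra 𝓘(ℝ, E) G)),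
      leftDeriv (π.leftSharp g ξ₁) (fun x => ξ₃ (π.leftSharp x ξ₂)) g +
        leftDeriv (π.leftSharp g ξ₂) (fun x => ξ₁ (π.leftSharp x ξ₃)) g +
        leftDeriv (π.leftSharp g ξ₃) (fun x => ξ₂ (π.leftSharp x ξ₁)) g +
        ξ₃ ⁅π.leftSharp g ξ₁, π.leftSharp g ξ₂⁆ + ξ₁ ⁅π.leftSharp g ξ₂, π.leftSharp g ξ₃⁆ +
        ξ₂ ⁅π.leftSharp g ξ₃, π.leftSharp g ξ₁⁆ = 0) : π.IsPoisson := by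
  refine ⟨BivectorField.isSmooth_of_leftSharp hs, fun f₁ f₂ f₃ h₁ h₂ h₃ g => ?_⟩
  have h := hj g (leftDifferential f₁ g) (leftDifferential f₂ g) (leftDifferential f₃ g)
  rw [leftDifferential_apply f₁ g ⁅_, _⁆, leftDifferential_apply f₂ g ⁅_, _⁆,
    leftDifferential_apply f₃ g ⁅_, _⁆, leftDeriv_lie h₁, leftDeriv_lie h₂, leftDeriv_lie h₃] at h
  rw [π.bracket_eq_leftDeriv f₁, π.bracket_eq_leftDeriv f₂ (π.bracket f₃ f₁),
    π.bracket_eq_leftDeriv f₃ (π.bracket f₁ f₂), BivectorField.leftDeriv_bracket hs h₂ h₃,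
    BivectorField.leftDeriv_bracket hs h₃ h₁, BivectorField.leftDeriv_bracket hs h₁ h₂]
  -- The second-derivative terms pair up into the commutators that express the brackets in `hj`;
  -- what remains is `hj` for the covectors frozen at `g`.
  linarith

end Jacobi

theorem bilin_eq_sum {V : Type*} [AddCommGroup V] [Module ℝ V] (B : LinearMap.BilinForm ℝ V)
    {n : Type*} [Fintype n] (b : Module.Basis n ℝ V) (x y : V) :
    B x y = ∑ i, b.coord i x * B (b i) y := by
  have h := congrArg (fun z => B z y) (b.sum_repr x)
  simp only [map_sum, map_smul, LinearMap.sum_apply, LinearMap.smul_apply, smul_eq_mul] at h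
  exact h.symm

theorem map_inv_map {G V : Type*} [Group G] [AddCommGroup V] [Module ℝ V] {Ad : G →* (V →ₗ[ℝ] V)} (g : G) (w : V) : Ad g⁻¹ (Ad g w) = w := by
  rw [← Module.End.mul_apply, ← map_mul, inv_mul_cancel, map_one, Module.End.one_apply]

theorem map_map_inv {G V : Type*} [Group G] [AddCommGroup V] [Module ℝ V] {Ad : G →* (V →ₗ[ℝ] V)} (g : G) (w : V) : Ad g (Ad g⁻¹ w) = w := by
  rw [← Module.End.mul_apply, ← map_mul, mul_inv_cancel, map_one, Module.End.one_apply]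

/-! ### Actions integrating `ad`, and the projection criterion for Poisson structures. -/

section Action

variable {E : Type*} [NormedAddCommGroup E] [NormedSpace ℝ E] {G : Type*} [TopologicalSpace G]
  [ChartedSpace E G] [Group G] {𝔡 : Type*} [LieRing 𝔡] [LieAlgebra ℝ 𝔡]

/-- `Ad` is a smooth linear action of `G` on `𝔡` whose derivative is the action `v ↦ ad (ι v)`. -/
structure IntegratesAd (ι : GroupLieAlgebra 𝓘(ℝ, E) G →ₗ[ℝ] 𝔡) (Ad : G →* (𝔡 →ₗ[ℝ] 𝔡)) :
    Prop where
  smooth : ∀ (w : 𝔡) (φ : Module.Dual ℝ 𝔡),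
    ContMDiff 𝓘(ℝ, E) 𝓘(ℝ, ℝ) ∞ (fun g => φ (Ad g w))
  deriv_one : ∀ (w : 𝔡) (φ : Module.Dual ℝ 𝔡) (v : GroupLieAlgebra 𝓘(ℝ, E) G),
    differential 𝓘(ℝ, E) (fun g => φ (Ad g w)) 1 v = φ ⁅ι v, w⁆

variable {ι : GroupLieAlgebra 𝓘(ℝ, E) G →ₗ[ℝ] 𝔡} {Ad : G →* (𝔡 →ₗ[ℝ] 𝔡)}

namespace IntegratesAd

variable (h : IntegratesAd ι Ad)
include h

/-- A functional vanishing on `W` has constant matrix coefficient on `w`, so it also vanishes on the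
derivative at `1`. The two subspaces may differ, since tangency and descent only confine `Ad_K 𝔨°`
to a larger space. -/
theorem lie_mem {V W : Submodule ℝ 𝔡} (hV : ∀ g, ∀ w ∈ V, Ad g w ∈ W)
    (v : GroupLieAlgebra 𝓘(ℝ, E) G) {w : 𝔡} (hw : w ∈ V) : ⁅ι v, w⁆ ∈ W := by
  by_contra hn
  obtain ⟨φ, hφ, hW⟩ := Submodule.exists_le_ker_of_notMem hn
  refine hφ ?_
  rw [← h.deriv_one]
  have e : (fun g => φ (Ad g w)) = fun _ => (0 : ℝ) := funext fun g => hW (hV g w hw)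
  rw [e]
  exact DFunLike.congr_fun (hasMFDerivAt_const (0 : ℝ) (1 : G)).mfderiv v

theorem smooth_bilin [FiniteDimensional ℝ 𝔡] (B : LinearMap.BilinForm ℝ 𝔡) (w w' : 𝔡) :
    ContMDiff 𝓘(ℝ, E) 𝓘(ℝ, ℝ) ∞ fun g => B (Ad g w) (Ad g w') := by
  let b := Module.finBasis ℝ 𝔡
  have e : (fun g => B (Ad g w) (Ad g w')) =
      fun g => ∑ i, b.coord i (Ad g w) * B (b i) (Ad g w') := by
    funext g
    exact bilin_eq_sum B b _ _
  rw [e]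
  exact ContMDiff.sum fun i _ => (h.smooth w _).mul (h.smooth w' _)

variable [LieGroup 𝓘(ℝ, E) ∞ G]

theorem leftDeriv_apply (w : 𝔡) (φ : Module.Dual ℝ 𝔡) (v : GroupLieAlgebra 𝓘(ℝ, E) G) (g : G) :
    leftDeriv v (fun x => φ (Ad x w)) g = φ (Ad g ⁅ι v, w⁆) := by
  rw [leftDeriv_eq ((h.smooth w φ).mdifferentiableAt (by simp))]
  have e : (fun x => φ (Ad (g * x) w)) = fun x => (φ ∘ₗ Ad g) (Ad x w) := by
    funext x
    simp
  rw [e, h.deriv_one]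
  rfl

variable [FiniteDimensional ℝ 𝔡]

theorem leftDeriv_bilin (B : LinearMap.BilinForm ℝ 𝔡) (w w' : 𝔡)
    (v : GroupLieAlgebra 𝓘(ℝ, E) G) (g : G) :
    leftDeriv v (fun g => B (Ad g w) (Ad g w')) g =
      B (Ad g ⁅ι v, w⁆) (Ad g w') + B (Ad g w) (Ad g ⁅ι v, w'⁆) := by
  let b := Module.finBasis ℝ 𝔡
  have hd : ∀ (w : 𝔡) (φ : Module.Dual ℝ 𝔡),
      MDifferentiableAt 𝓘(ℝ, E) 𝓘(ℝ, ℝ) (fun x => φ (Ad x w)) g :=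
    fun w φ => (h.smooth w φ).mdifferentiableAt (by simp)
  have e1 : (fun g => B (Ad g w) (Ad g w')) =
      fun g => ∑ i, b.coord i (Ad g w) * B (b i) (Ad g w') := funext fun g => bilin_eq_sum B b _ _
  rw [e1, leftDeriv_sum]
  · rw [bilin_eq_sum B b (Ad g ⁅ι v, w⁆), bilin_eq_sum B b (Ad g w), ← Finset.sum_add_distrib]
    refine Finset.sum_congr rfl fun i _ => ?_
    rw [← h.leftDeriv_apply, ← h.leftDeriv_apply]
    exact leftDeriv_mul (hd w _) (hd w' _) v
  · exact fun i => (hd w _).mul (hd w' _)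

end IntegratesAd

/-- The algebraic identity behind the Jacobi identity of dressing bivector fields. -/
theorem cyclic_projection_identity {B : LinearMap.BilinForm ℝ 𝔡}
    (hsymm : ∀ v w : 𝔡, B v w = B w v) (hinv : ∀ u v w : 𝔡, B ⁅u, v⁆ w + B v ⁅u, w⁆ = 0)
    (P : 𝔡 →ₗ[ℝ] 𝔡) (𝔠 : LieSubalgebra ℝ 𝔡) (hP : ∀ x ∈ 𝔠, P x ∈ 𝔠)
    (h₁ : ∀ x ∈ 𝔠, ∀ y ∈ 𝔠, B (P x) (P y) = 0)
    (h₂ : ∀ x ∈ 𝔠, ∀ y ∈ 𝔠, B (x - P x) (y - P y) = 0)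
    (h₃ : ∀ x ∈ 𝔠, ∀ y ∈ 𝔠, ∀ z ∈ 𝔠, B ⁅P x, P y⁆ (P z) = 0)
    (h₄ : ∀ x ∈ 𝔠, ∀ y ∈ 𝔠, ∀ z ∈ 𝔠, B ⁅x - P x, y - P y⁆ (z - P z) = 0)
    {x y z : 𝔡} (hx : x ∈ 𝔠) (hy : y ∈ 𝔠) (hz : z ∈ 𝔠) (h₅ : B ⁅x, y⁆ z = 0) :
    B (P ⁅P x, y⁆) z + B (P ⁅P y, z⁆) x + B (P ⁅P z, x⁆) y = 0 := by
  have cyc : ∀ a b c : 𝔡, B ⁅a, b⁆ c = B ⁅b, c⁆ a := by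
    intro a b c
    have h1 := hinv b a c
    rw [← lie_skew a b]
    simp only [map_neg, LinearMap.neg_apply]
    rw [hsymm a] at h1
    linarith
  -- With `X = ⁅P a, b⁆`, isotropy of the image allows `c - P c` in place of `c`, and isotropy of
  -- the complementary part then allows `X` in place of `P X`.
  have key : ∀ a ∈ 𝔠, ∀ b ∈ 𝔠, ∀ c ∈ 𝔠,
      B (P ⁅P a, b⁆) c = B ⁅P a, P b⁆ (c - P c) + B ⁅P a, b - P b⁆ (c - P c) := by
    intro a ha b hb c hc
    have hab : ⁅P a, b⁆ ∈ 𝔠 := 𝔠.lie_mem (hP a ha) hb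
    have e1 := h₁ _ hab c hc
    have e2 := h₂ _ hab c hc
    rw [← LinearMap.add_apply, ← map_add, ← lie_add, add_sub_cancel]
    simp only [map_sub, LinearMap.sub_apply] at e1 e2 ⊢
    linarith
  rw [key x hx y hy z hz, key y hy z hz x hx, key z hz x hx y hy]
  have hPPP := h₃ x hx y hy z hz
  have hQQQ := h₄ x hx y hy z hz
  have ex : x = P x + (x - P x) := by abel
  have ey : y = P y + (y - P y) := by abel
  have ez : z = P z + (z - P z) := by abel
  generalize x - P x = x' at *
  generalize y - P y = y' at *
  generalize z - P z = z' at *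
  generalize P x = a at *
  generalize P y = b at *
  generalize P z = c at *
  -- Of the eight terms in the expansion of `B ⁅x, y⁆ z`, the two pure ones vanish by `h₃` and `h₄`;
  -- the six mixed ones form the cyclic sum, by cyclicity of `B ⁅·, ·⁆ ·`.
  rw [ex, ey, ez] at h₅
  simp only [add_lie, lie_add, map_add, LinearMap.add_apply] at h₅
  linarith [cyc a b z', cyc b z' a, cyc a y' c, cyc y' c a, cyc a y' z', cyc y' z' a,
    cyc x' y' c, cyc y' c x', cyc z' x' b, cyc x' b z', cyc c a y', cyc c x' b, cyc x' b c]

/-- A bivector field on a Lie group, given by a projection onto `𝔤` in an invariant extension `𝔡` of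
`𝔤`, is a Poisson structure. -/
theorem isPoisson_of_projection [LieGroup 𝓘(ℝ, E) ∞ G] [FiniteDimensional ℝ E] [CompleteSpace E]
    [FiniteDimensional ℝ 𝔡]
    (h : IntegratesAd ι Ad) (hι : ∀ v w, ι ⁅v, w⁆ = ⁅ι v, ι w⁆)
    {B : LinearMap.BilinForm ℝ 𝔡}
    (hsymm : ∀ v w : 𝔡, B v w = B w v) (hinv : ∀ u v w : 𝔡, B ⁅u, v⁆ w + B v ⁅u, w⁆ = 0)
    (hAdB : ∀ g v w, B (Ad g v) (Ad g w) = B v w) (hAd : ∀ g v w, Ad g ⁅v, w⁆ = ⁅Ad g v, Ad g w⁆)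
    (P : 𝔡 →ₗ[ℝ] 𝔡) (𝔠 : LieSubalgebra ℝ 𝔡) (hP : ∀ x ∈ 𝔠, P x ∈ 𝔠)
    (h₁ : ∀ x ∈ 𝔠, ∀ y ∈ 𝔠, B (P x) (P y) = 0)
    (h₂ : ∀ x ∈ 𝔠, ∀ y ∈ 𝔠, B (x - P x) (y - P y) = 0)
    (h₃ : ∀ x ∈ 𝔠, ∀ y ∈ 𝔠, ∀ z ∈ 𝔠, B ⁅P x, P y⁆ (P z) = 0)
    (h₄ : ∀ x ∈ 𝔠, ∀ y ∈ 𝔠, ∀ z ∈ 𝔠, B ⁅x - P x, y - P y⁆ (z - P z) = 0)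
    (s : Module.Dual ℝ (GroupLieAlgebra 𝓘(ℝ, E) G) → 𝔡) (hs : ∀ ξ v, B (ι v) (s ξ) = ξ v)
    (hs𝔠 : ∀ g ξ, Ad g (s ξ) ∈ 𝔠) (h₅ : ∀ ξ₁ ξ₂ ξ₃, B ⁅s ξ₁, s ξ₂⁆ (s ξ₃) = 0)
    {π : BivectorField 𝓘(ℝ, E) G}
    (hπ : ∀ g ξ, ι (π.leftSharp g ξ) = Ad g⁻¹ (P (Ad g (s ξ)))) : π.IsPoisson := by
  -- The components of `π` are matrix coefficients of the action for the bilinear form `B (P ·) ·`,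
  -- hence smooth with known derivatives.
  have e : ∀ ξ η, (fun g => η (π.leftSharp g ξ)) =
      fun g => (B ∘ₗ P) (Ad g (s ξ)) (Ad g (s η)) := by
    intro ξ η
    funext g
    rw [← hs η, hπ, ← hAdB g, map_map_inv]
    rfl
  refine BivectorField.isPoisson_of_leftSharp (fun ξ η => ?_) fun g ξ₁ ξ₂ ξ₃ => ?_
  · rw [e]
    exact h.smooth_bilin _ _ _
  · have e1 : ∀ a b c, leftDeriv (π.leftSharp g a) (fun x => c (π.leftSharp x b)) g =
        B (P ⁅P (Ad g (s a)), Ad g (s b)⁆) (Ad g (s c)) +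
          B (P (Ad g (s b))) ⁅P (Ad g (s a)), Ad g (s c)⁆ := by
      intro a b c
      rw [e, h.leftDeriv_bilin, hAd, hAd, hπ, map_map_inv]
      rfl
    have e2 : ∀ a b c, c ⁅π.leftSharp g a, π.leftSharp g b⁆ =
        B ⁅P (Ad g (s a)), P (Ad g (s b))⁆ (Ad g (s c)) := by
      intro a b c
      rw [← hs c, hι, ← hAdB g, hAd, hπ, hπ, map_map_inv, map_map_inv]
    rw [e1, e1, e1, e2, e2, e2]
    have h5 : B ⁅Ad g (s ξ₁), Ad g (s ξ₂)⁆ (Ad g (s ξ₃)) = 0 := by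
      rw [← hAd, hAdB, h₅]
    have key := cyclic_projection_identity hsymm hinv P 𝔠 hP h₁ h₂ h₃ h₄ (hs𝔠 g ξ₁) (hs𝔠 g ξ₂)
      (hs𝔠 g ξ₃) h5
    -- By invariance of `B`, the terms from differentiating the second argument cancel the bracket
    -- terms, and `key` disposes of the rest.
    linarith [hinv (P (Ad g (s ξ₁))) (P (Ad g (s ξ₂))) (Ad g (s ξ₃)),
      hinv (P (Ad g (s ξ₂))) (P (Ad g (s ξ₃))) (Ad g (s ξ₁)),
      hinv (P (Ad g (s ξ₃))) (P (Ad g (s ξ₁))) (Ad g (s ξ₂))]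

end Action

/-! ### Infinitesimally stable subspaces are stable under connected groups. -/

section Stability

/-- A continuous linear system of differential equations with zero initial value has only the
trivial solution. -/
theorem linear_ode_eq_zero {n : Type*} [Fintype n] {f : ℝ → n → ℝ} {m : ℝ → n → n → ℝ} {b : ℝ}
    (hm : ∀ i j, ContinuousOn (fun t => m t i j) (Set.Icc 0 b))
    (hf : ∀ t ∈ Set.Icc 0 b, ∀ i, HasDerivAt (fun t => f t i) (∑ j, m t i j * f t j) t)
    (h0 : f 0 = 0) : ∀ t ∈ Set.Icc 0 b, f t = 0 := by
  have hc : ContinuousOn (fun t => ∑ i, ∑ j, |m t i j|) (Set.Icc 0 b) :=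
    continuousOn_finsetSum _ fun i _ => continuousOn_finsetSum _ fun j _ => (hm i j).abs
  -- A bound on the sum of all `|m t i j|` bounds the operator for the sup norm, as the Grönwall
  -- estimate requires.
  obtain ⟨C, hC⟩ := isCompact_Icc.exists_bound_of_continuousOn hc
  have hd : ∀ t ∈ Set.Icc 0 b, HasDerivAt f (fun i => ∑ j, m t i j * f t j) t :=
    fun t ht => hasDerivAt_pi.2 (hf t ht)
  refine eq_zero_of_abs_deriv_le_mul_abs_self_of_eq_zero_right (K := C)
    (fun t ht => (hd t ht).continuousAt.continuousWithinAt)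
    (fun t ht => (hd t (Set.Ico_subset_Icc_self ht)).hasDerivWithinAt) h0 fun t ht => ?_
  have hC' := hC t (Set.Ico_subset_Icc_self ht)
  rw [Real.norm_eq_abs] at hC'
  have hC0 : 0 ≤ C := (abs_nonneg _).trans hC'
  rw [pi_norm_le_iff_of_nonneg (by positivity)]
  intro i
  calc ‖∑ j, m t i j * f t j‖ ≤ ∑ j, ‖m t i j * f t j‖ := norm_sum_le _ _
    _ ≤ ∑ j, |m t i j| * ‖f t‖ := Finset.sum_le_sum fun j _ => by
        rw [norm_mul, Real.norm_eq_abs]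
        exact mul_le_mul_of_nonneg_left (norm_le_pi_norm (f t) j) (abs_nonneg _)
    _ = (∑ j, |m t i j|) * ‖f t‖ := by rw [Finset.sum_mul]
    _ ≤ C * ‖f t‖ := by
        refine mul_le_mul_of_nonneg_right ?_ (norm_nonneg _)
        refine (Finset.single_le_sum (f := fun i => ∑ j, |m t i j|)
          (fun i _ => Finset.sum_nonneg fun j _ => abs_nonneg _) (Finset.mem_univ i)).trans ?_
        exact (le_abs_self _).trans hC'

variable {E : Type*} [NormedAddCommGroup E] [NormedSpace ℝ E] {G : Type*} [TopologicalSpace G]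
  [ChartedSpace E G] [Group G] {𝔡 : Type*} [LieRing 𝔡] [LieAlgebra ℝ 𝔡]
  {ι : GroupLieAlgebra 𝓘(ℝ, E) G →ₗ[ℝ] 𝔡} {Ad : G →* (𝔡 →ₗ[ℝ] 𝔡)}
  [LieGroup 𝓘(ℝ, E) ∞ G] [FiniteDimensional ℝ 𝔡]

namespace IntegratesAd

variable (h : IntegratesAd ι Ad)
include h

/-- A subspace stable under the infinitesimal action is preserved along smooth curves from `1`. -/
theorem map_mem_of_curve {V : Submodule ℝ 𝔡} (hV : ∀ v, ∀ w ∈ V, ⁅ι v, w⁆ ∈ V) {γ : ℝ → G}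
    {O : Set ℝ} (hO : IsOpen O) {b : ℝ} (hb : Set.Icc 0 b ⊆ O)
    (hγ : ContMDiffOn 𝓘(ℝ, ℝ) 𝓘(ℝ, E) ∞ γ O) (h0 : γ 0 = 1) :
    ∀ t ∈ Set.Icc 0 b, ∀ w ∈ V, Ad (γ t) w ∈ V := by
  -- The logarithmic derivative `γ⁻¹ γ'`.
  let c : ℝ → GroupLieAlgebra 𝓘(ℝ, E) G := fun t =>
    maurerCartan 𝓘(ℝ, E) (γ t) (mfderiv 𝓘(ℝ, ℝ) 𝓘(ℝ, E) γ t (1 : ℝ))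
  have hdiff : ∀ (w : 𝔡) (φ : Module.Dual ℝ 𝔡), ContDiffOn ℝ ∞ (fun t => φ (Ad (γ t) w)) O := by
    intro w φ
    have h1 := (h.smooth w φ).comp_contMDiffOn hγ
    exact h1.contDiffOn
  have hder : ∀ (w : 𝔡) (φ : Module.Dual ℝ 𝔡), ∀ t ∈ O,
      HasDerivAt (fun t => φ (Ad (γ t) w)) (φ (Ad (γ t) ⁅ι (c t), w⁆)) t := by
    intro w φ t ht
    have h1 : HasMFDerivAt 𝓘(ℝ, ℝ) 𝓘(ℝ, E) γ t (mfderiv 𝓘(ℝ, ℝ) 𝓘(ℝ, E) γ t) :=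
      ((hγ.contMDiffAt (hO.mem_nhds ht)).mdifferentiableAt (by simp)).hasMFDerivAt
    have h2 : HasMFDerivAt 𝓘(ℝ, E) 𝓘(ℝ, ℝ) (fun g => φ (Ad g w)) (γ t)
        (mfderiv 𝓘(ℝ, E) 𝓘(ℝ, ℝ) (fun g => φ (Ad g w)) (γ t)) :=
      ((h.smooth w φ).mdifferentiableAt (by simp)).hasMFDerivAt
    let L : ℝ →L[ℝ] ℝ := (mfderiv 𝓘(ℝ, E) 𝓘(ℝ, ℝ) (fun g => φ (Ad g w)) (γ t)).comp
      (mfderiv 𝓘(ℝ, ℝ) 𝓘(ℝ, E) γ t)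
    have hL : HasFDerivAt (fun t => φ (Ad (γ t) w)) L t := (h2.comp t h1).hasFDerivAt
    have h3 := hL.hasDerivAt
    rw [← h.leftDeriv_apply, leftDeriv, leftTranslate_maurerCartan]
    exact h3
  -- Continuity of `c` itself is not needed: `⁅ι (c t), w⁆` is `Ad (γ t)⁻¹` applied to the
  -- derivative of `Ad (γ t) w`, and both factors have continuous coefficients.
  have hcont : ∀ (w : 𝔡) (ψ : Module.Dual ℝ 𝔡), ContinuousOn (fun t => ψ ⁅ι (c t), w⁆) O := by
    intro w ψ
    let e := Module.finBasis ℝ 𝔡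
    have h1 : ∀ t ∈ O, ψ ⁅ι (c t), w⁆ =
        ∑ i, ψ (Ad (γ t)⁻¹ (e i)) * deriv (fun t => e.coord i (Ad (γ t) w)) t := by
      intro t ht
      have h2 := congrArg (fun z => ψ (Ad (γ t)⁻¹ z)) (e.sum_repr (Ad (γ t) ⁅ι (c t), w⁆))
      simp only [map_inv_map, map_sum, map_smul, smul_eq_mul] at h2
      rw [← h2]
      refine Finset.sum_congr rfl fun i _ => ?_
      rw [(hder w (e.coord i) t ht).deriv, mul_comm]
      rfl
    refine ContinuousOn.congr (continuousOn_finsetSum _ fun i _ => ?_) h1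
    refine ContinuousOn.mul ?_ ((hdiff w (e.coord i)).continuousOn_deriv_of_isOpen hO (by simp))
    have h3 : ContMDiff 𝓘(ℝ, E) 𝓘(ℝ, ℝ) ∞ fun g : G => ψ (Ad g⁻¹ (e i)) :=
      (h.smooth (e i) ψ).comp (contMDiff_inv 𝓘(ℝ, E) ∞)
    exact h3.continuous.comp_continuousOn hγ.continuousOn
  intro t ht w hw
  by_contra hn
  obtain ⟨φ, hφ, hφV⟩ := Submodule.exists_le_ker_of_notMem hn
  refine hφ ?_
  -- With `φ` zero on `V`, the functions `φ (Ad (γ t) (e i))` start at `0`. They satisfy a closed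
  -- linear system because `⁅ι (c t), e i⁆` stays in `V`; the `ψ j` extend the coordinates of `V` to
  -- `𝔡`.
  let e := Module.finBasis ℝ V
  choose ψ hψ using fun i => LinearMap.exists_extend (e.coord i)
  have hsum : ∀ z ∈ V, ∀ x, φ (Ad x z) = ∑ j, ψ j z * φ (Ad x (e j)) := by
    intro z hz x
    have h1 := congrArg (fun y : V => φ (Ad x y)) (e.sum_repr ⟨z, hz⟩)
    simp only [Submodule.coe_sum, Submodule.coe_smul, map_sum, map_smul, smul_eq_mul] at h1
    rw [← h1]
    refine Finset.sum_congr rfl fun j _ => ?_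
    rw [← e.coord_apply, ← hψ j]
    rfl
  have key := linear_ode_eq_zero (f := fun t i => φ (Ad (γ t) (e i)))
    (m := fun t i j => ψ j ⁅ι (c t), (e i : 𝔡)⁆) (b := b)
    (fun i j => (hcont _ _).mono hb) (fun t ht i => by
      rw [← hsum _ (hV _ _ (e i).2)]
      exact hder _ _ t (hb ht)) (by
      funext i
      simp only [h0, map_one, Module.End.one_apply]
      exact hφV (e i).2) t ht
  rw [hsum w hw]
  refine Finset.sum_eq_zero fun j _ => ?_
  rw [congrFun key j]
  simp

/-- On a connected Lie group, a subspace stable under the infinitesimal action is stable. -/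
theorem map_mem [PreconnectedSpace G] {V : Submodule ℝ 𝔡} (hV : ∀ v, ∀ w ∈ V, ⁅ι v, w⁆ ∈ V)
    (g : G) {w : 𝔡} (hw : w ∈ V) : Ad g w ∈ V := by
  have : IsTopologicalGroup G := topologicalGroup_of_lieGroup 𝓘(ℝ, E) ∞
  have hinj : ∀ g, Function.Injective (Ad g) := fun g =>
    Function.LeftInverse.injective (map_inv_map g)
  let S : Subgroup G :=
    { carrier := {g | ∀ w ∈ V, Ad g w ∈ V}
      one_mem' := fun w hw => by simpa using hw
      mul_mem' := fun {a b} ha hb w hw => by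
        rw [map_mul]
        exact ha _ (hb w hw)
      -- In finite dimension the injective `Ad a` maps `V` onto `V`.
      inv_mem' := fun {a} ha w hw => by
        have hle : V.map (Ad a) ≤ V := Submodule.map_le_iff_le_comap.2 ha
        have heq : V.map (Ad a) = V := Submodule.eq_of_le_of_finrank_eq hle
          (Submodule.equivMapOfInjective _ (hinj a) V).finrank_eq.symm
        rw [← heq] at hw
        obtain ⟨z, hz, rfl⟩ := hw
        rw [map_inv_map]
        exact hz }
  -- Every point of a chart ball around `1` is the end of a straight segment from `1`, so the result
  -- on curves applies. An open subgroup is closed, hence all of `G`.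
  have hS : (S : Set G) ∈ nhds 1 := by
    let φ := extChartAt 𝓘(ℝ, E) (1 : G)
    obtain ⟨r, hr, hball⟩ := Metric.mem_nhds_iff.1 (extChartAt_target_mem_nhds (I := 𝓘(ℝ, E)) (1 : G))
    have hn : φ ⁻¹' Metric.ball (φ 1) r ∈ nhds (1 : G) :=
      (continuousAt_extChartAt (I := 𝓘(ℝ, E)) (1 : G)).preimage_mem_nhds (Metric.ball_mem_nhds _ hr)
    filter_upwards [hn, extChartAt_source_mem_nhds (I := 𝓘(ℝ, E)) (1 : G)] with k hk hks
    have hl : ContDiff ℝ ∞ fun t : ℝ => φ 1 + t • (φ k - φ 1) := by fun_prop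
    have hγ : ContMDiffOn 𝓘(ℝ, ℝ) 𝓘(ℝ, E) ∞ (fun t : ℝ => φ.symm (φ 1 + t • (φ k - φ 1)))
        ((fun t : ℝ => φ 1 + t • (φ k - φ 1)) ⁻¹' Metric.ball (φ 1) r) := by
      have h1 : ContMDiffOn 𝓘(ℝ, E) 𝓘(ℝ, E) ∞ φ.symm φ.target := contMDiffOn_extChartAt_symm 1
      exact h1.comp hl.contMDiff.contMDiffOn fun t ht => hball ht
    have h1 : (φ.symm (φ 1 + (0 : ℝ) • (φ k - φ 1)) : G) = 1 := by
      rw [zero_smul, add_zero]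
      exact extChartAt_to_inv 1
    have h2 : (φ.symm (φ 1 + (1 : ℝ) • (φ k - φ 1)) : G) = k := by
      rw [one_smul, add_sub_cancel]
      exact φ.left_inv hks
    have h3 : ∀ w ∈ V, Ad (φ.symm (φ 1 + (1 : ℝ) • (φ k - φ 1))) w ∈ V :=
      h.map_mem_of_curve hV (b := 1) (Metric.isOpen_ball.preimage hl.continuous) (fun t ht => by
        have hk' : ‖φ k - φ 1‖ < r := by simpa [dist_eq_norm] using hk
        simp only [Set.mem_preimage, Metric.mem_ball, dist_eq_norm, add_sub_cancel_left, norm_smul,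
          Real.norm_eq_abs, abs_of_nonneg ht.1]
        exact (mul_le_of_le_one_left (norm_nonneg _) ht.2).trans_lt hk') hγ h1 1 (by simp)
    rw [h2] at h3
    exact h3
  have hopen : IsOpen (S : Set G) := S.isOpen_of_mem_nhds hS
  have huniv : (S : Set G) = Set.univ :=
    IsClopen.eq_univ ⟨S.isClosed_of_isOpen hopen, hopen⟩ ⟨1, S.one_mem⟩
  have hg : g ∈ (S : Set G) := huniv ▸ Set.mem_univ g
  exact hg w hw

end IntegratesAd

end Stability

/-! ### Duality in `𝔡` and the Poisson property of `π_G`. -/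

namespace InvariantManinTriple

variable {E : Type*} [NormedAddCommGroup E] [NormedSpace ℝ E] [CompleteSpace E]
  {G : Type*} [TopologicalSpace G] [ChartedSpace E G] [Group G] [LieGroup 𝓘(ℝ, E) ∞ G]
  {𝔡 : Type*} [LieRing 𝔡] [LieAlgebra ℝ 𝔡] (T : InvariantManinTriple 𝓘(ℝ, E) G 𝔡)

theorem integratesAd : IntegratesAd T.incl.toLinearMap T.Ad :=
  ⟨T.Ad_smooth, T.Ad_deriv⟩

theorem incl_mem_𝔥 {v : GroupLieAlgebra 𝓘(ℝ, E) G} (h : T.incl v ∈ T.𝔥) : v = 0 :=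
  (map_eq_zero_iff T.incl T.incl_injective).1
    (Submodule.disjoint_def.1 T.isCompl.disjoint (T.incl v) ⟨v, rfl⟩ h)

theorem pr_eq_iff (x : 𝔡) (v : GroupLieAlgebra 𝓘(ℝ, E) G) :
    T.pr x = v ↔ x - T.incl v ∈ T.𝔥 := by
  obtain ⟨y, hy, e⟩ := T.exists_eq_incl_pr_add x
  constructor
  · rintro rfl
    rwa [sub_eq_of_eq_add' e]
  · intro h
    have h1 : T.incl (T.pr x - v) ∈ T.𝔥 := by
      have h2 := T.𝔥.sub_mem h hy
      have h3 : x - T.incl v - y = T.incl (T.pr x - v) := by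
        rw [map_sub]
        nth_rewrite 1 [e]
        abel
      rwa [h3] at h2
    exact sub_eq_zero.1 (T.incl_mem_𝔥 h1)

theorem mem_𝔥_of_pairing {x : 𝔡} (h : ∀ y ∈ T.𝔥, T.pairing y x = 0) : x ∈ T.𝔥 := by
  have : x ∈ T.𝔥.toSubmodule.orthogonalBilin T.pairing := h
  rwa [T.lagrangian_𝔥] at this

theorem pairing_lie_cyclic (a b c : 𝔡) : T.pairing ⁅a, b⁆ c = T.pairing ⁅b, c⁆ a := by
  have h1 := T.pairing_invariant b a c
  rw [← lie_skew a b, map_neg, LinearMap.neg_apply]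
  rw [T.pairing_symm a] at h1
  linarith

theorem covector_leftTranslate (g : G) (w : 𝔡) (v : GroupLieAlgebra 𝓘(ℝ, E) G) :
    T.covector g w (leftTranslate g v) = T.pairing (T.incl v) w := by
  rw [covector_apply, maurerCartan_leftTranslate]

theorem mem_ann {𝔨 : Submodule ℝ (GroupLieAlgebra 𝓘(ℝ, E) G)} {w : 𝔡} :
    w ∈ T.ann 𝔨 ↔ w ∈ T.𝔥 ∧ ∀ v ∈ 𝔨, T.pairing (T.incl v) w = 0 := by
  refine Submodule.mem_inf.trans (and_congr Iff.rfl ⟨fun h v hv => h _ ⟨v, hv, rfl⟩, ?_⟩)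
  rintro h _ ⟨v, hv, rfl⟩
  exact h v hv

/-- Elements orthogonal to `𝔨` lie in `𝔤 ⊕ 𝔨°`. -/
theorem exists_eq_incl_add_of_pairing {𝔨 : Submodule ℝ (GroupLieAlgebra 𝓘(ℝ, E) G)} {x : 𝔡}
    (h : ∀ v ∈ 𝔨, T.pairing (T.incl v) x = 0) :
    ∃ y ∈ T.ann 𝔨, x = T.incl (T.pr x) + y := by
  obtain ⟨y, hy, e⟩ := T.exists_eq_incl_pr_add x
  refine ⟨y, T.mem_ann.2 ⟨hy, fun v hv => ?_⟩, e⟩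
  have := h v hv
  rwa [e, map_add, T.pairing_incl, zero_add] at this

variable [FiniteDimensional ℝ 𝔡]

/-- The double orthogonal of `A` is `A`: the pairing is nondegenerate because its radical lies in
`𝔤^⊥ ∩ 𝔥^⊥ = 𝔤 ∩ 𝔥 = 0`. -/
theorem mem_of_pairing (A : Submodule ℝ 𝔡) {x : 𝔡}
    (h : ∀ y, (∀ a ∈ A, T.pairing a y = 0) → T.pairing x y = 0) : x ∈ A := by
  have hsep : ∀ x, (∀ y, T.pairing x y = 0) → x = 0 := by
    intro x hx
    refine Submodule.disjoint_def.1 T.isCompl.disjoint x ?_ ?_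
    · rw [← T.lagrangian_𝔤]
      exact fun y _ => (T.pairing_symm y x).trans (hx y)
    · exact T.mem_𝔥_of_pairing fun y _ => (T.pairing_symm y x).trans (hx y)
  have hnd : T.pairing.Nondegenerate :=
    ⟨hsep, fun y hy => hsep y fun x => (T.pairing_symm y x).trans (hy x)⟩
  have hrefl : T.pairing.IsRefl := fun x y hxy => (T.pairing_symm y x).trans hxy
  rw [← LinearMap.BilinForm.orthogonal_orthogonal hnd hrefl A]
  exact fun y hy => (T.pairing_symm y x).trans (h y hy)

/-- The orthogonal of `𝔨 ⊕ 𝔥` is `𝔨°`; take orthogonals again. -/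
theorem mem_sup_of_pairing_ann {𝔨 : Submodule ℝ (GroupLieAlgebra 𝓘(ℝ, E) G)} {x : 𝔡}
    (h : ∀ w ∈ T.ann 𝔨, T.pairing x w = 0) :
    x ∈ 𝔨.map T.incl.toLinearMap ⊔ T.𝔥.toSubmodule := by
  refine T.mem_of_pairing _ fun y hy => h y (T.mem_ann.2 ⟨T.mem_𝔥_of_pairing fun z hz => ?_, ?_⟩)
  · exact hy z (Submodule.mem_sup_right hz)
  · exact fun v hv => hy _ (Submodule.mem_sup_left ⟨v, hv, rfl⟩)

variable [FiniteDimensional ℝ E]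

theorem exists_covector_eq (g : G) (ξ : Module.Dual ℝ (TangentSpace 𝓘(ℝ, E) g)) :
    ∃ w ∈ T.𝔥, T.covector g w = ξ := by
  obtain ⟨⟨w, hw⟩, e⟩ := (T.covector_bijective g).2 ξ
  exact ⟨w, hw, e⟩

theorem exists_pairing_eq (ξ : Module.Dual ℝ (GroupLieAlgebra 𝓘(ℝ, E) G)) :
    ∃ w ∈ T.𝔥, ∀ v, T.pairing (T.incl v) w = ξ v := by
  obtain ⟨w, hw, e⟩ := T.exists_covector_eq 1 (ξ ∘ₗ maurerCartan 𝓘(ℝ, E) 1)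
  refine ⟨w, hw, fun v => ?_⟩
  rw [← T.covector_leftTranslate 1, e]
  exact congrArg ξ (maurerCartan_leftTranslate 1 v)

/-- The graph of the Poisson-Lie structure in left trivialization. -/
theorem sharp_covector_eq_iff (g : G) {w : 𝔡} (hw : w ∈ T.𝔥) (v : GroupLieAlgebra 𝓘(ℝ, E) G) :
    T.bivector.sharp g (T.covector g w) = leftTranslate g v ↔ T.Ad g (w - T.incl v) ∈ T.𝔥 := by
  have e : ∀ u, (u = leftTranslate g v ↔
      T.Ad g (T.incl (maurerCartan 𝓘(ℝ, E) g u)) = T.Ad g (T.incl v)) := by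
    intro u
    refine ⟨?_, fun h => ?_⟩
    · rintro rfl
      rw [maurerCartan_leftTranslate]
    · have h1 := T.incl_injective (Function.LeftInverse.injective (map_inv_map g) h)
      rw [← h1, leftTranslate_maurerCartan]
  rw [T.bivector_sharp_covector g hw, e, incl_maurerCartan_dressing, map_map_inv, map_sub,
    T.Ad_incl, ← T.pr_eq_iff]
  exact T.incl_injective.eq_iff

/-- The projection criterion for all of `𝔡 = 𝔤 ⊕ 𝔥`, with `s` the duality `𝔤^* → 𝔥`. -/
theorem isPoisson_bivector : T.bivector.IsPoisson := by
  choose s hs𝔥 hs using T.exists_pairing_eq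
  have hmem : ∀ x, x - T.incl (T.pr x) ∈ T.𝔥 := fun x => (T.pr_eq_iff x _).1 rfl
  refine isPoisson_of_projection T.integratesAd (fun v w => T.incl.map_lie v w) T.pairing_symm
    T.pairing_invariant T.Ad_pairing T.Ad_lie (T.incl.toLinearMap ∘ₗ T.pr) ⊤
    (fun _ _ => LieSubalgebra.mem_top _) (fun _ _ _ _ => T.pairing_incl _ _)
    (fun x _ y _ => T.pairing_𝔥 (hmem x) (hmem y)) (fun x _ y _ z _ => ?_)
    (fun x _ y _ z _ => T.pairing_𝔥 (T.𝔥.lie_mem (hmem x) (hmem y)) (hmem z)) s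
    (fun ξ v => hs ξ v) (fun _ _ => LieSubalgebra.mem_top _)
    (fun _ _ _ => T.pairing_𝔥 (T.𝔥.lie_mem (hs𝔥 _) (hs𝔥 _)) (hs𝔥 _)) (fun g ξ => ?_)
  · change T.pairing ⁅T.incl _, T.incl _⁆ (T.incl _) = 0
    rw [← T.incl.map_lie]
    exact T.pairing_incl _ _
  · have e : (maurerCartan 𝓘(ℝ, E) g).dualMap ξ = T.covector g (s ξ) := by
      ext u
      exact (hs ξ _).symm
    change T.incl (maurerCartan 𝓘(ℝ, E) g (T.bivector.sharp g
      ((maurerCartan 𝓘(ℝ, E) g).dualMap ξ))) = _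
    rw [e, T.bivector_sharp_covector g (hs𝔥 ξ), incl_maurerCartan_dressing]
    rfl

end InvariantManinTriple

/-! ### Embedded subgroups and their Lie algebras. -/

section Subgroup

variable {E : Type*} [NormedAddCommGroup E] [NormedSpace ℝ E] {M : Type*} [TopologicalSpace M]
  [ChartedSpace E M] {E' : Type*} [NormedAddCommGroup E'] [NormedSpace ℝ E'] {N : Type*}
  [TopologicalSpace N] [ChartedSpace E' N]

/-- In immersion charts `f` is the inclusion of a factor; projecting back gives a differentiable
local left inverse. -/
theorem Manifold.IsImmersion.tangentLin_injective [IsManifold 𝓘(ℝ, E) ∞ M]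
    [IsManifold 𝓘(ℝ, E') ∞ N] {f : M → N}
    (hf : Manifold.IsImmersion 𝓘(ℝ, E) 𝓘(ℝ, E') ∞ f) (x : M) :
    Function.Injective (tangentLin 𝓘(ℝ, E) 𝓘(ℝ, E') f x) := by
  obtain ⟨F, _, _, h⟩ := hf
  have hfs : ContMDiffAt 𝓘(ℝ, E) 𝓘(ℝ, E') ∞ f x := (h x).contMDiffAt
  let φ := (h x).domChart
  let ψ := (h x).codChart
  let e := (h x).equiv
  have hx : x ∈ φ.source := (h x).mem_domChart_source
  have hfx : f x ∈ ψ.source := (h x).mem_codChart_source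
  have hφi : ContMDiffAt 𝓘(ℝ, E) 𝓘(ℝ, E) ∞ φ.symm (φ x) :=
    (contMDiffOn_symm_of_mem_maximalAtlas (h x).domChart_mem_maximalAtlas).contMDiffAt
      (φ.open_target.mem_nhds (φ.map_source hx))
  have hψs : ContMDiffAt 𝓘(ℝ, E') 𝓘(ℝ, E') ∞ ψ (f x) :=
    (contMDiffOn_of_mem_maximalAtlas (h x).codChart_mem_maximalAtlas).contMDiffAt
      (ψ.open_source.mem_nhds hfx)
  let L : E' →L[ℝ] E := (ContinuousLinearMap.fst ℝ E F).comp (e.symm : E' →L[ℝ] E × F)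
  have heq : (φ.symm ∘ L ∘ ψ ∘ f) =ᶠ[nhds x] id := by
    filter_upwards [φ.open_source.mem_nhds hx] with y hy
    have hz : φ y ∈ (φ.extend 𝓘(ℝ, E)).target := by
      simpa [OpenPartialHomeomorph.extend] using φ.map_source hy
    have h1 := (h x).writtenInCharts hz
    have h2 : ψ (f (φ.symm (φ y))) = e (φ y, 0) := by simpa using h1
    rw [φ.left_inv hy] at h2
    simp only [Function.comp_apply, h2, L, id]
    simp [φ.left_inv hy]
  have hLx : L (ψ (f x)) = φ x := by
    have hz : φ x ∈ (φ.extend 𝓘(ℝ, E)).target := by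
      simpa [OpenPartialHomeomorph.extend] using φ.map_source hx
    have h1 := (h x).writtenInCharts hz
    have h2 : ψ (f (φ.symm (φ x))) = e (φ x, 0) := by simpa using h1
    rw [φ.left_inv hx] at h2
    simp [L, h2]
  have hLs : ContMDiff 𝓘(ℝ, E') 𝓘(ℝ, E) ∞ L := L.contMDiff
  have hr : MDifferentiableAt 𝓘(ℝ, E') 𝓘(ℝ, E) (φ.symm ∘ L ∘ ψ) (f x) := by
    refine ContMDiffAt.mdifferentiableAt (n := ∞) ?_ (by simp)
    exact ContMDiffAt.comp (f x) (by simpa only [Function.comp_apply, hLx] using hφi)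
      (hLs.contMDiffAt.comp (f x) hψs)
  have h1 := heq.mfderiv_eq (I := 𝓘(ℝ, E)) (I' := 𝓘(ℝ, E))
  have h2 : mfderiv 𝓘(ℝ, E) 𝓘(ℝ, E) ((φ.symm ∘ L ∘ ψ) ∘ f) x =
      (mfderiv 𝓘(ℝ, E') 𝓘(ℝ, E) (φ.symm ∘ L ∘ ψ) (f x)).comp (mfderiv 𝓘(ℝ, E) 𝓘(ℝ, E') f x) :=
    mfderiv_comp x hr (hfs.mdifferentiableAt (by simp))
  rw [mfderiv_id] at h1
  have h3 := h2.symm.trans h1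
  intro v w hvw
  have h4 := DFunLike.congr_fun h3 v
  have h5 := DFunLike.congr_fun h3 w
  have h6 : mfderiv 𝓘(ℝ, E) 𝓘(ℝ, E') f x v = mfderiv 𝓘(ℝ, E) 𝓘(ℝ, E') f x w := hvw
  refine h4.symm.trans (Eq.trans ?_ h5)
  exact congrArg (mfderiv 𝓘(ℝ, E') 𝓘(ℝ, E) (φ.symm ∘ L ∘ ψ) (f x)) h6

/-- Every covector of a Hausdorff manifold is the differential of a global smooth function. -/
theorem exists_differential_eq [FiniteDimensional ℝ E] [T2Space M] [IsManifold 𝓘(ℝ, E) ∞ M] (x : M)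
    (ξ : Module.Dual ℝ (TangentSpace 𝓘(ℝ, E) x)) :
    ∃ f : M → ℝ, ContMDiff 𝓘(ℝ, E) 𝓘(ℝ, ℝ) ∞ f ∧ differential 𝓘(ℝ, E) f x = ξ := by
  have : IsManifold 𝓘(ℝ, E) 1 M := IsManifold.of_le (n := ∞) (by exact ENat.LEInfty.out)
  let ρ : SmoothBumpFunction 𝓘(ℝ, E) x := Classical.choice inferInstance
  let L : E →L[ℝ] ℝ := LinearMap.toContinuousLinearMap (𝕜 := ℝ) (E := E) (F' := ℝ) ξ
  refine ⟨fun y => ρ y • L (extChartAt 𝓘(ℝ, E) x y),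
    ρ.contMDiff_smul (L.contMDiff.comp_contMDiffOn contMDiffOn_extChartAt), ?_⟩
  have h1 : (fun y => ρ y • L (extChartAt 𝓘(ℝ, E) x y)) =ᶠ[nhds x]
      L ∘ extChartAt 𝓘(ℝ, E) x := by
    filter_upwards [ρ.eventuallyEq_one] with y hy
    simp [hy]
  have h2 := h1.mfderiv_eq (I := 𝓘(ℝ, E)) (I' := 𝓘(ℝ, ℝ))
  have h3 : HasMFDerivAt 𝓘(ℝ, E) 𝓘(ℝ, ℝ) L (extChartAt 𝓘(ℝ, E) x x) L :=
    L.hasFDerivAt.hasMFDerivAt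
  have h4 := (h3.comp x (mdifferentiableAt_extChartAt (I := 𝓘(ℝ, E))
    (mem_chart_source E x)).hasMFDerivAt).mfderiv
  ext v
  have h5 := DFunLike.congr_fun (h2.trans h4) v
  refine Eq.trans h5 ?_
  have h6 := DFunLike.congr_fun (mfderiv_extChartAt_self (I := 𝓘(ℝ, E)) (x := x)) v
  exact congrArg L h6

variable {G : Type*} [TopologicalSpace G] [ChartedSpace E G] [Group G]
  {K : Subgroup G} {EK : Type*} [NormedAddCommGroup EK] [NormedSpace ℝ EK] [ChartedSpace EK K]

variable (E EK K) in
/-- The inclusion of the Lie algebra of an embedded subgroup. -/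
def subgroupIncl : GroupLieAlgebra 𝓘(ℝ, EK) K →ₗ[ℝ] GroupLieAlgebra 𝓘(ℝ, E) G :=
  tangentLin 𝓘(ℝ, EK) 𝓘(ℝ, E) (Subtype.val : K → G) 1

theorem tangentLin_comp_val_one
    (hv : ContMDiff 𝓘(ℝ, EK) 𝓘(ℝ, E) ∞ (Subtype.val : K → G)) {N : Type*} [TopologicalSpace N]
    [ChartedSpace E' N] {φ : G → N}
    (hφ : MDifferentiableAt 𝓘(ℝ, E) 𝓘(ℝ, E') φ 1) (v : GroupLieAlgebra 𝓘(ℝ, EK) K) :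
    (tangentLin 𝓘(ℝ, EK) 𝓘(ℝ, E') (fun k : K => φ k) 1 v : E') =
      tangentLin 𝓘(ℝ, E) 𝓘(ℝ, E') φ 1 (subgroupIncl E K EK v) := by
  have h1 : HasMFDerivAt 𝓘(ℝ, E) 𝓘(ℝ, E') φ ((1 : K) : G) (mfderiv 𝓘(ℝ, E) 𝓘(ℝ, E') φ 1) :=
    hφ.hasMFDerivAt
  have h2 := (h1.comp (1 : K) (hv.mdifferentiableAt (by simp)).hasMFDerivAt).mfderiv
  exact DFunLike.congr_fun h2 v

variable [LieGroup 𝓘(ℝ, E) ∞ G]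

/-- Smoothness of a continuous map into `K` can be tested in `G`, since the inclusion is an
immersion. -/
theorem lieGroup_subgroup [IsManifold 𝓘(ℝ, EK) ∞ K]
    (hK : Manifold.IsSmoothEmbedding 𝓘(ℝ, EK) 𝓘(ℝ, E) ∞ (Subtype.val : K → G)) :
    LieGroup 𝓘(ℝ, EK) ∞ K := by
  have : IsTopologicalGroup G := topologicalGroup_of_lieGroup 𝓘(ℝ, E) ∞
  have hv := hK.contMDiff
  refine { contMDiff_mul := ?_, contMDiff_inv := ?_ }
  · rw [ContMDiff.iff_comp_isImmersion hK.isImmersion]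
    refine ⟨continuous_mul, ?_⟩
    exact (contMDiff_mul 𝓘(ℝ, E) ∞).comp ((hv.comp contMDiff_fst).prodMk (hv.comp contMDiff_snd))
  · rw [ContMDiff.iff_comp_isImmersion hK.isImmersion]
    refine ⟨continuous_inv, ?_⟩
    exact (contMDiff_inv 𝓘(ℝ, E) ∞).comp hv

variable [LieGroup 𝓘(ℝ, EK) ∞ K]

section

variable (hv : ContMDiff 𝓘(ℝ, EK) 𝓘(ℝ, E) ∞ (Subtype.val : K → G))
include hv

theorem tangentLin_fibreEmbedding (g : G) (k : K) (v : GroupLieAlgebra 𝓘(ℝ, EK) K) :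
    tangentLin 𝓘(ℝ, EK) 𝓘(ℝ, E) (fibreEmbedding K g) k (leftTranslate k v) =
      leftTranslate (g * k) (subgroupIncl E K EK v) := by
  have hs : ContMDiff 𝓘(ℝ, EK) 𝓘(ℝ, E) ∞ (fibreEmbedding K g) := contMDiff_mul_left.comp hv
  refine (tangentLin_leftTranslate (hs.mdifferentiableAt (by simp)) v).trans ?_
  refine Eq.trans ?_ (tangentLin_comp_val_one hv (mdifferentiableAt_leftMul (g * k) 1) v)
  have e : (fun x : K => fibreEmbedding K g (k * x)) = fun x : K => g * k * (x : G) := by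
    funext x
    simp [fibreEmbedding, mul_assoc]
  rw [e]
  rfl

theorem tangentLin_val (k : K) (v : GroupLieAlgebra 𝓘(ℝ, EK) K) :
    tangentLin 𝓘(ℝ, EK) 𝓘(ℝ, E) (Subtype.val : K → G) k (leftTranslate k v) =
      leftTranslate (k : G) (subgroupIncl E K EK v) := by
  refine (tangentLin_leftTranslate (hv.mdifferentiableAt (by simp)) v).trans ?_
  exact tangentLin_comp_val_one hv (mdifferentiableAt_leftMul (k : G) 1) v

theorem subgroupIncl_adjointMap (k : K) (v : GroupLieAlgebra 𝓘(ℝ, EK) K) :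
    subgroupIncl E K EK (adjointMap 𝓘(ℝ, EK) k v) =
      adjointMap 𝓘(ℝ, E) (k : G) (subgroupIncl E K EK v) := by
  have hc : ContMDiff 𝓘(ℝ, EK) 𝓘(ℝ, EK) ∞ (fun x : K => k * x * k⁻¹) :=
    contMDiff_mul_right.comp contMDiff_mul_left
  have hc' : ContMDiff 𝓘(ℝ, E) 𝓘(ℝ, E) ∞ (fun x : G => (k : G) * x * (k : G)⁻¹) :=
    contMDiff_mul_right.comp contMDiff_mul_left
  have h1 : HasMFDerivAt 𝓘(ℝ, EK) 𝓘(ℝ, E) (Subtype.val : K → G) (k * 1 * k⁻¹)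
      (mfderiv 𝓘(ℝ, EK) 𝓘(ℝ, E) (Subtype.val : K → G) 1) := by
    rw [mul_one, mul_inv_cancel]
    exact (hv.mdifferentiableAt (by simp)).hasMFDerivAt
  have h2 := (h1.comp (1 : K) (hc.mdifferentiableAt (x := 1) (by simp)).hasMFDerivAt).mfderiv
  have h3 := tangentLin_comp_val_one hv (hc'.mdifferentiableAt (by simp)) v
  exact (DFunLike.congr_fun h2 v).symm.trans h3

theorem leftDeriv_comp_val {f : G → ℝ} (hf : ContMDiff 𝓘(ℝ, E) 𝓘(ℝ, ℝ) ∞ f)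
    (v : GroupLieAlgebra 𝓘(ℝ, EK) K) (k : K) :
    leftDeriv v (fun k : K => f k) k = leftDeriv (subgroupIncl E K EK v) f k := by
  have h1 : HasMFDerivAt 𝓘(ℝ, E) 𝓘(ℝ, ℝ) f (k : G) (mfderiv 𝓘(ℝ, E) 𝓘(ℝ, ℝ) f k) :=
    (hf.mdifferentiableAt (by simp)).hasMFDerivAt
  have h2 := (h1.comp k (hv.mdifferentiableAt (by simp)).hasMFDerivAt).mfderiv
  have h3 := DFunLike.congr_fun h2 (leftTranslate k v)
  refine Eq.trans h3 ?_
  exact congrArg (mfderiv 𝓘(ℝ, E) 𝓘(ℝ, ℝ) f k) (tangentLin_val hv k v)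

/-- Global functions on `G` detect tangent vectors at `1`, and derivatives along left-invariant
fields are compatible with restriction to `K`; compare commutators. -/
theorem subgroupIncl_lie [T2Space G] [FiniteDimensional ℝ E] [CompleteSpace E] [CompleteSpace EK]
    (v w : GroupLieAlgebra 𝓘(ℝ, EK) K) :
    subgroupIncl E K EK ⁅v, w⁆ = ⁅subgroupIncl E K EK v, subgroupIncl E K EK w⁆ := by
  rw [← sub_eq_zero]
  rw [← Module.forall_dual_apply_eq_zero_iff ℝ]
  intro ξ
  rw [map_sub, sub_eq_zero]
  obtain ⟨f, hf, hξ⟩ := exists_differential_eq (1 : G) ξ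
  have e1 : ∀ u : GroupLieAlgebra 𝓘(ℝ, E) G, ξ u = leftDeriv u f 1 := by
    intro u
    rw [leftDeriv, leftTranslate_one, hξ]
  have hfv : ContMDiff 𝓘(ℝ, EK) 𝓘(ℝ, ℝ) ∞ (fun k : K => f k) := hf.comp hv
  have e2 : ∀ u : GroupLieAlgebra 𝓘(ℝ, EK) K, leftDeriv u (fun k : K => f k) =
      fun k : K => leftDeriv (subgroupIncl E K EK u) f k :=
    fun u => funext fun k => leftDeriv_comp_val hv hf u k
  have e3 := leftDeriv_comp_val hv hf ⁅v, w⁆ 1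
  rw [e1, e1, leftDeriv_lie hf]
  refine e3.symm.trans ?_
  rw [leftDeriv_lie hfv, e2, e2]
  exact congrArg₂ _ (leftDeriv_comp_val hv (contMDiff_leftDeriv hf _) _ _)
    (leftDeriv_comp_val hv (contMDiff_leftDeriv hf _) _ _)

end

end Subgroup

/-! ### Group conditions on `Ad_K` versus bracket conditions on `𝔨`. -/

namespace InvariantManinTriple

variable {E : Type*} [NormedAddCommGroup E] [NormedSpace ℝ E] [CompleteSpace E]
  {G : Type*} [TopologicalSpace G] [ChartedSpace E G] [Group G] [LieGroup 𝓘(ℝ, E) ∞ G]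
  {𝔡 : Type*} [LieRing 𝔡] [LieAlgebra ℝ 𝔡] (T : InvariantManinTriple 𝓘(ℝ, E) G 𝔡)

section Algebra

variable {𝔨 : Submodule ℝ (GroupLieAlgebra 𝓘(ℝ, E) G)}

theorem mem_of_incl_mem_sup {v : GroupLieAlgebra 𝓘(ℝ, E) G}
    (h : T.incl v ∈ 𝔨.map T.incl.toLinearMap ⊔ T.𝔥.toSubmodule) : v ∈ 𝔨 := by
  obtain ⟨_, ⟨u, hu, rfl⟩, y, hy, e⟩ := Submodule.mem_sup.1 h
  have h1 : T.incl (v - u) ∈ T.𝔥 := by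
    have : T.incl (v - u) = y := by
      rw [map_sub, ← e]
      exact add_sub_cancel_left _ _
    rw [this]
    exact hy
  rw [sub_eq_zero.1 (T.incl_mem_𝔥 h1)]
  exact hu

theorem ann_le : T.ann 𝔨 ≤ T.𝔥.toSubmodule := inf_le_left

theorem pr_mem_of_mem_sup {x : 𝔡} (h : x ∈ 𝔨.map T.incl.toLinearMap ⊔ T.𝔥.toSubmodule) :
    T.pr x ∈ 𝔨 := by
  refine T.mem_of_incl_mem_sup ?_
  have h1 := (T.pr_eq_iff x _).1 rfl
  have h2 := Submodule.sub_mem _ h (Submodule.mem_sup_right h1)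
  rwa [sub_sub_cancel] at h2

theorem mem_sup_of_pr_mem {x : 𝔡} (h : T.pr x ∈ 𝔨) :
    x ∈ 𝔨.map T.incl.toLinearMap ⊔ T.𝔥.toSubmodule := by
  have h1 := (T.pr_eq_iff x _).1 rfl
  rw [← add_sub_cancel (T.incl (T.pr x)) x]
  exact Submodule.add_mem_sup ⟨_, h, rfl⟩ h1

/-- For `v ∈ 𝔨`, `x ∈ 𝔥` and `w ∈ 𝔨°`, invariance gives `⟨v, ⁅x, w⁆⟩ = -⟨⁅v, w⁆, x⟩`. Vanishing of
the left side means `⁅x, w⁆ ∈ 𝔨°`; vanishing of the right side for all `x` means `⁅v, w⁆ ∈ 𝔥^⊥ = 𝔥`.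
-/
theorem ann_isIdeal_iff :
    (∀ x ∈ T.𝔥, ∀ w ∈ T.ann 𝔨, ⁅x, w⁆ ∈ T.ann 𝔨) ↔
      ∀ v ∈ 𝔨.map T.incl.toLinearMap, ∀ w ∈ T.ann 𝔨, ⁅v, w⁆ ∈ T.𝔥 := by
  constructor
  · rintro h _ ⟨v, hv, rfl⟩ w hw
    refine T.mem_𝔥_of_pairing fun x hx => ?_
    have h1 := (T.mem_ann.1 (h x hx w hw)).2 v hv
    rw [T.pairing_symm, T.pairing_lie_cyclic, ← lie_skew, map_neg, LinearMap.neg_apply,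
      T.pairing_symm]
    exact neg_eq_zero.2 h1
  · intro h x hx w hw
    refine T.mem_ann.2 ⟨T.𝔥.lie_mem hx (T.ann_le hw), fun v hv => ?_⟩
    have h1 := T.pairing_𝔥 (h _ ⟨v, hv, rfl⟩ w hw) hx
    rw [T.pairing_symm, ← lie_skew, map_neg, LinearMap.neg_apply, ← T.pairing_lie_cyclic]
    exact neg_eq_zero.2 h1

end Algebra

variable {K : Subgroup G} {EK : Type*} [NormedAddCommGroup EK] [NormedSpace ℝ EK]
  [ChartedSpace EK K]

variable (EK K) in
/-- The inclusion of the Lie algebra of the subgroup `K` in `𝔡`. -/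
def inclK : GroupLieAlgebra 𝓘(ℝ, EK) K →ₗ[ℝ] 𝔡 :=
  T.incl.toLinearMap ∘ₗ subgroupIncl E K EK

variable (EK K) in
/-- The image of the Lie algebra of the subgroup `K` in `𝔡`. -/
abbrev 𝔨d : Submodule ℝ 𝔡 :=
  (subgroupLieAlgebra 𝓘(ℝ, E) 𝓘(ℝ, EK) K).map T.incl.toLinearMap

variable (EK K) in
/-- The annihilator of the Lie algebra of the subgroup `K`. -/
abbrev 𝔨o : Submodule ℝ 𝔡 := T.ann (subgroupLieAlgebra 𝓘(ℝ, E) 𝓘(ℝ, EK) K)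

theorem inclK_mem (v : GroupLieAlgebra 𝓘(ℝ, EK) K) : T.inclK K EK v ∈ T.𝔨d K EK :=
  ⟨_, ⟨v, rfl⟩, rfl⟩

theorem exists_inclK_eq {x : 𝔡} (hx : x ∈ T.𝔨d K EK) : ∃ v, T.inclK K EK v = x := by
  obtain ⟨_, ⟨v, rfl⟩, rfl⟩ := hx
  exact ⟨v, rfl⟩

theorem pairing_inclK (v : GroupLieAlgebra 𝓘(ℝ, EK) K) {w : 𝔡} (hw : w ∈ T.𝔨o K EK) :
    T.pairing (T.inclK K EK v) w = 0 :=
  (T.mem_ann.1 hw).2 _ ⟨v, rfl⟩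

section Subgroup

variable (hv : ContMDiff 𝓘(ℝ, EK) 𝓘(ℝ, E) ∞ (Subtype.val : K → G))
include hv

theorem integratesAd_subgroup : IntegratesAd (T.inclK K EK) (T.Ad.comp K.subtype) := by
  refine ⟨fun w φ => (T.Ad_smooth w φ).comp hv, fun w φ v => ?_⟩
  have h := tangentLin_comp_val_one hv ((T.Ad_smooth w φ).mdifferentiableAt (x := 1) (by simp)) v
  exact h.trans (T.Ad_deriv w φ _)

variable [LieGroup 𝓘(ℝ, EK) ∞ K]

theorem Ad_inclK (k : K) (v : GroupLieAlgebra 𝓘(ℝ, EK) K) :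
    T.Ad k (T.inclK K EK v) = T.inclK K EK (adjointMap 𝓘(ℝ, EK) k v) := by
  refine (T.Ad_incl k _).trans ?_
  rw [← subgroupIncl_adjointMap hv]
  rfl

theorem Ad_mem_𝔨d (k : K) {x : 𝔡} (hx : x ∈ T.𝔨d K EK) : T.Ad k x ∈ T.𝔨d K EK := by
  obtain ⟨v, rfl⟩ := T.exists_inclK_eq hx
  rw [T.Ad_inclK hv]
  exact T.inclK_mem _

theorem lie_mem_𝔨d {x y : 𝔡} (hx : x ∈ T.𝔨d K EK) (hy : y ∈ T.𝔨d K EK) :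
    ⁅x, y⁆ ∈ T.𝔨d K EK := by
  obtain ⟨v, rfl⟩ := T.exists_inclK_eq hx
  exact (T.integratesAd_subgroup hv).lie_mem (fun k y hy => T.Ad_mem_𝔨d hv k hy) v hy

theorem pairing_lie_𝔨d {x y w : 𝔡} (hx : x ∈ T.𝔨d K EK) (hy : y ∈ T.𝔨d K EK)
    (hw : w ∈ T.𝔨o K EK) : T.pairing y ⁅x, w⁆ = 0 := by
  obtain ⟨u, hu⟩ := T.exists_inclK_eq (T.lie_mem_𝔨d hv hx hy)
  have h := T.pairing_invariant x y w
  rw [← hu, T.pairing_inclK u hw, zero_add] at h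
  exact h

variable [FiniteDimensional ℝ 𝔡] [PreconnectedSpace K]

theorem Ad_mem_𝔥_iff :
    (∀ k ∈ K, ∀ w ∈ T.𝔥, T.Ad k w ∈ T.𝔥) ↔ ∀ v ∈ T.𝔨d K EK, ∀ w ∈ T.𝔥, ⁅v, w⁆ ∈ T.𝔥 := by
  constructor
  · intro h v hx w hw
    obtain ⟨v, rfl⟩ := T.exists_inclK_eq hx
    exact (T.integratesAd_subgroup hv).lie_mem (V := T.𝔥.toSubmodule) (W := T.𝔥.toSubmodule)
      (fun k y hy => h k k.2 y hy) v hw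
  · intro h k hk w hw
    exact (T.integratesAd_subgroup hv).map_mem (V := T.𝔥.toSubmodule)
      (fun v w hw => h _ (T.inclK_mem v) w hw) ⟨k, hk⟩ hw

/-- Brackets `⁅𝔨, 𝔨°⁆` are always orthogonal to the subalgebra `𝔨`. If they lie in `𝔥` they lie in
`𝔨°`, which is then `ad 𝔨`-stable. -/
theorem Ad_mem_𝔨o (h : ∀ v ∈ T.𝔨d K EK, ∀ w ∈ T.𝔨o K EK, ⁅v, w⁆ ∈ T.𝔥) (k : K) {w : 𝔡}
    (hw : w ∈ T.𝔨o K EK) : T.Ad k w ∈ T.𝔨o K EK :=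
  (T.integratesAd_subgroup hv).map_mem (V := T.𝔨o K EK)
    (fun v w hw => T.mem_ann.2 ⟨h _ (T.inclK_mem v) w hw,
      fun _ hu => T.pairing_lie_𝔨d hv (T.inclK_mem v) ⟨_, hu, rfl⟩ hw⟩) k hw

theorem Ad_𝔨o_mem_𝔥_iff :
    (∀ k ∈ K, ∀ w ∈ T.𝔨o K EK, T.Ad k w ∈ T.𝔥) ↔
      ∀ v ∈ T.𝔨d K EK, ∀ w ∈ T.𝔨o K EK, ⁅v, w⁆ ∈ T.𝔥 := by
  constructor
  · intro h v hx w hw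
    obtain ⟨v, rfl⟩ := T.exists_inclK_eq hx
    exact (T.integratesAd_subgroup hv).lie_mem (V := T.𝔨o K EK) (W := T.𝔥.toSubmodule)
      (fun k y hy => h k k.2 y hy) v hw
  · intro h k hk w hw
    exact T.ann_le (T.Ad_mem_𝔨o hv h ⟨k, hk⟩ hw)

/-- Differentiating gives `⁅𝔨, 𝔨°⁆ ⊆ 𝔨 ⊕ 𝔥 = (𝔨°)^⊥`, which by invariance says `⁅𝔨°, 𝔨°⁆ ⊥ 𝔨`. For
the converse, `𝔨 ⊕ 𝔨°` is `ad 𝔨`-stable: an element of `⁅𝔨, 𝔨°⁆` is orthogonal to `𝔨`, so it lies in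
`𝔤 ⊕ 𝔨°`, and orthogonal to `𝔨°`, so it lies in `𝔨 ⊕ 𝔥`. -/
theorem pr_Ad_mem_iff :
    (∀ k ∈ K, ∀ w ∈ T.𝔨o K EK, T.pr (T.Ad k w) ∈ subgroupLieAlgebra 𝓘(ℝ, E) 𝓘(ℝ, EK) K) ↔
      ∀ w ∈ T.𝔨o K EK, ∀ w' ∈ T.𝔨o K EK, ⁅w, w'⁆ ∈ T.𝔨o K EK := by
  constructor
  · intro h w hw w' hw'
    refine T.mem_ann.2 ⟨T.𝔥.lie_mem (T.ann_le hw) (T.ann_le hw'), ?_⟩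
    rintro _ ⟨v, rfl⟩
    have h1 := (T.integratesAd_subgroup hv).lie_mem (V := T.𝔨o K EK)
      (W := T.𝔨d K EK ⊔ T.𝔥.toSubmodule)
      (fun k y hy => T.mem_sup_of_pr_mem (h k k.2 y hy)) v hw
    obtain ⟨x, hx, y, hy, e⟩ := Submodule.mem_sup.1 h1
    obtain ⟨u, rfl⟩ := T.exists_inclK_eq hx
    have h2 := T.pairing_invariant w (T.inclK K EK v) w'
    have h3 : T.pairing ⁅w, T.inclK K EK v⁆ w' = 0 := by
      rw [← lie_skew, ← e, map_neg, LinearMap.neg_apply, map_add, LinearMap.add_apply,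
        T.pairing_inclK u hw', T.pairing_𝔥 hy (T.ann_le hw'), add_zero, neg_zero]
    rw [h3, zero_add] at h2
    exact h2
  · intro h k hk w hw
    refine T.pr_mem_of_mem_sup (sup_le_sup_left T.ann_le _
      ((T.integratesAd_subgroup hv).map_mem (V := T.𝔨d K EK ⊔ T.𝔨o K EK) (fun v x hx => ?_)
        ⟨k, hk⟩ (Submodule.mem_sup_right hw)))
    obtain ⟨y, hy, z, hz, rfl⟩ := Submodule.mem_sup.1 hx
    rw [lie_add]
    refine Submodule.add_mem _ (Submodule.mem_sup_left (T.lie_mem_𝔨d hv (T.inclK_mem v) hy)) ?_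
    obtain ⟨a, ha, e⟩ := T.exists_eq_incl_add_of_pairing
      (𝔨 := subgroupLieAlgebra 𝓘(ℝ, E) 𝓘(ℝ, EK) K) (x := ⁅T.inclK K EK v, z⁆)
      (fun _ hu => T.pairing_lie_𝔨d hv (T.inclK_mem v) ⟨_, hu, rfl⟩ hz)
    have h1 : ⁅T.inclK K EK v, z⁆ ∈ T.𝔨d K EK ⊔ T.𝔥.toSubmodule := by
      refine T.mem_sup_of_pairing_ann fun w' hw' => ?_
      have h2 := T.pairing_inclK v (h z hz w' hw')
      have h3 := T.pairing_invariant z (T.inclK K EK v) w'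
      rw [h2, add_zero] at h3
      rw [← lie_skew, map_neg, LinearMap.neg_apply, h3, neg_zero]
    rw [e]
    exact Submodule.add_mem_sup ⟨_, T.pr_mem_of_mem_sup h1, rfl⟩ ha

end Subgroup

end InvariantManinTriple

/-! ### Right translations of `π_G`; the criteria for a) and b). -/

namespace InvariantManinTriple

variable {E : Type*} [NormedAddCommGroup E] [NormedSpace ℝ E] [CompleteSpace E]
  {G : Type*} [TopologicalSpace G] [ChartedSpace E G] [Group G] [LieGroup 𝓘(ℝ, E) ∞ G]
  {𝔡 : Type*} [LieRing 𝔡] [LieAlgebra ℝ 𝔡] (T : InvariantManinTriple 𝓘(ℝ, E) G 𝔡)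

/-- The `𝔥`-component of `Ad_{k⁻¹} w`. -/
def coadjoint (k : G) (w : 𝔡) : 𝔡 := T.Ad k⁻¹ w - T.incl (T.pr (T.Ad k⁻¹ w))

theorem coadjoint_mem (k : G) (w : 𝔡) : T.coadjoint k w ∈ T.𝔥 := (T.pr_eq_iff _ _).1 rfl

/-- `⟨Ad_k v, w⟩ = ⟨v, Ad_{k⁻¹} w⟩`, and the `𝔤`-part of `Ad_{k⁻¹} w` pairs to zero with `𝔤`. -/
theorem covector_comp_tangentLin (k g : G) (w : 𝔡) :
    T.covector (g * k⁻¹) w ∘ₗ tangentLin 𝓘(ℝ, E) 𝓘(ℝ, E) (fun x : G => x * k⁻¹) g =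
      T.covector g (T.coadjoint k w) := by
  ext u
  obtain ⟨v, rfl⟩ := leftTranslate_surjective g u
  have h : T.pairing (T.incl v) (T.coadjoint k w) = T.pairing (T.incl v) (T.Ad k⁻¹ w) := by
    rw [coadjoint, map_sub, T.pairing_incl, sub_zero]
  rw [covector_leftTranslate, h, ← T.Ad_pairing k, map_map_inv, T.Ad_incl]
  refine Eq.trans ?_ (T.covector_leftTranslate (g * k⁻¹) w (adjointMap 𝓘(ℝ, E) k v))
  exact congrArg (T.covector (g * k⁻¹) w) (tangentLin_mul_right k g v)

theorem adjointMap_eq_zero (T : InvariantManinTriple 𝓘(ℝ, E) G 𝔡) {k : G} {v : GroupLieAlgebra 𝓘(ℝ, E) G}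
    (h : adjointMap 𝓘(ℝ, E) k v = 0) : v = 0 := by
  have h1 : T.Ad k (T.incl v) = 0 := by rw [T.Ad_incl, h, map_zero]
  have h2 := congrArg (T.Ad k⁻¹) h1
  rw [map_inv_map, map_zero] at h2
  exact (map_eq_zero_iff T.incl T.incl_injective).1 h2

variable [FiniteDimensional ℝ 𝔡] [FiniteDimensional ℝ E]

/-- The graph condition at `g k⁻¹` becomes the one at `g` after moving `Ad_{k⁻¹}` inside. The extra
term `pr (Ad_{k⁻¹} w)` is the exact failure of invariance, which governs both a) and c). -/
theorem sharp_mul_inv (k g : G) {w : 𝔡} (hw : w ∈ T.𝔥) {v : GroupLieAlgebra 𝓘(ℝ, E) G}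
    (hv : T.bivector.sharp g (T.covector g (T.coadjoint k w)) = leftTranslate g v) :
    T.bivector.sharp (g * k⁻¹) (T.covector (g * k⁻¹) w) =
      leftTranslate (g * k⁻¹) (adjointMap 𝓘(ℝ, E) k (v + T.pr (T.Ad k⁻¹ w))) := by
  rw [T.sharp_covector_eq_iff _ hw, ← T.Ad_incl, map_mul, Module.End.mul_apply, map_sub,
    map_inv_map, map_add, add_comm (T.incl v), ← sub_sub]
  exact (T.sharp_covector_eq_iff g (T.coadjoint_mem k w) v).1 hv

theorem isRightInvariant_iff (K : Subgroup G) :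
    IsRightInvariant 𝓘(ℝ, E) K T.bivector ↔ ∀ k ∈ K, ∀ w ∈ T.𝔥, T.Ad k w ∈ T.𝔥 := by
  have key : ∀ k g : G, ∀ w ∈ T.𝔥, (tangentLin 𝓘(ℝ, E) 𝓘(ℝ, E) (fun x : G => x * k⁻¹) g
      (T.bivector.sharp g (T.covector (g * k⁻¹) w ∘ₗ
        tangentLin 𝓘(ℝ, E) 𝓘(ℝ, E) (fun x : G => x * k⁻¹) g)) =
      T.bivector.sharp (g * k⁻¹) (T.covector (g * k⁻¹) w) ↔ T.Ad k⁻¹ w ∈ T.𝔥) := by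
    intro k g w hw
    obtain ⟨v, hv⟩ := leftTranslate_surjective g
      (T.bivector.sharp g (T.covector g (T.coadjoint k w)))
    have h0 : T.pr (T.Ad k⁻¹ w) = 0 ↔ T.Ad k⁻¹ w ∈ T.𝔥 := by
      rw [pr_eq_iff, map_zero, sub_zero]
    rw [T.sharp_mul_inv k g hw hv.symm, covector_comp_tangentLin, ← hv, ← h0]
    refine (Eq.congr_left (tangentLin_mul_right k g v)).trans ?_
    rw [(leftTranslate_injective (g * k⁻¹)).eq_iff, map_add, left_eq_add]
    exact ⟨T.adjointMap_eq_zero, fun h => by rw [h, map_zero]⟩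
  constructor
  · intro h k hk w hw
    have := (key k⁻¹ 1 w hw).1 (h k⁻¹ (K.inv_mem hk) 1 _)
    rwa [inv_inv] at this
  · intro h k hk g ξ
    obtain ⟨w, hw, rfl⟩ := T.exists_covector_eq (g * k⁻¹) ξ
    exact (key k g w hw).2 (h k⁻¹ (K.inv_mem hk) w hw)

theorem sharp_eq_zero {k : G} (h : ∀ w ∈ T.𝔥, T.Ad k w ∈ T.𝔥) : T.bivector.sharp k = 0 := by
  ext ξ
  obtain ⟨w, hw, rfl⟩ := T.exists_covector_eq k ξ
  have := (T.sharp_covector_eq_iff k hw 0).2 (by rw [map_zero, sub_zero]; exact h w hw)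
  rw [map_zero] at this
  exact this

variable {K : Subgroup G} {EK : Type*} [NormedAddCommGroup EK] [NormedSpace ℝ EK]
  [ChartedSpace EK K] [LieGroup 𝓘(ℝ, EK) ∞ K]

/-- By skewness, tangency at `k` means that `π_G^♯` kills the covectors of `𝔨°`, and `π_G^♯ ⟨θ^L, w⟩
= 0` at `k` means `Ad_k w ∈ 𝔥`. -/
theorem isPoissonSubmanifold_iff
    (hv : ContMDiff 𝓘(ℝ, EK) 𝓘(ℝ, E) ∞ (Subtype.val : K → G)) :
    BivectorField.IsPoissonSubmanifold (I := 𝓘(ℝ, EK)) (Subtype.val : K → G) T.bivector ↔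
      ∀ k ∈ K, ∀ w ∈ T.𝔨o K EK, T.Ad k w ∈ T.𝔥 := by
  constructor
  · intro h k hk w hw
    have h0 : T.bivector.sharp k (T.covector k w) = 0 := by
      rw [← Module.forall_dual_apply_eq_zero_iff ℝ]
      intro ξ
      rw [T.bivector.skew, neg_eq_zero]
      obtain ⟨u, hu⟩ := h ⟨k, hk⟩ ξ
      obtain ⟨v, rfl⟩ := leftTranslate_surjective (⟨k, hk⟩ : K) u
      refine (congrArg (T.covector k w) (hu.symm.trans (tangentLin_val hv ⟨k, hk⟩ v))).trans ?_
      exact (T.covector_leftTranslate k w _).trans (T.pairing_inclK v hw)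
    have := (T.sharp_covector_eq_iff k (T.ann_le hw) 0).1 (by rw [h0, map_zero])
    rwa [map_zero, sub_zero] at this
  · intro h k ξ
    obtain ⟨v, hξ⟩ := leftTranslate_surjective (k : G) (T.bivector.sharp k ξ)
    have hmem : v ∈ subgroupLieAlgebra 𝓘(ℝ, E) 𝓘(ℝ, EK) K := by
      refine T.mem_of_incl_mem_sup (T.mem_sup_of_pairing_ann fun w hw => ?_)
      rw [← T.covector_leftTranslate k, hξ, T.bivector.skew, neg_eq_zero]
      have h0 := (T.sharp_covector_eq_iff (k : G) (T.ann_le hw) 0).2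
        (by rw [map_zero, sub_zero]; exact h k k.2 w hw)
      rw [map_zero] at h0
      refine (congrArg ξ h0).trans (map_zero _)
    obtain ⟨u, rfl⟩ := hmem
    exact ⟨leftTranslate k u, (tangentLin_val hv k u).trans hξ⟩

end InvariantManinTriple

/-! ### Push-forward of Poisson structures along submersions. -/

section Pushforward

variable {E : Type*} [NormedAddCommGroup E] [NormedSpace ℝ E] {M : Type*} [TopologicalSpace M]
  [ChartedSpace E M] {E' : Type*} [NormedAddCommGroup E'] [NormedSpace ℝ E'] {N : Type*}
  [TopologicalSpace N] [ChartedSpace E' N]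

namespace BivectorField

/-- The push-forward `T_{p x}^* N → T_{p x} N` of a bivector at `x` under `p`. -/
def pushSharp (π : BivectorField 𝓘(ℝ, E) M) (p : M → N) (x : M) : Module.Dual ℝ E' →ₗ[ℝ] E' :=
  LinearMap.comp (tangentLin 𝓘(ℝ, E) 𝓘(ℝ, E') p x)
    (π.sharp x ∘ₗ (tangentLin 𝓘(ℝ, E) 𝓘(ℝ, E') p x).dualMap)

theorem pushSharp_skew (π : BivectorField 𝓘(ℝ, E) M) (p : M → N) (x : M)
    (ξ η : Module.Dual ℝ E') : ξ (π.pushSharp p x η) = -η (π.pushSharp p x ξ) :=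
  π.skew x ((tangentLin 𝓘(ℝ, E) 𝓘(ℝ, E') p x).dualMap ξ)
    ((tangentLin 𝓘(ℝ, E) 𝓘(ℝ, E') p x).dualMap η)

theorem exists_pushes_iff (π : BivectorField 𝓘(ℝ, E) M) {p : M → N}
    (hs : Function.Surjective p) :
    (∃ σ : BivectorField 𝓘(ℝ, E') N, π.Pushes p σ) ↔
      ∀ x y, p x = p y → ∀ η : Module.Dual ℝ E', π.pushSharp p x η = π.pushSharp p y η := by
  constructor
  · rintro ⟨σ, h⟩ x y hxy η
    have e : ∀ z z' : N, z = z' → (σ.sharp z η : E') = σ.sharp z' η := by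
      rintro z _ rfl
      rfl
    exact (h x η).trans ((e _ _ hxy).trans (h y η).symm)
  · intro h
    choose s hps using hs
    exact ⟨⟨fun y => π.pushSharp (E' := E') p (s y),
      fun y => π.pushSharp_skew (E' := E') p (s y)⟩,
      fun x ξ => h x (s (p x)) (hps (p x)).symm ξ⟩

theorem Pushes.bracket_comp {π : BivectorField 𝓘(ℝ, E) M} {σ : BivectorField 𝓘(ℝ, E') N}
    {p : M → N} (h : π.Pushes p σ) (hp : ContMDiff 𝓘(ℝ, E) 𝓘(ℝ, E') ∞ p) {f g : N → ℝ}
    (hf : ContMDiff 𝓘(ℝ, E') 𝓘(ℝ, ℝ) ∞ f) (hg : ContMDiff 𝓘(ℝ, E') 𝓘(ℝ, ℝ) ∞ g) :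
    σ.bracket f g ∘ p = π.bracket (f ∘ p) (g ∘ p) := by
  funext x
  have e : ∀ {f : N → ℝ}, ContMDiff 𝓘(ℝ, E') 𝓘(ℝ, ℝ) ∞ f → differential 𝓘(ℝ, E) (f ∘ p) x =
      differential 𝓘(ℝ, E') f (p x) ∘ₗ tangentLin 𝓘(ℝ, E) 𝓘(ℝ, E') p x := by
    intro f hf
    ext v
    exact DFunLike.congr_fun (mfderiv_comp x (hf.mdifferentiableAt (by simp))
      (hp.mdifferentiableAt (by simp))) v
  rw [bracket, e hf, e hg]
  exact congrArg (differential 𝓘(ℝ, E') g (p x)) (h x _).symm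

/-- Pull-back by the surjection `p` is injective and intertwines the brackets, so Jacobi descends;
smoothness descends since `p` is a submersion. -/
theorem Pushes.isPoisson {π : BivectorField 𝓘(ℝ, E) M} {σ : BivectorField 𝓘(ℝ, E') N}
    {p : M → N} (h : π.Pushes p σ) (hp : Manifold.IsSubmersion 𝓘(ℝ, E) 𝓘(ℝ, E') ∞ p)
    (hs : Function.Surjective p) (hπ : π.IsPoisson) : σ.IsPoisson := by
  have hsm := hp.contMDiff
  have hσ : σ.IsSmooth := by
    intro f g hf hg
    refine hp.contMDiff_of_comp hs ?_
    rw [h.bracket_comp hsm hf hg]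
    exact hπ.1 _ _ (hf.comp hsm) (hg.comp hsm)
  refine ⟨hσ, fun f g k hf hg hk y => ?_⟩
  obtain ⟨x, rfl⟩ := hs y
  have key : ∀ {a b c : N → ℝ}, ContMDiff 𝓘(ℝ, E') 𝓘(ℝ, ℝ) ∞ a →
      ContMDiff 𝓘(ℝ, E') 𝓘(ℝ, ℝ) ∞ b → ContMDiff 𝓘(ℝ, E') 𝓘(ℝ, ℝ) ∞ c →
      σ.bracket a (σ.bracket b c) (p x) =
        π.bracket (a ∘ p) (π.bracket (b ∘ p) (c ∘ p)) x := by
    intro a b c ha hb hc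
    rw [← h.bracket_comp hsm hb hc, ← h.bracket_comp hsm ha (hσ b c hb hc)]
    rfl
  rw [key hf hg hk, key hg hk hf, key hk hf hg]
  exact hπ.2 _ _ _ (hf.comp hsm) (hg.comp hsm) (hk.comp hsm) x

end BivectorField

end Pushforward

/-! ### The tangent map of `G → G/K`. -/

section Quotient

variable {E : Type*} [NormedAddCommGroup E] [NormedSpace ℝ E]
  {G : Type*} [TopologicalSpace G] [ChartedSpace E G] [Group G]
  {K : Subgroup G} {EK : Type*} [NormedAddCommGroup EK] [NormedSpace ℝ EK]
  [ChartedSpace EK K]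
  {EM : Type*} [NormedAddCommGroup EM] [NormedSpace ℝ EM]
  [ChartedSpace EM (G ⧸ K)]

theorem mem_subgroupLieAlgebra_of_curve
    (hK : Manifold.IsSmoothEmbedding 𝓘(ℝ, EK) 𝓘(ℝ, E) ∞ (Subtype.val : K → G))
    {γ : ℝ → G} (h0 : γ 0 = 1) (hγ : ContMDiffAt 𝓘(ℝ, ℝ) 𝓘(ℝ, E) ∞ γ 0)
    (hmem : ∀ᶠ t in nhds 0, γ t ∈ K) {v : GroupLieAlgebra 𝓘(ℝ, E) G}
    (hv : (mfderiv 𝓘(ℝ, ℝ) 𝓘(ℝ, E) γ 0 (1 : ℝ) : E) = v) :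
    v ∈ subgroupLieAlgebra 𝓘(ℝ, E) 𝓘(ℝ, EK) K := by
  classical
  -- The value `1` off `K` is immaterial: near `0` the curve lies in `K`.
  let σ : ℝ → K := fun t => if h : γ t ∈ K then ⟨γ t, h⟩ else 1
  have hσ : (Subtype.val : K → G) ∘ σ =ᶠ[nhds 0] γ := by
    filter_upwards [hmem] with t ht
    simp [σ, ht]
  have hσ0 : σ 0 = 1 := by
    apply Subtype.ext
    exact hσ.self_of_nhds.trans h0
  have hvs : ContMDiffAt 𝓘(ℝ, ℝ) 𝓘(ℝ, E) ∞ ((Subtype.val : K → G) ∘ σ) 0 :=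
    hγ.congr_of_eventuallyEq hσ
  have hσs : ContMDiffAt 𝓘(ℝ, ℝ) 𝓘(ℝ, EK) ∞ σ 0 :=
    (ContMDiffAt.iff_comp_isImmersionAt (hK.isImmersion.isImmersionAt _)).2
      ⟨hK.isEmbedding.continuousAt_iff.2 hvs.continuousAt, hvs⟩
  have h1 : HasMFDerivAt 𝓘(ℝ, EK) 𝓘(ℝ, E) (Subtype.val : K → G) (σ 0)
      (mfderiv 𝓘(ℝ, EK) 𝓘(ℝ, E) (Subtype.val : K → G) 1) := by
    rw [hσ0]
    exact (hK.contMDiff.mdifferentiableAt (by simp)).hasMFDerivAt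
  have h2 := (h1.comp (0 : ℝ) (hσs.mdifferentiableAt (by simp)).hasMFDerivAt).mfderiv
  have h3 := hσ.mfderiv_eq (I := 𝓘(ℝ, ℝ)) (I' := 𝓘(ℝ, E))
  refine ⟨mfderiv 𝓘(ℝ, ℝ) 𝓘(ℝ, EK) σ 0 (1 : ℝ), ?_⟩
  have h4 := DFunLike.congr_fun h2 (1 : ℝ)
  have h5 := DFunLike.congr_fun h3 (1 : ℝ)
  exact h4.symm.trans (h5.trans hv)

variable [LieGroup 𝓘(ℝ, E) ∞ G]

/-- A kernel vector is the velocity of a curve in the fibre, which left translation by `g⁻¹` carries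
into `K`. Conversely `k ↦ p (g k)` is constant. -/
theorem tangentLin_mk_leftTranslate_eq_zero_iff [IsManifold 𝓘(ℝ, EM) ∞ (G ⧸ K)]
    (hK : Manifold.IsSmoothEmbedding 𝓘(ℝ, EK) 𝓘(ℝ, E) ∞ (Subtype.val : K → G))
    (hp : Manifold.IsSubmersion 𝓘(ℝ, E) 𝓘(ℝ, EM) ∞ (QuotientGroup.mk : G → G ⧸ K)) (g : G)
    (v : GroupLieAlgebra 𝓘(ℝ, E) G) :
    tangentLin 𝓘(ℝ, E) 𝓘(ℝ, EM) (QuotientGroup.mk : G → G ⧸ K) g (leftTranslate g v) = 0 ↔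
      v ∈ subgroupLieAlgebra 𝓘(ℝ, E) 𝓘(ℝ, EK) K := by
  constructor
  · intro h
    obtain ⟨γ, h0, hγ, hpγ, hd⟩ := hp.exists_curve g _ h
    have h1 : HasMFDerivAt 𝓘(ℝ, E) 𝓘(ℝ, E) (fun x : G => g⁻¹ * x) (γ 0)
        (mfderiv 𝓘(ℝ, E) 𝓘(ℝ, E) (fun x : G => g⁻¹ * x) g) := by
      rw [h0]
      exact (mdifferentiableAt_leftMul g⁻¹ g).hasMFDerivAt
    have h2 := (h1.comp (0 : ℝ) (hγ.mdifferentiableAt (by simp)).hasMFDerivAt).mfderiv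
    have hs : ContMDiff 𝓘(ℝ, E) 𝓘(ℝ, E) ∞ (fun x : G => g⁻¹ * x) := contMDiff_mul_left
    refine mem_subgroupLieAlgebra_of_curve hK (γ := (fun x : G => g⁻¹ * x) ∘ γ)
      (by simp [h0]) (hs.contMDiffAt.comp (0 : ℝ) hγ) ?_ ?_
    · filter_upwards [hpγ] with t ht
      exact QuotientGroup.eq.1 ht.symm
    · refine (DFunLike.congr_fun h2 (1 : ℝ)).trans ?_
      refine Eq.trans ?_ (maurerCartan_leftTranslate g v)
      exact congrArg (mfderiv 𝓘(ℝ, E) 𝓘(ℝ, E) (fun x : G => g⁻¹ * x) g) hd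
  · rintro ⟨u, rfl⟩
    have hs : ContMDiff 𝓘(ℝ, E) 𝓘(ℝ, EM) ∞ (fun x : G => (QuotientGroup.mk (g * x) : G ⧸ K)) :=
      hp.contMDiff.comp contMDiff_mul_left
    refine (tangentLin_leftTranslate (hp.contMDiff.mdifferentiableAt (by simp)) _).trans ?_
    refine (tangentLin_comp_val_one hK.contMDiff (hs.mdifferentiableAt (by simp)) u).symm.trans ?_
    have e : (fun k : K => (QuotientGroup.mk (g * k) : G ⧸ K)) = fun _ => QuotientGroup.mk g := by
      funext k
      exact QuotientGroup.eq.2 (by simp)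
    rw [e]
    exact DFunLike.congr_fun (mfderiv_const (I := 𝓘(ℝ, EK)) (I' := 𝓘(ℝ, EM))
      (c := (QuotientGroup.mk g : G ⧸ K)) (x := (1 : K))) u

theorem tangentLin_mk_mul_right
    (hp : ContMDiff 𝓘(ℝ, E) 𝓘(ℝ, EM) ∞ (QuotientGroup.mk : G → G ⧸ K)) {k : G} (hk : k ∈ K)
    (g : G) (u : TangentSpace 𝓘(ℝ, E) g) :
    (tangentLin 𝓘(ℝ, E) 𝓘(ℝ, EM) (QuotientGroup.mk : G → G ⧸ K) (g * k⁻¹)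
      (tangentLin 𝓘(ℝ, E) 𝓘(ℝ, E) (fun x : G => x * k⁻¹) g u) : EM) =
      tangentLin 𝓘(ℝ, E) 𝓘(ℝ, EM) (QuotientGroup.mk : G → G ⧸ K) g u := by
  have hr : ContMDiff 𝓘(ℝ, E) 𝓘(ℝ, E) ∞ (fun x : G => x * k⁻¹) := contMDiff_mul_right
  have h1 := mfderiv_comp (I := 𝓘(ℝ, E)) (I' := 𝓘(ℝ, E)) (I'' := 𝓘(ℝ, EM)) g
    (g := (QuotientGroup.mk : G → G ⧸ K)) (f := fun x : G => x * k⁻¹)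
    (hp.mdifferentiableAt (by simp)) (hr.mdifferentiableAt (by simp))
  have e : (QuotientGroup.mk : G → G ⧸ K) ∘ (fun x : G => x * k⁻¹) = QuotientGroup.mk := by
    funext x
    exact QuotientGroup.eq.2 (by simpa using hk)
  rw [e] at h1
  exact (DFunLike.congr_fun h1 u).symm

end Quotient

/-! ### Descent of `π_G` to `G/K`, the criterion for c). -/

namespace InvariantManinTriple

variable {E : Type*} [NormedAddCommGroup E] [NormedSpace ℝ E] [CompleteSpace E]
  {G : Type*} [TopologicalSpace G] [ChartedSpace E G] [Group G] [LieGroup 𝓘(ℝ, E) ∞ G]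
  {𝔡 : Type*} [LieRing 𝔡] [LieAlgebra ℝ 𝔡]
  (T : InvariantManinTriple 𝓘(ℝ, E) G 𝔡)
  {K : Subgroup G} {EK : Type*} [NormedAddCommGroup EK] [NormedSpace ℝ EK]
  [ChartedSpace EK K]
  {EM : Type*} [NormedAddCommGroup EM] [NormedSpace ℝ EM]
  [ChartedSpace EM (G ⧸ K)] [IsManifold 𝓘(ℝ, EM) ∞ (G ⧸ K)]

section

variable (hK : Manifold.IsSmoothEmbedding 𝓘(ℝ, EK) 𝓘(ℝ, E) ∞ (Subtype.val : K → G))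
  (hp : Manifold.IsSubmersion 𝓘(ℝ, E) 𝓘(ℝ, EM) ∞ (QuotientGroup.mk : G → G ⧸ K))
include hK hp

theorem exists_comp_tangentLin_mk_eq_covector_iff (g : G) {w : 𝔡} (hw : w ∈ T.𝔥) :
    (∃ η : Module.Dual ℝ EM, (tangentLin 𝓘(ℝ, E) 𝓘(ℝ, EM) (QuotientGroup.mk : G → G ⧸ K) g).dualMap
      η = T.covector g w) ↔ w ∈ T.𝔨o K EK := by
  constructor
  · rintro ⟨η, hη⟩
    refine T.mem_ann.2 ⟨hw, fun v hv => ?_⟩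
    rw [← T.covector_leftTranslate g, ← hη]
    exact (congrArg η ((tangentLin_mk_leftTranslate_eq_zero_iff hK hp g v).2 hv)).trans
      (map_zero η)
  · intro h
    have h1 : T.covector g w ∈ LinearMap.range
        (tangentLin 𝓘(ℝ, E) 𝓘(ℝ, EM) (QuotientGroup.mk : G → G ⧸ K) g).dualMap := by
      rw [LinearMap.range_dualMap_eq_dualAnnihilator_ker, Submodule.mem_dualAnnihilator]
      intro u hu
      obtain ⟨v, rfl⟩ := leftTranslate_surjective g u
      rw [T.covector_leftTranslate]
      exact (T.mem_ann.1 h).2 v ((tangentLin_mk_leftTranslate_eq_zero_iff hK hp g v).1 hu)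
    exact h1

variable [FiniteDimensional ℝ 𝔡] [FiniteDimensional ℝ E]

/-- As `p` is invariant under right translation by `K`, the two push-forwards differ by the image of
`pr (Ad_{k⁻¹} w)`, and the kernel of the tangent map is `𝔨`. -/
theorem pushSharp_mul_inv_eq_iff {k : G} (hk : k ∈ K) (g : G) {w : 𝔡} (hw : w ∈ T.𝔥)
    {η : Module.Dual ℝ EM}
    (hη : (tangentLin 𝓘(ℝ, E) 𝓘(ℝ, EM) (QuotientGroup.mk : G → G ⧸ K) (g * k⁻¹)).dualMap η =
      T.covector (g * k⁻¹) w) :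
    T.bivector.pushSharp (QuotientGroup.mk : G → G ⧸ K) (g * k⁻¹) η =
        T.bivector.pushSharp (QuotientGroup.mk : G → G ⧸ K) g η ↔
      T.pr (T.Ad k⁻¹ w) ∈ subgroupLieAlgebra 𝓘(ℝ, E) 𝓘(ℝ, EK) K := by
  obtain ⟨v, hv⟩ := leftTranslate_surjective g
    (T.bivector.sharp g (T.covector g (T.coadjoint k w)))
  have hη' : (tangentLin 𝓘(ℝ, E) 𝓘(ℝ, EM) (QuotientGroup.mk : G → G ⧸ K) g).dualMap η =
      T.covector g (T.coadjoint k w) := by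
    rw [← T.covector_comp_tangentLin, ← hη]
    ext u
    exact congrArg η (tangentLin_mk_mul_right hp.contMDiff hk g u).symm
  have e1 : T.bivector.pushSharp (QuotientGroup.mk : G → G ⧸ K) g η =
      (tangentLin 𝓘(ℝ, E) 𝓘(ℝ, EM) (QuotientGroup.mk : G → G ⧸ K) g (leftTranslate g v) : EM) := by
    rw [hv, ← hη']
    rfl
  have e2 : T.bivector.pushSharp (QuotientGroup.mk : G → G ⧸ K) (g * k⁻¹) η =
      (tangentLin 𝓘(ℝ, E) 𝓘(ℝ, EM) (QuotientGroup.mk : G → G ⧸ K) g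
        (leftTranslate g (v + T.pr (T.Ad k⁻¹ w))) : EM) := by
    refine Eq.trans ?_ (tangentLin_mk_mul_right hp.contMDiff hk g _)
    have h1 := tangentLin_mul_right k g (v + T.pr (T.Ad k⁻¹ w))
    refine Eq.trans ?_ (congrArg (tangentLin 𝓘(ℝ, E) 𝓘(ℝ, EM)
      (QuotientGroup.mk : G → G ⧸ K) (g * k⁻¹)) h1.symm)
    rw [← T.sharp_mul_inv k g hw hv.symm, ← hη]
    rfl
  rw [e1, e2, ← tangentLin_mk_leftTranslate_eq_zero_iff hK hp g, map_add, map_add]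
  exact add_eq_left

theorem exists_pushes_mk_iff :
    (∃ πM : BivectorField 𝓘(ℝ, EM) (G ⧸ K), πM.IsPoisson ∧
        T.bivector.Pushes (QuotientGroup.mk : G → G ⧸ K) πM) ↔
      ∀ k ∈ K, ∀ w ∈ T.𝔨o K EK, T.pr (T.Ad k w) ∈ subgroupLieAlgebra 𝓘(ℝ, E) 𝓘(ℝ, EK) K := by
  have hs : Function.Surjective (QuotientGroup.mk : G → G ⧸ K) := QuotientGroup.mk_surjective
  have h1 : (∃ πM : BivectorField 𝓘(ℝ, EM) (G ⧸ K), πM.IsPoisson ∧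
      T.bivector.Pushes (QuotientGroup.mk : G → G ⧸ K) πM) ↔
      ∃ πM : BivectorField 𝓘(ℝ, EM) (G ⧸ K),
        T.bivector.Pushes (QuotientGroup.mk : G → G ⧸ K) πM :=
    exists_congr fun πM => and_iff_right_of_imp fun h => h.isPoisson hp hs T.isPoisson_bivector
  rw [h1, BivectorField.exists_pushes_iff _ hs]
  constructor
  · intro h k hk w hw
    obtain ⟨η, hη⟩ := (T.exists_comp_tangentLin_mk_eq_covector_iff hK hp (1 * k⁻¹⁻¹)
      (T.ann_le hw)).2 hw
    have := (T.pushSharp_mul_inv_eq_iff hK hp (K.inv_mem hk) 1 (T.ann_le hw) hη).1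
      (h _ _ (QuotientGroup.eq.2 (by simpa using hk)) η)
    rwa [inv_inv] at this
  · intro h x y hxy η
    obtain ⟨k, hk, rfl⟩ : ∃ k ∈ K, x = y * k⁻¹ :=
      ⟨x⁻¹ * y, QuotientGroup.eq.1 hxy, by simp⟩
    obtain ⟨w, hw, e⟩ := T.exists_covector_eq (y * k⁻¹)
      ((tangentLin 𝓘(ℝ, E) 𝓘(ℝ, EM) (QuotientGroup.mk : G → G ⧸ K) (y * k⁻¹)).dualMap η)
    exact (T.pushSharp_mul_inv_eq_iff hK hp hk y hw e.symm).2 (h _ (K.inv_mem hk) w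
      ((T.exists_comp_tangentLin_mk_eq_covector_iff hK hp _ hw).1 ⟨η, e.symm⟩))

end

end InvariantManinTriple

/-! ### Induced structures on the fibres, and the complement of `𝔨` in `𝔨 ⊕ 𝔥`. -/

namespace InvariantManinTriple

variable {E : Type*} [NormedAddCommGroup E] [NormedSpace ℝ E] [CompleteSpace E]
  {G : Type*} [TopologicalSpace G] [ChartedSpace E G] [Group G] [LieGroup 𝓘(ℝ, E) ∞ G]
  {𝔡 : Type*} [LieRing 𝔡] [LieAlgebra ℝ 𝔡]
  (T : InvariantManinTriple 𝓘(ℝ, E) G 𝔡)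
  {K : Subgroup G} {EK : Type*} [NormedAddCommGroup EK] [NormedSpace ℝ EK]
  [ChartedSpace EK K]

theorem inclK_mem_𝔥
    (hi : Function.Injective (subgroupIncl E K EK)) {u : GroupLieAlgebra 𝓘(ℝ, EK) K}
    (hu : T.inclK K EK u ∈ T.𝔥) : u = 0 :=
  (map_eq_zero_iff _ hi).1 (T.incl_mem_𝔥 hu)

section Induced

variable [LieGroup 𝓘(ℝ, EK) ∞ K] [FiniteDimensional ℝ E] [FiniteDimensional ℝ 𝔡]

/-- The condition that a bivector field on `K` is induced by the embedding of `K` as a fibre, in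
left trivialization. -/
theorem isInduced_fibreEmbedding_iff
    (hv : ContMDiff 𝓘(ℝ, EK) 𝓘(ℝ, E) ∞ (Subtype.val : K → G)) (g : G)
    (π : BivectorField 𝓘(ℝ, EK) K) :
    BivectorField.IsInduced (fibreEmbedding K g) T.bivector π ↔
      ∀ (k : K) (u : GroupLieAlgebra 𝓘(ℝ, EK) K) (ξ : Module.Dual ℝ (GroupLieAlgebra 𝓘(ℝ, EK) K)),
        π.leftSharp k ξ = u ↔ ∃ w ∈ T.𝔥, T.Ad (g * k) (w - T.inclK K EK u) ∈ T.𝔥 ∧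
          ∀ v, T.pairing (T.inclK K EK v) w = ξ v := by
  have key : ∀ (k : K) (u : GroupLieAlgebra 𝓘(ℝ, EK) K)
      (ξ : Module.Dual ℝ (GroupLieAlgebra 𝓘(ℝ, EK) K)),
      ((π.leftSharp k ξ = u ↔ ∃ w ∈ T.𝔥, T.Ad (g * k) (w - T.inclK K EK u) ∈ T.𝔥 ∧
          ∀ v, T.pairing (T.inclK K EK v) w = ξ v) ↔
        (π.sharp k ((maurerCartan 𝓘(ℝ, EK) k).dualMap ξ) = leftTranslate k u ↔
          ∃ ζ : Module.Dual ℝ (TangentSpace 𝓘(ℝ, E) (fibreEmbedding K g k)),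
            T.bivector.sharp (fibreEmbedding K g k) ζ =
              tangentLin 𝓘(ℝ, EK) 𝓘(ℝ, E) (fibreEmbedding K g) k (leftTranslate k u) ∧
            (maurerCartan 𝓘(ℝ, EK) k).dualMap ξ =
              ζ ∘ₗ tangentLin 𝓘(ℝ, EK) 𝓘(ℝ, E) (fibreEmbedding K g) k)) := by
    intro k u ξ
    have hc : ∀ w v, T.covector (g * k) w (tangentLin 𝓘(ℝ, EK) 𝓘(ℝ, E) (fibreEmbedding K g) k
        (leftTranslate k v)) = T.pairing (T.inclK K EK v) w := fun w v =>
      (congrArg (T.covector (g * k) w) (tangentLin_fibreEmbedding hv g k v)).trans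
        (T.covector_leftTranslate _ _ _)
    have hiff : ∀ w ∈ T.𝔥, (T.bivector.sharp (g * k) (T.covector (g * k) w) =
        tangentLin 𝓘(ℝ, EK) 𝓘(ℝ, E) (fibreEmbedding K g) k (leftTranslate k u) ↔
        T.Ad (g * k) (w - T.inclK K EK u) ∈ T.𝔥) := fun w hw =>
      (Eq.congr_right (tangentLin_fibreEmbedding hv g k u)).trans
        (T.sharp_covector_eq_iff (g * k) hw (subgroupIncl E K EK u))
    refine iff_congr ?_ ⟨?_, ?_⟩
    · rw [← leftTranslate_leftSharp, (leftTranslate_injective k).eq_iff]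
    · rintro ⟨w, hw, h1, h2⟩
      refine ⟨T.covector (g * k) w, (hiff w hw).2 h1, ?_⟩
      ext x
      obtain ⟨v, rfl⟩ := leftTranslate_surjective k x
      refine Eq.trans ?_ (((hc w v).trans (h2 v)).symm)
      exact congrArg ξ (maurerCartan_leftTranslate k v)
    · rintro ⟨ζ, h1, h2⟩
      obtain ⟨w, hw, rfl⟩ := T.exists_covector_eq (g * k) ζ
      refine ⟨w, hw, (hiff w hw).1 h1, fun v => (hc w v).symm.trans ?_⟩
      refine (DFunLike.congr_fun h2 (leftTranslate k v)).symm.trans ?_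
      exact congrArg ξ (maurerCartan_leftTranslate k v)
  constructor
  · exact fun h k u ξ => (key k u ξ).2 (h k _ _)
  · intro h k u η
    obtain ⟨u, rfl⟩ := leftTranslate_surjective k u
    have := (key k u (η ∘ₗ leftTranslate k)).1 (h k u _)
    have e : (maurerCartan 𝓘(ℝ, EK) k).dualMap (η ∘ₗ leftTranslate k) = η := by
      ext x
      exact congrArg η (leftTranslate_maurerCartan k x)
    rwa [e] at this

variable {T} in
-- If `Ad_g x = u + w` with `u ∈ 𝔨`, `w ∈ 𝔨°`, then `w` restricts to the zero covector on `𝔨`, and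
-- `Ad_{g⁻¹} (w + u) = x ∈ 𝔥` makes `-u` its image under the induced bivector at `g⁻¹`. Hence `u =
-- 0`.
theorem Ad_mem_ann_of_isInduced
    (hv : ContMDiff 𝓘(ℝ, EK) 𝓘(ℝ, E) ∞ (Subtype.val : K → G)) {g : G}
    {π : BivectorField 𝓘(ℝ, EK) K}
    (h : BivectorField.IsInduced (fibreEmbedding K g⁻¹) T.bivector π) {x : 𝔡} (hx : x ∈ T.𝔥)
    (hgx : T.Ad g x ∈ T.𝔨d K EK ⊔ T.𝔨o K EK) : T.Ad g x ∈ T.𝔨o K EK := by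
  obtain ⟨_, hu, w, hw, e⟩ := Submodule.mem_sup.1 hgx
  obtain ⟨u, rfl⟩ := T.exists_inclK_eq hu
  have h1 := ((T.isInduced_fibreEmbedding_iff hv g⁻¹ π).1 h 1 (-u) 0).2 ⟨w, T.ann_le hw, by
    rw [map_neg, sub_neg_eq_add, add_comm, e, OneMemClass.coe_one, mul_one, map_inv_map]
    exact hx, fun v => T.pairing_inclK v hw⟩
  rw [map_zero, eq_comm, neg_eq_zero] at h1
  rw [← e, h1, map_zero, zero_add]
  exact hw

variable {T} in
theorem Ad_mem_𝔥_of_isInduced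
    (hv : ContMDiff 𝓘(ℝ, EK) 𝓘(ℝ, E) ∞ (Subtype.val : K → G)) {g : G}
    {π : BivectorField 𝓘(ℝ, EK) K}
    (h : BivectorField.IsInduced (fibreEmbedding K g⁻¹) T.bivector π) (h0 : π.sharp 1 = 0)
    {x : 𝔡} (hx : x ∈ T.𝔥) (hgx : T.Ad g x ∈ T.𝔨d K EK ⊔ T.𝔥.toSubmodule) : T.Ad g x ∈ T.𝔥 := by
  obtain ⟨_, hu, y, hy, e⟩ := Submodule.mem_sup.1 hgx
  obtain ⟨u, rfl⟩ := T.exists_inclK_eq hu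
  have h1 := ((T.isInduced_fibreEmbedding_iff hv g⁻¹ π).1 h 1 (-u)
    (T.pairing.flip y ∘ₗ T.inclK K EK)).2 ⟨y, hy, by
    rw [map_neg, sub_neg_eq_add, add_comm, e, OneMemClass.coe_one, mul_one, map_inv_map]
    exact hx, fun v => rfl⟩
  rw [BivectorField.leftSharp, h0, LinearMap.zero_comp, LinearMap.comp_zero,
    LinearMap.zero_apply, eq_comm, neg_eq_zero] at h1
  rw [← e, h1, map_zero, zero_add]
  exact hy

variable {T} in
-- A value `u` of the induced bivector comes with `w ∈ 𝔥` such that `w - u ∈ Ad_{(g k)⁻¹} 𝔥 ∩ (𝔨 ⊕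
-- 𝔥)`. By `hT` this lies in `𝔥`, so `u ∈ 𝔤 ∩ 𝔥 = 0`.
theorem sharp_eq_zero_of_isInduced
    (hv : ContMDiff 𝓘(ℝ, EK) 𝓘(ℝ, E) ∞ (Subtype.val : K → G))
    (hi : Function.Injective (subgroupIncl E K EK)) {g : G}
    {π : BivectorField 𝓘(ℝ, EK) K}
    (h : BivectorField.IsInduced (fibreEmbedding K g) T.bivector π)
    (hT : ∀ (g : G), ∀ x ∈ T.𝔥, T.Ad g x ∈ T.𝔨d K EK ⊔ T.𝔥.toSubmodule → T.Ad g x ∈ T.𝔥) (k : K) :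
    π.sharp k = 0 := by
  have h1 : ∀ ξ, π.leftSharp k ξ = 0 := by
    intro ξ
    obtain ⟨w, hw, h2, -⟩ := ((T.isInduced_fibreEmbedding_iff hv g π).1 h k _ ξ).1 rfl
    have h3 := hT (g * k)⁻¹ _ h2
    rw [map_inv_map] at h3
    have h4 := h3 (Submodule.sub_mem _ (Submodule.mem_sup_right hw)
      (Submodule.mem_sup_left (T.inclK_mem _)))
    have h5 := T.𝔥.sub_mem hw h4
    rw [sub_sub_cancel] at h5
    exact T.inclK_mem_𝔥 hi h5
  ext η
  have e : (maurerCartan 𝓘(ℝ, EK) k).dualMap (η ∘ₗ leftTranslate k) = η := by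
    ext x
    exact congrArg η (leftTranslate_maurerCartan k x)
  rw [← e, ← leftTranslate_leftSharp, h1, map_zero]
  rfl

end Induced

section Complement

variable (EK K) in
/-- The subspace `(Ad_{g⁻¹} 𝔥 ∩ (𝔨 ⊕ 𝔥)) + 𝔨°` of `𝔨 ⊕ 𝔥`. -/
def fibreComplement (g : G) : Submodule ℝ 𝔡 :=
  (T.𝔥.toSubmodule.comap (T.Ad g) ⊓ (T.𝔨d K EK ⊔ T.𝔥.toSubmodule)) ⊔ T.𝔨o K EK

theorem pairing_of_mem_sup {x w : 𝔡} (hx : x ∈ T.𝔨d K EK ⊔ T.𝔥.toSubmodule)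
    (hw : w ∈ T.𝔨o K EK) : T.pairing x w = 0 := by
  obtain ⟨_, hv, y, hy, rfl⟩ := Submodule.mem_sup.1 hx
  obtain ⟨v, rfl⟩ := T.exists_inclK_eq hv
  rw [map_add, LinearMap.add_apply, T.pairing_inclK v hw, T.pairing_𝔥 hy (T.ann_le hw), add_zero]

theorem pairing_fibreComplement (g : G) {x y : 𝔡} (hx : x ∈ T.fibreComplement K EK g)
    (hy : y ∈ T.fibreComplement K EK g) : T.pairing x y = 0 := by
  obtain ⟨a, ⟨ha, ha'⟩, b, hb, rfl⟩ := Submodule.mem_sup.1 hx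
  obtain ⟨c, ⟨hc, hc'⟩, d, hd, rfl⟩ := Submodule.mem_sup.1 hy
  have h1 : T.pairing a c = 0 := by
    rw [← T.Ad_pairing g]
    exact T.pairing_𝔥 ha hc
  simp only [map_add, LinearMap.add_apply, h1, T.pairing_of_mem_sup ha' hd,
    T.pairing_symm b c, T.pairing_of_mem_sup hc' hb, T.pairing_𝔥 (T.ann_le hb) (T.ann_le hd),
    add_zero]

theorem disjoint_fibreComplement {g : G}
    (hg : ∀ x, T.Ad g x ∈ T.𝔥 → x ∈ T.𝔨d K EK ⊔ T.𝔨o K EK → x ∈ T.𝔨o K EK) :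
    Disjoint (T.𝔨d K EK) (T.fibreComplement K EK g) := by
  rw [Submodule.disjoint_def]
  intro u hu hu'
  obtain ⟨a, ⟨ha, -⟩, b, hb, rfl⟩ := Submodule.mem_sup.1 hu'
  have h1 : a ∈ T.𝔨o K EK := by
    refine hg a ha ?_
    rw [← add_sub_cancel_right a b]
    exact Submodule.sub_mem _ (Submodule.mem_sup_left hu) (Submodule.mem_sup_right hb)
  obtain ⟨v, -, e⟩ := hu
  have h2 : T.incl v ∈ T.𝔥 := by
    rw [show T.incl v = a + b from e]
    exact T.ann_le (Submodule.add_mem _ h1 hb)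
  rw [← e, T.incl_mem_𝔥 h2, map_zero]

section

variable [LieGroup 𝓘(ℝ, EK) ∞ K]
  (hv : ContMDiff 𝓘(ℝ, EK) 𝓘(ℝ, E) ∞ (Subtype.val : K → G))
  (hL : ∀ v ∈ T.𝔨d K EK, ∀ w ∈ T.𝔨o K EK, ⁅v, w⁆ ∈ T.𝔥)
include hv hL

theorem lie_mem_ann_of_mem_sup {x w : 𝔡} (hx : x ∈ T.𝔨d K EK ⊔ T.𝔥.toSubmodule)
    (hw : w ∈ T.𝔨o K EK) : ⁅x, w⁆ ∈ T.𝔨o K EK := by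
  obtain ⟨v, hv', y, hy, rfl⟩ := Submodule.mem_sup.1 hx
  rw [add_lie]
  refine Submodule.add_mem _ (T.mem_ann.2 ⟨hL v hv' w hw, ?_⟩) (T.ann_isIdeal_iff.2 hL y hy w hw)
  exact fun u hu => T.pairing_lie_𝔨d hv hv' ⟨u, hu, rfl⟩ hw

variable [FiniteDimensional ℝ 𝔡]

theorem lie_mem_sup {x y : 𝔡} (hx : x ∈ T.𝔨d K EK ⊔ T.𝔥.toSubmodule)
    (hy : y ∈ T.𝔨d K EK ⊔ T.𝔥.toSubmodule) : ⁅x, y⁆ ∈ T.𝔨d K EK ⊔ T.𝔥.toSubmodule := by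
  refine T.mem_sup_of_pairing_ann fun w hw => ?_
  have h1 := T.pairing_invariant x y w
  rwa [T.pairing_of_mem_sup hy (T.lie_mem_ann_of_mem_sup hv hL hx hw), add_zero] at h1

/-- The sum of a subalgebra of `𝔨 ⊕ 𝔥` and the ideal `𝔨°` of it. -/
theorem lie_mem_fibreComplement (g : G) {x y : 𝔡} (hx : x ∈ T.fibreComplement K EK g)
    (hy : y ∈ T.fibreComplement K EK g) : ⁅x, y⁆ ∈ T.fibreComplement K EK g := by
  obtain ⟨a, ⟨ha, ha'⟩, b, hb, rfl⟩ := Submodule.mem_sup.1 hx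
  obtain ⟨c, ⟨hc, hc'⟩, d, hd, rfl⟩ := Submodule.mem_sup.1 hy
  rw [add_lie, lie_add, add_assoc]
  refine Submodule.add_mem_sup ⟨?_, T.lie_mem_sup hv hL ha' hc'⟩ (Submodule.add_mem _
    (T.lie_mem_ann_of_mem_sup hv hL ha' hd) ?_)
  · change T.Ad g ⁅a, c⁆ ∈ T.𝔥
    rw [T.Ad_lie]
    exact T.𝔥.lie_mem ha hc
  · rw [← lie_skew]
    refine Submodule.neg_mem _ (T.lie_mem_ann_of_mem_sup hv hL (Submodule.add_mem _ hc'
      (Submodule.mem_sup_right (T.ann_le hd))) hb)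

theorem Ad_mem_sup [PreconnectedSpace K] (k : K) {y : 𝔡} (hy : y ∈ T.𝔥) :
    T.Ad k y ∈ T.𝔨d K EK ⊔ T.𝔥.toSubmodule := by
  refine T.mem_sup_of_pairing_ann fun w hw => ?_
  have h1 := T.Ad_mem_𝔨o hv hL k⁻¹ hw
  rw [← map_map_inv (Ad := T.Ad) (k : G) w, T.Ad_pairing]
  exact T.pairing_𝔥 hy (T.ann_le h1)

end

variable [FiniteDimensional ℝ 𝔡]

/-- Anything orthogonal to `𝔨`, `𝔨°` and `Ad_{g⁻¹} 𝔥` lies in `Ad_{g⁻¹} 𝔥 ∩ (𝔨 ⊕ 𝔨°)`, hence by `hg`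
in `𝔨°`, which is orthogonal to `𝔥`. So `𝔥 ⊆ 𝔨 + 𝔨° + Ad_{g⁻¹} 𝔥`, and the last component is
automatically in `𝔨 ⊕ 𝔥`. -/
theorem le_sup_fibreComplement {g : G}
    (hg : ∀ x, T.Ad g x ∈ T.𝔥 → x ∈ T.𝔨d K EK ⊔ T.𝔨o K EK → x ∈ T.𝔨o K EK) :
    T.𝔨d K EK ⊔ T.𝔥.toSubmodule ≤ T.𝔨d K EK ⊔ T.fibreComplement K EK g := by
  refine sup_le le_sup_left fun y hy => ?_
  have h1 : y ∈ T.𝔨d K EK ⊔ T.𝔨o K EK ⊔ T.𝔥.toSubmodule.comap (T.Ad g) := by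
    refine T.mem_of_pairing _ fun z hz => T.pairing_𝔥 hy (T.ann_le (hg z ?_ ?_))
    · refine T.mem_𝔥_of_pairing fun x hx => ?_
      rw [← map_map_inv (Ad := T.Ad) g x, T.Ad_pairing]
      refine hz _ (Submodule.mem_sup_right ?_)
      change T.Ad g (T.Ad g⁻¹ x) ∈ T.𝔥
      rwa [map_map_inv]
    · obtain ⟨b, hb, e⟩ := T.exists_eq_incl_add_of_pairing
        (𝔨 := subgroupLieAlgebra 𝓘(ℝ, E) 𝓘(ℝ, EK) K) (x := z) (fun v hv =>
          hz _ (Submodule.mem_sup_left (Submodule.mem_sup_left ⟨v, hv, rfl⟩)))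
      have h2 : z ∈ T.𝔨d K EK ⊔ T.𝔥.toSubmodule := T.mem_sup_of_pairing_ann fun w hw => by
        rw [T.pairing_symm]
        exact hz _ (Submodule.mem_sup_left (Submodule.mem_sup_right hw))
      rw [e]
      exact Submodule.add_mem_sup ⟨_, T.pr_mem_of_mem_sup h2, rfl⟩ hb
  obtain ⟨_, hab, c, hc, e⟩ := Submodule.mem_sup.1 h1
  obtain ⟨a, ha, b, hb, rfl⟩ := Submodule.mem_sup.1 hab
  have hc' : c ∈ T.𝔨d K EK ⊔ T.𝔥.toSubmodule := by
    rw [eq_sub_of_add_eq' e]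
    exact Submodule.sub_mem _ (Submodule.mem_sup_right hy) (Submodule.add_mem_sup ha (T.ann_le hb))
  rw [← e, add_assoc, add_comm b]
  exact Submodule.add_mem_sup ha (Submodule.add_mem_sup ⟨hc, hc'⟩ hb)

end Complement

end InvariantManinTriple

theorem exists_projection_of_disjoint {V : Type*} [AddCommGroup V] [Module ℝ V]
    {A B : Submodule ℝ V} (h : Disjoint A B) :
    ∃ P : V →ₗ[ℝ] V, (∀ x, P x ∈ A) ∧ (∀ x ∈ A, P x = x) ∧ (∀ x ∈ B, P x = 0) ∧
      ∀ x ∈ A ⊔ B, x - P x ∈ B := by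
  obtain ⟨B', hB, hc⟩ := h.symm.exists_isCompl
  have h1 : ∀ x ∈ A, Submodule.projection A B' hc.symm x = x := fun x hx =>
    Submodule.projection_apply_left hc.symm ⟨x, hx⟩
  have h2 : ∀ x ∈ B, Submodule.projection A B' hc.symm x = 0 := fun x hx =>
    (Submodule.projection_apply_eq_zero_iff hc.symm).2 (hB hx)
  refine ⟨Submodule.projection A B' hc.symm, fun x => Submodule.projection_apply_mem hc.symm x,
    h1, h2, fun x hx => ?_⟩
  obtain ⟨a, ha, b, hb, rfl⟩ := Submodule.mem_sup.1 hx
  rw [map_add, h1 a ha, h2 b hb, add_zero, add_sub_cancel_left]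
  exact hb

/-! ### Fibres are Poisson-Dirac: construction of the induced structure. -/

namespace InvariantManinTriple

variable {E : Type*} [NormedAddCommGroup E] [NormedSpace ℝ E] [CompleteSpace E]
  {G : Type*} [TopologicalSpace G] [ChartedSpace E G] [Group G] [LieGroup 𝓘(ℝ, E) ∞ G]
  {𝔡 : Type*} [LieRing 𝔡] [LieAlgebra ℝ 𝔡]
  (T : InvariantManinTriple 𝓘(ℝ, E) G 𝔡)
  {K : Subgroup G} {EK : Type*} [NormedAddCommGroup EK] [NormedSpace ℝ EK]
  [ChartedSpace EK K]

section

variable (hi : Function.Injective (subgroupIncl E K EK))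
include hi

theorem exists_leftInverse_inclK :
    ∃ r : 𝔡 →ₗ[ℝ] GroupLieAlgebra 𝓘(ℝ, EK) K, ∀ x ∈ T.𝔨d K EK, T.inclK K EK (r x) = x := by
  have h : Function.Injective (T.inclK K EK) := T.incl_injective.comp hi
  obtain ⟨r, hr⟩ := LinearMap.exists_leftInverse_of_injective _ (LinearMap.ker_eq_bot.2 h)
  refine ⟨r, fun x hx => ?_⟩
  obtain ⟨v, rfl⟩ := T.exists_inclK_eq hx
  exact congrArg (T.inclK K EK) (DFunLike.congr_fun hr v)

variable [FiniteDimensional ℝ 𝔡] [FiniteDimensional ℝ E]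

theorem exists_pairing_section : ∃ s : Module.Dual ℝ (GroupLieAlgebra 𝓘(ℝ, EK) K) →ₗ[ℝ] 𝔡,
    (∀ ξ, s ξ ∈ T.𝔥) ∧ ∀ ξ v, T.pairing (T.inclK K EK v) (s ξ) = ξ v := by
  let R : T.𝔥.toSubmodule →ₗ[ℝ] Module.Dual ℝ (GroupLieAlgebra 𝓘(ℝ, EK) K) :=
    LinearMap.flip (T.pairing ∘ₗ T.inclK K EK) ∘ₗ T.𝔥.toSubmodule.subtype
  have hR : Function.Surjective R := by
    intro ξ
    obtain ⟨ζ, rfl⟩ := LinearMap.dualMap_surjective_of_injective hi ξ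
    obtain ⟨w, hw, e⟩ := T.exists_pairing_eq ζ
    exact ⟨⟨w, hw⟩, LinearMap.ext fun v => e _⟩
  obtain ⟨s, hs⟩ := LinearMap.exists_rightInverse_of_surjective R (LinearMap.range_eq_top.2 hR)
  exact ⟨T.𝔥.toSubmodule.subtype ∘ₗ s, fun ξ => (s ξ).2,
    fun ξ v => DFunLike.congr_fun (DFunLike.congr_fun hs ξ) v⟩

theorem isPoissonDirac_fibreEmbedding [T2Space G] [LieGroup 𝓘(ℝ, EK) ∞ K] [FiniteDimensional ℝ EK]
    [CompleteSpace EK] [PreconnectedSpace K]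
    (hv : ContMDiff 𝓘(ℝ, EK) 𝓘(ℝ, E) ∞ (Subtype.val : K → G))
    (hL : ∀ v ∈ T.𝔨d K EK, ∀ w ∈ T.𝔨o K EK, ⁅v, w⁆ ∈ T.𝔥) {g : G}
    (hg : ∀ x, T.Ad g x ∈ T.𝔥 → x ∈ T.𝔨d K EK ⊔ T.𝔨o K EK → x ∈ T.𝔨o K EK) :
    BivectorField.IsPoissonDirac 𝓘(ℝ, EK) (fibreEmbedding K g) T.bivector := by
  obtain ⟨P, hPK, hP1, hP0, hPL⟩ := exists_projection_of_disjoint (T.disjoint_fibreComplement hg)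
  obtain ⟨s, hs𝔥, hs⟩ := T.exists_pairing_section hi
  obtain ⟨r, hr⟩ := T.exists_leftInverse_inclK hi
  have hsup := T.le_sup_fibreComplement hg
  have hAds : ∀ (k : K) ξ, T.Ad k (s ξ) ∈ T.𝔨d K EK ⊔ T.𝔥.toSubmodule :=
    fun k ξ => T.Ad_mem_sup hv hL k (hs𝔥 ξ)
  have h₁ : ∀ x y, T.pairing (P x) (P y) = 0 := by
    intro x y
    obtain ⟨u, -, hu⟩ := hPK x
    obtain ⟨v, -, hv⟩ := hPK y
    rw [← hu, ← hv]
    exact T.pairing_incl u v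
  have h₂ : ∀ x ∈ T.𝔨d K EK ⊔ T.𝔥.toSubmodule, ∀ y ∈ T.𝔨d K EK ⊔ T.𝔥.toSubmodule,
      T.pairing (x - P x) (y - P y) = 0 := fun x hx y hy =>
    T.pairing_fibreComplement g (hPL x (hsup hx)) (hPL y (hsup hy))
  have hPskew : ∀ x ∈ T.𝔨d K EK ⊔ T.𝔥.toSubmodule, ∀ y ∈ T.𝔨d K EK ⊔ T.𝔥.toSubmodule,
      T.pairing x y = 0 → T.pairing (P x) y = -T.pairing (P y) x := by
    intro x hx y hy h0
    have e := h₂ x hx y hy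
    simp only [map_sub, LinearMap.sub_apply, h0, h₁] at e
    rw [T.pairing_symm x (P y)] at e
    linarith
  -- The bivector `Ad_{k⁻¹} P Ad_k` applied to a lift of the covector to `𝔥`; `P` depends only on
  -- the base point `g` of the fibre.
  let Z : K → Module.Dual ℝ (GroupLieAlgebra 𝓘(ℝ, EK) K) →ₗ[ℝ] GroupLieAlgebra 𝓘(ℝ, EK) K :=
    fun k => r ∘ₗ T.Ad (k : G)⁻¹ ∘ₗ P ∘ₗ T.Ad k ∘ₗ s
  have hZ : ∀ k ξ, T.inclK K EK (Z k ξ) = T.Ad (k : G)⁻¹ (P (T.Ad k (s ξ))) :=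
    fun k ξ => hr _ (T.Ad_mem_𝔨d hv k⁻¹ (hPK _))
  have hZskew : ∀ k (ξ η : Module.Dual ℝ (GroupLieAlgebra 𝓘(ℝ, EK) K)), ξ (Z k η) = -η (Z k ξ) := by
    intro k ξ η
    have e : ∀ ξ η : Module.Dual ℝ (GroupLieAlgebra 𝓘(ℝ, EK) K), ξ (Z k η) = T.pairing (P (T.Ad k (s η))) (T.Ad k (s ξ)) := by
      intro ξ η
      rw [← hs ξ, hZ, ← T.Ad_pairing k, map_map_inv]
    rw [e, e]
    refine hPskew _ (hAds k η) _ (hAds k ξ) ?_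
    rw [T.Ad_pairing]
    exact T.pairing_𝔥 (hs𝔥 η) (hs𝔥 ξ)
  let π : BivectorField 𝓘(ℝ, EK) K :=
    ⟨fun k => leftTranslate k ∘ₗ Z k ∘ₗ (leftTranslate k).dualMap,
      fun k ξ η => hZskew k ((leftTranslate k).dualMap ξ) ((leftTranslate k).dualMap η)⟩
  have hπ : ∀ k ξ, π.leftSharp k ξ = Z k ξ := by
    intro k ξ
    refine (maurerCartan_leftTranslate k _).trans (congrArg (Z k) ?_)
    ext v
    exact congrArg ξ (maurerCartan_leftTranslate k v)
  let 𝔠 : LieSubalgebra ℝ 𝔡 :=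
    { T.𝔨d K EK ⊔ T.𝔥.toSubmodule with
      lie_mem' := fun hx hy => T.lie_mem_sup hv hL hx hy }
  refine ⟨π, ?_, ?_⟩
  · refine isPoisson_of_projection (T.integratesAd_subgroup hv) ?_ T.pairing_symm
      T.pairing_invariant (fun k => T.Ad_pairing k) (fun k => T.Ad_lie k) P 𝔠
      (fun x _ => Submodule.mem_sup_left (hPK x)) (fun x _ y _ => h₁ x y) h₂ ?_ ?_ s
      (fun ξ v => hs ξ v) hAds
      (fun _ _ _ => T.pairing_𝔥 (T.𝔥.lie_mem (hs𝔥 _) (hs𝔥 _)) (hs𝔥 _)) ?_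
    · intro v w
      refine (congrArg T.incl (subgroupIncl_lie hv v w)).trans ?_
      exact T.incl.map_lie _ _
    · intro x _ y _ z _
      have h := T.lie_mem_𝔨d hv (hPK x) (hPK y)
      obtain ⟨u, -, hu⟩ := h
      obtain ⟨v, -, hv⟩ := hPK z
      rw [← hu, ← hv]
      exact T.pairing_incl u v
    · exact fun x hx y hy z hz => T.pairing_fibreComplement g
        (T.lie_mem_fibreComplement hv hL g (hPL x (hsup hx)) (hPL y (hsup hy))) (hPL z (hsup hz))
    · intro k ξ
      rw [hπ, hZ]
      rfl
  · rw [T.isInduced_fibreEmbedding_iff hv]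
    intro k u ξ
    rw [hπ]
    constructor
    · rintro rfl
      -- Moving the `𝔨°`-component `b` into the covector leaves its restriction to `𝔨` unchanged and
      -- puts the remainder `a` in `Ad_{g⁻¹} 𝔥`.
      obtain ⟨a, ⟨ha, -⟩, b, hb, e⟩ := Submodule.mem_sup.1 (hPL _ (hsup (hAds k ξ)))
      have hb' : T.Ad (k : G)⁻¹ b ∈ T.𝔨o K EK := T.Ad_mem_𝔨o hv hL k⁻¹ hb
      refine ⟨s ξ - T.Ad (k : G)⁻¹ b, T.𝔥.sub_mem (hs𝔥 ξ) (T.ann_le hb'), ?_, fun v => ?_⟩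
      · have h1 : T.Ad k (s ξ - T.Ad (k : G)⁻¹ b - T.inclK K EK (Z k ξ)) = a := by
          rw [hZ, map_sub, map_sub, map_map_inv, map_map_inv, sub_right_comm, ← e,
            add_sub_cancel_right]
        rw [map_mul, Module.End.mul_apply, h1]
        exact ha
      · rw [map_sub, hs, T.pairing_inclK v hb', sub_zero]
    · rintro ⟨w, hw, h1, h2⟩
      have hb : s ξ - w ∈ T.𝔨o K EK := by
        refine T.mem_ann.2 ⟨T.𝔥.sub_mem (hs𝔥 ξ) hw, ?_⟩
        rintro _ ⟨v, rfl⟩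
        have h3 : T.pairing (T.inclK K EK v) (s ξ - w) = 0 := by
          rw [map_sub, hs, h2, sub_self]
        exact h3
      have ha : T.Ad k (w - T.inclK K EK u) ∈ T.fibreComplement K EK g := by
        refine Submodule.mem_sup_left ⟨?_, ?_⟩
        · rw [map_mul] at h1
          exact h1
        · rw [map_sub]
          exact Submodule.sub_mem _ (T.Ad_mem_sup hv hL k hw)
            (Submodule.mem_sup_left (T.Ad_mem_𝔨d hv k (T.inclK_mem u)))
      -- The splitting of `Ad_k (s ξ)` into `𝔨` and the complement, on which `P` is known; it
      -- identifies `u` with `Z k ξ`.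
      have e : T.Ad k (s ξ) = T.Ad k (T.inclK K EK u) +
          (T.Ad k (w - T.inclK K EK u) + T.Ad k (s ξ - w)) := by
        rw [← map_add, ← map_add]
        congr 1
        abel
      have hP : P (T.Ad k (s ξ)) = T.Ad k (T.inclK K EK u) := by
        rw [e, map_add, hP1 _ (T.Ad_mem_𝔨d hv k (T.inclK_mem u)), hP0 _ (Submodule.add_mem _ ha
          (Submodule.mem_sup_right (T.Ad_mem_𝔨o hv hL k hb))), add_zero]
      refine (T.incl_injective.comp hi) ((hZ k ξ).trans ?_)
      rw [hP, map_inv_map]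
      rfl

end

end InvariantManinTriple

end

/-! ### Assembly of a) to d). -/

theorem mainTheorem7
    {E : Type*} [NormedAddCommGroup E] [NormedSpace ℝ E] [FiniteDimensional ℝ E] [CompleteSpace E]
    -- the Lie group `G` and the invariant Manin triple
    {G : Type*} [TopologicalSpace G] [T2Space G] [ChartedSpace E G] [Group G]
    [LieGroup 𝓘(ℝ, E) ∞ G]
    {𝔡 : Type*} [LieRing 𝔡] [LieAlgebra ℝ 𝔡] [FiniteDimensional ℝ 𝔡]
    (T : InvariantManinTriple 𝓘(ℝ, E) G 𝔡)
    -- the connected closed subgroup `K`, with its structure of an embedded submanifold of `G`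
    (K : Subgroup G) (hKclosed : IsClosed (K : Set G)) (hKconn : IsConnected (K : Set G))
    {EK : Type*} [NormedAddCommGroup EK] [NormedSpace ℝ EK] [FiniteDimensional ℝ EK]
    [ChartedSpace EK K] [IsManifold 𝓘(ℝ, EK) ∞ K]
    (hK : Manifold.IsSmoothEmbedding 𝓘(ℝ, EK) 𝓘(ℝ, E) ∞ (Subtype.val : K → G))
    -- the quotient manifold `M = G ⧸ K`, for which `p : G → M` is a submersion
    {EM : Type*} [NormedAddCommGroup EM] [NormedSpace ℝ EM] [FiniteDimensional ℝ EM]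
    [ChartedSpace EM (G ⧸ K)] [IsManifold 𝓘(ℝ, EM) ∞ (G ⧸ K)]
    (hp : Manifold.IsSubmersion 𝓘(ℝ, E) 𝓘(ℝ, EM) ∞ (QuotientGroup.mk : G → G ⧸ K))
    -- the Lie algebra of `K`, in `𝔤` and as a subspace of `𝔡`, and its annihilator in `𝔥`
    (𝔨 : Submodule ℝ (GroupLieAlgebra 𝓘(ℝ, E) G))
    (h𝔨 : 𝔨 = subgroupLieAlgebra 𝓘(ℝ, E) 𝓘(ℝ, EK) K)
    (𝔨d 𝔨o : Submodule ℝ 𝔡) (h𝔨d : 𝔨d = 𝔨.map T.incl.toLinearMap) (h𝔨o : 𝔨o = T.ann 𝔨) :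
    -- a)
    ((IsRightInvariant 𝓘(ℝ, E) K T.bivector ↔ ∀ v ∈ 𝔨d, ∀ w ∈ T.𝔥, ⁅v, w⁆ ∈ T.𝔥) ∧
      (IsRightInvariant 𝓘(ℝ, E) K T.bivector → ∀ k ∈ K, T.bivector.sharp k = 0)) ∧
    -- b)
    ((BivectorField.IsPoissonSubmanifold (I := 𝓘(ℝ, EK)) (Subtype.val : K → G) T.bivector ↔
        ∀ x ∈ T.𝔥, ∀ w ∈ 𝔨o, ⁅x, w⁆ ∈ 𝔨o) ∧
      ((∀ x ∈ T.𝔥, ∀ w ∈ 𝔨o, ⁅x, w⁆ ∈ 𝔨o) ↔ ∀ v ∈ 𝔨d, ∀ w ∈ 𝔨o, ⁅v, w⁆ ∈ T.𝔥)) ∧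
    -- c)
    ((∃ πM : BivectorField 𝓘(ℝ, EM) (G ⧸ K), πM.IsPoisson ∧
        T.bivector.Pushes (QuotientGroup.mk : G → G ⧸ K) πM) ↔
      ∀ w ∈ 𝔨o, ∀ w' ∈ 𝔨o, ⁅w, w'⁆ ∈ 𝔨o) ∧
    -- d)
    (BivectorField.IsPoissonSubmanifold (I := 𝓘(ℝ, EK)) (Subtype.val : K → G) T.bivector →
      ((∀ g : G, BivectorField.IsPoissonDirac 𝓘(ℝ, EK) (fibreEmbedding K g) T.bivector) ↔
        ∀ (g : G), ∀ x ∈ T.𝔥, T.Ad g x ∈ 𝔨d ⊔ 𝔨o → T.Ad g x ∈ 𝔨o) ∧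
      ((∀ g : G, BivectorField.IsPoissonDirac 𝓘(ℝ, EK) (fibreEmbedding K g) T.bivector) →
        ((∀ (g : G) (π : BivectorField 𝓘(ℝ, EK) K),
            BivectorField.IsInduced (fibreEmbedding K g) T.bivector π → ∀ k, π.sharp k = 0) ↔
          ∀ (g : G), ∀ x ∈ T.𝔥, T.Ad g x ∈ 𝔨d ⊔ T.𝔥.toSubmodule → T.Ad g x ∈ T.𝔥))) := by
  subst h𝔨 h𝔨d h𝔨o
  have := lieGroup_subgroup hK
  have : CompleteSpace EK := FiniteDimensional.complete ℝ EK
  have : PreconnectedSpace K := isPreconnected_iff_preconnectedSpace.1 hKconn.isPreconnected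
  have hv := hK.contMDiff
  have hi : Function.Injective (subgroupIncl E K EK) := hK.isImmersion.tangentLin_injective 1
  refine ⟨⟨(T.isRightInvariant_iff K).trans (T.Ad_mem_𝔥_iff hv), fun h k hk =>
      T.sharp_eq_zero ((T.isRightInvariant_iff K).1 h k hk)⟩,
    ⟨((T.isPoissonSubmanifold_iff hv).trans (T.Ad_𝔨o_mem_𝔥_iff hv)).trans T.ann_isIdeal_iff.symm,
      T.ann_isIdeal_iff⟩,
    (T.exists_pushes_mk_iff hK hp).trans (T.pr_Ad_mem_iff hv), fun hP => ?_⟩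
  have hL := ((T.isPoissonSubmanifold_iff hv).trans (T.Ad_𝔨o_mem_𝔥_iff hv)).1 hP
  refine ⟨⟨fun h g x hx hgx => ?_, fun h g => ?_⟩, fun hD => ⟨fun h g x hx hgx => ?_,
    fun h g π hπ k => InvariantManinTriple.sharp_eq_zero_of_isInduced hv hi hπ h k⟩⟩
  · obtain ⟨π, -, hπ⟩ := h g⁻¹
    exact InvariantManinTriple.Ad_mem_ann_of_isInduced hv hπ hx hgx
  · refine T.isPoissonDirac_fibreEmbedding hi hv hL fun x hx hx' => ?_
    have := h g⁻¹ _ hx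
    rw [map_inv_map] at this
    exact this hx'
  · obtain ⟨π, -, hπ⟩ := hD g⁻¹
    exact InvariantManinTriple.Ad_mem_𝔥_of_isInduced hv hπ (h g⁻¹ π hπ 1) hx hgx
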